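/- **Setting.** Let $\tau,\lambda\in\mathbb C$ with $\operatorname{Im}\tau>0$ and $\lambda\notin\Gamma=\mathbb Z+\mathbb Z\tau$. Put $\vartheta_1(u)=\sum_{k\in\mathbb Z}e^{\pi i\tau(k+1/2)^2+2\pi i(k+1/2)(u+1/2)}$, $\theta(u)=\vartheta_1(u)/\vartheta_1'(0)$ and $$\phi_\lambda(u)=\frac{\theta(u+\lambda)}{\theta(u)\theta(\lambda)},\qquad \zeta(u)=\frac{\theta'(u)}{\theta(u)} .$$ *Test functions.* $\mathfrak K$ denotes one of two commutative algebras. (1) $\mathfrak K=\mathcal K_0$, the germs at $0$ of meromorphic functions, with $\int s:=\operatorname{res}_0 s$. (2) $\mathfrak K=K$, the entire functions $s$ with $s(u+1)=s(u)$ and $|s(u)|\le Ce^{p|\operatorname{Im}u|}$ for some constants $C,p>0$ depending on $s$, with $\int s:=\int_{-1/2}^{1/2}s(u)\frac{du}{2\pi i}$. In both cases $\langle s,t\rangle=\int st$. *Lie algebras.* On $\mathfrak{sl}_2(\mathbb C)$ let $(x,y)=\operatorname{tr}(xy)$, with the standard basis $h,e,f$. The Lie algebra $\hat{\mathfrak g}=(\mathfrak{sl}_2\otimes\mathfrak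 K)\oplus\mathbb Cc\oplus\mathbb Cd$, with $\hat x[s]=x\otimes s$, has the bracket $$[\hat x[s],\hat y[t]]=\widehat{[x,y]}[st]+(x,y)\langle s',t\rangle c,\qquad [d,\hat x[s]]=\hat x[s'],\qquad c\ \text{central}.\tag{C}$$ It is called $\mathfrak e_\tau(\widehat{\mathfrak{sl}}_2)$ for $\mathfrak K=\mathcal K_0$ and $\mathfrak u_\tau(\widehat{\mathfrak{sl}}_2)$ for $\mathfrak K=K$ when it is considered with the half-currents below. *Green distributions.* A distribution $a(u,v)$ is given by its values $\langle a(u,v),s(u)t(v)\rangle$, $s,t\in\mathfrak K$. Call it *shifted* if its two partial actions $s\mapsto\langle a(u,v),s(u)\rangle_u$ and $t\mapsto\langle a(u,v),t(v)\rangle_v$ are linear maps into $\mathfrak K$ and $\partial_ua=-\partial_va$ (where $\langle\partial a,s\rangle=-\langle a,s'\rangle$). In case (1), put $$G(u,v)=\sum_{n\ge0}\tfrac{1}{n!}\zeta^{(n)}(u)(-v)^n,\quad G^+_\lambda(u,v)=\sum_{n\ge0}\tfrac1{n!}\phi_\lambda^{(n)}(u)(-v)^n,\quad G^-_\lambda(u,v)=-\sum_{n\ge0}u^n\,\tfrac{(-1)^n}{n!}\phi_{-\lambda}^{(n)}(v),$$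 where a summand $\alpha(u)\beta(v)$ takes the value $\langle\alpha,s\rangle\langle\beta,t\rangle$; for given $s,t$ the sums are finite. In case (2), $G$, $G^+_\lambda$, $G^-_\lambda$ take the value $$\int_{-1/2}^{1/2}\frac{dz}{2\pi i}\,t(z)\int\frac{dw}{2\pi i}\,k(w)\,s(z+w),$$ where $k=\zeta,\phi_\lambda,\phi_\lambda$, respectively, and $w$ runs over a unit horizontal segment: $w\in-\frac\tau2+[-\frac12,\frac12]$ for $G$ and $G^+_\lambda$, $w\in\frac\tau2+[-\frac12,\frac12]$ for $G^-_\lambda$. *Half-currents, $L$-operators, $r$-matrix.* Let $x(u)$ be the $\hat{\mathfrak g}$-valued distribution $\langle x(u),s(u)\rangle=\hat x[s]$, and let $$h^+(u)=\langle G(u,v)h(v)\rangle_v,\quad h^-(u)=-\langle G(v,u)h(v)\rangle_v,\quad e^\pm_\lambda(u)=\langle G^\pm_\lambda(u,v)e(v)\rangle_v,\quad f^\pm_\lambda(u)=\langle G^\pm_{-\lambda}(u,v)f(v)\rangle_v,$$ $$L^\pm_\lambda(u)=\begin{pmatrix}\frac12h^\pm(u)&f^\pm_\lambda(u)\\ e^\pm_\lambda(u)&-\frac12h^\pm(u)\end{pmatrix},\qquad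 r^+_\lambda(u,v)=\begin{pmatrix}\frac12G&0&0&0\\0&-\frac12G&G^+_{-\lambda}&0\\0&G^+_\lambda&-\frac12G&0\\0&0&0&\frac12G\end{pmatrix}(u,v).$$ Indices $1,2$ refer to the two factors of $\operatorname{End}\mathbb C^2\otimes\operatorname{End}\mathbb C^2$. Put $H=\operatorname{diag}(1,-1)$ and $h=\hat h[1]$. The operator $\partial_\lambda L^\pm_\lambda$ is obtained by differentiating the Green distributions in $\lambda$. **Theorem.** In both cases, the distributions defining the half-currents are shifted; their $\lambda$-derivatives exist and are shifted; in case (2), the entries of $r^+_\lambda$ are differentiable in $\tau$. In $\hat{\mathfrak g}$, as identities of distributions, $$[d,L^\pm_\lambda(u)]=-\partial_uL^\pm_\lambda(u),\qquad [H+h,L^\pm_\lambda(u)]=0,\tag{A}$$ $$[L^\pm_{\lambda,1}(u),L^\pm_{\lambda,2}(v)]=[L^\pm_{\lambda,1}(u)+L^\pm_{\lambda,2}(v),r^+_\lambda]+H_1\partial_\lambda L^\pm_{\lambda,2}(v)-H_2\partial_\lambda L^\pm_{\lambda,1}(u)+h\,\partial_\lambda r^+_\lambda+c\,Z,\tag{B1}$$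 $$[L^+_{\lambda,1}(u),L^-_{\lambda,2}(v)]=[L^+_{\lambda,1}(u)+L^-_{\lambda,2}(v),r^+_\lambda]+H_1\partial_\lambda L^-_{\lambda,2}(v)-H_2\partial_\lambda L^+_{\lambda,1}(u)+h\,\partial_\lambda r^+_\lambda+c\,Z',\tag{B2}$$ where $r^+_\lambda=r^+_\lambda(u,v)$, the signs in (B1) are both $+$ or both $-$, and * for $\mathfrak e_\tau(\widehat{\mathfrak{sl}}_2)$: $Z=0$ and $Z'=\partial_ur^+_\lambda$; * for $\mathfrak u_\tau(\widehat{\mathfrak{sl}}_2)$: $Z=-\partial_\tau r^+_\lambda$ and $Z'=(\partial_u-\partial_\tau)r^+_\lambda$. Moreover these relations are a way of writing the commutation relations of the algebra. Let $A$ be any complex Lie algebra with linear maps $\mathfrak K\to A$, $s\mapsto\hat x[s]$, depending linearly on $x\in\mathfrak{sl}_2$, a central element $c\in A$ and an element $d\in A$, and define half-currents and $L$-operators in $A$ by the same formulas. Then the first relation of (C) holds for all $x,y,s,t$ if and only if (B1) and (B2) hold, and in this case $[H+h,L^\pm_\lambda(u)]=0$; and $[d,\hat x[s]]=\hat x[s']$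 holds for all $x,s$ if and only if $[d,L^\pm_\lambda(u)]=-\partial_uL^\pm_\lambda(u)$. -/

import Mathlib

open Filter Topology
open scoped TensorProduct

/-- A commutative algebra of test functions with the derivation `s ↦ s'` and a linear functional
`s ↦ ∫ s(u) du` such that `∫ s' = 0` and the pairing `⟨s, t⟩ = ∫ s(u) t(u) du` is nondegenerate. -/
structure TestFunctionAlgebra (K : Type*) [CommRing K] [Algebra ℂ K] where
  D : Derivation ℂ K K
  integral : K →ₗ[ℂ] ℂ
  integral_D : ∀ s, integral (D s) = 0
  nondegenerate : ∀ s, (∀ t, integral (s * t) = 0) → s = 0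

/-! ### Germs of meromorphic functions -/

/-- Functions meromorphic at the origin. -/
def MeroAtZero : Subalgebra ℂ (ℂ → ℂ) where
  carrier := {f | MeromorphicAt f 0}
  mul_mem' hf hg := MeromorphicAt.mul hf hg
  add_mem' hf hg := MeromorphicAt.add hf hg
  algebraMap_mem' c := MeromorphicAt.const c 0

/-- The functions vanishing on a punctured neighbourhood of the origin. -/
def vanishingGerm : Ideal MeroAtZero where
  carrier := {f | (f : ℂ → ℂ) =ᶠ[𝓝[≠] 0] 0}
  zero_mem' := EventuallyEq.refl (𝓝[≠] (0 : ℂ)) (0 : ℂ → ℂ)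
  add_mem' {f g} hf hg := by
    filter_upwards [show ∀ᶠ u in 𝓝[≠] (0 : ℂ), f.1 u = 0 from hf,
      show ∀ᶠ u in 𝓝[≠] (0 : ℂ), g.1 u = 0 from hg] with u h1 h2
    simp [h1, h2]
  smul_mem' c f hf := by
    filter_upwards [show ∀ᶠ u in 𝓝[≠] (0 : ℂ), f.1 u = 0 from hf] with u h1
    simp [h1]

/-- The algebra of germs at the origin of meromorphic functions (near the origin). -/
abbrev LocalField : Type := MeroAtZero ⧸ vanishingGerm

namespace LocalField

def mk (f : ℂ → ℂ) (hf : MeromorphicAt f 0) : LocalField :=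
  Ideal.Quotient.mk vanishingGerm ⟨f, hf⟩

theorem mk_eq_mk {f g : ℂ → ℂ} (hf : MeromorphicAt f 0) (hg : MeromorphicAt g 0) :
    mk f hf = mk g hg ↔ f =ᶠ[𝓝[≠] 0] g := by
  rw [mk, mk, Ideal.Quotient.eq]
  exact (eventuallyEq_iff_sub (f := f) (g := g) (l := 𝓝[≠] (0 : ℂ))).symm

theorem exists_rep (s : LocalField) : ∃ f hf, s = mk f hf := by
  obtain ⟨⟨f, hf⟩, rfl⟩ := Ideal.Quotient.mk_surjective s
  exact ⟨f, hf, rfl⟩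

/-- The residue at the origin of a function, as the value of the contour integrals
over all sufficiently small circles. -/
noncomputable def residueFun (f : ℂ → ℂ) : ℂ :=
  limUnder (𝓝[>] (0 : ℝ)) fun R => (2 * Real.pi * Complex.I)⁻¹ * ∮ u in C(0, R), f u

/-- The residue of a germ. -/
noncomputable def residueGerm (s : LocalField) : ℂ := residueFun (s.exists_rep.choose)

theorem circle_congr {f g : ℂ → ℂ} (h : f =ᶠ[𝓝[≠] 0] g) :
    ∀ᶠ R in 𝓝[>] (0 : ℝ), (∮ u in C(0, R), f u) = ∮ u in C(0, R), g u := by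
  rw [eventuallyEq_nhdsWithin_iff, Metric.eventually_nhds_iff] at h
  obtain ⟨ε, hε, h⟩ := h
  filter_upwards [Ioo_mem_nhdsGT hε] with R hR
  refine circleIntegral.integral_congr hR.1.le fun u hu => ?_
  have hu' : ‖u‖ = R := by simpa using hu
  refine h (by simpa [hu'] using hR.2) ?_
  rintro rfl
  simp at hu'
  exact hR.1.ne hu'

theorem residueFun_congr {f g : ℂ → ℂ} (h : f =ᶠ[𝓝[≠] 0] g) : residueFun f = residueFun g := by
  unfold residueFun limUnder
  congr 1
  refine Filter.map_congr ?_
  filter_upwards [circle_congr h] with R hR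
  rw [hR]

theorem residueGerm_mk (f : ℂ → ℂ) (hf : MeromorphicAt f 0) :
    residueGerm (mk f hf) = residueFun f := by
  refine residueFun_congr ?_
  have h := (mk f hf).exists_rep.choose_spec
  exact ((mk_eq_mk hf h.1).1 h.2).symm

theorem exists_analytic {f : ℂ → ℂ} (hf : MeromorphicAt f 0) :
    ∃ R₀ > 0, ∀ u : ℂ, u ≠ 0 → ‖u‖ < R₀ → AnalyticAt ℂ f u := by
  have h := hf.eventually_analyticAt
  rw [eventually_nhdsWithin_iff, Metric.eventually_nhds_iff] at h
  obtain ⟨ε, hε, h⟩ := h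
  exact ⟨ε, hε, fun u hu hu' => h (by simpa using hu') hu⟩

theorem circle_const {f : ℂ → ℂ} {R₀ : ℝ}
    (h : ∀ u : ℂ, u ≠ 0 → ‖u‖ < R₀ → AnalyticAt ℂ f u) {r R : ℝ} (hr : 0 < r) (hrR : r ≤ R)
    (hR : R < R₀) : (∮ u in C(0, R), f u) = ∮ u in C(0, r), f u := by
  have key : ∀ u ∈ Metric.closedBall (0:ℂ) R \ Metric.ball 0 r, AnalyticAt ℂ f u := by
    intro u hu
    simp only [Set.mem_sdiff, Metric.mem_closedBall, dist_zero_right, Metric.mem_ball, not_lt] at hu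
    refine h u ?_ (by linarith [hu.1])
    rintro rfl
    simp at hu
    linarith
  refine Complex.circleIntegral_eq_of_differentiable_on_annulus_off_countable hr hrR
    Set.countable_empty (fun u hu => (key u hu).continuousAt.continuousWithinAt) ?_
  rintro u ⟨⟨h1, h2⟩, -⟩
  refine (key u ⟨Metric.ball_subset_closedBall h1, fun h3 => h2 (Metric.ball_subset_closedBall h3)⟩).differentiableAt

theorem eventually_circle {f : ℂ → ℂ} (hf : MeromorphicAt f 0) :
    ∀ᶠ R in 𝓝[>] (0 : ℝ),
      (2 * Real.pi * Complex.I)⁻¹ * (∮ u in C(0, R), f u) = residueFun f := by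
  obtain ⟨R₀, hR₀, h⟩ := exists_analytic hf
  set c := (2 * Real.pi * Complex.I)⁻¹ * (∮ u in C(0, R₀ / 2), f u) with hc
  have hev : ∀ᶠ R in 𝓝[>] (0 : ℝ),
      (2 * Real.pi * Complex.I)⁻¹ * (∮ u in C(0, R), f u) = c := by
    filter_upwards [Ioo_mem_nhdsGT (half_pos hR₀)] with R hR
    rw [hc, circle_const h hR.1 hR.2.le (by linarith)]
  have hlim : residueFun f = c := Tendsto.limUnder_eq (tendsto_const_nhds.congr' (hev.mono fun R h => h.symm))
  rw [hlim]
  exact hev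

theorem eventually_circleIntegrable {f : ℂ → ℂ} (hf : MeromorphicAt f 0) :
    ∀ᶠ R in 𝓝[>] (0 : ℝ), CircleIntegrable f 0 R := by
  obtain ⟨R₀, hR₀, h⟩ := exists_analytic hf
  filter_upwards [Ioo_mem_nhdsGT hR₀] with R hR
  refine ContinuousOn.circleIntegrable hR.1.le fun u hu => ?_
  have hu' : ‖u‖ = R := by simpa using hu
  refine (h u ?_ (hu' ▸ hR.2)).continuousAt.continuousWithinAt
  rintro rfl
  simp at hu'
  exact hR.1.ne hu'

theorem residueFun_add {f g : ℂ → ℂ} (hf : MeromorphicAt f 0) (hg : MeromorphicAt g 0) :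
    residueFun (f + g) = residueFun f + residueFun g := by
  obtain ⟨R, h1, h2, h3, h4, h5⟩ := ((eventually_circle hf).and ((eventually_circle hg).and
    ((eventually_circle (hf.add hg)).and ((eventually_circleIntegrable hf).and
      (eventually_circleIntegrable hg))))).exists
  rw [← h1, ← h2, ← h3, ← mul_add, ← circleIntegral.integral_add h4 h5]
  rfl

theorem residueFun_smul {f : ℂ → ℂ} (c : ℂ) (hf : MeromorphicAt f 0) :
    residueFun (c • f) = c * residueFun f := by
  obtain ⟨R, h1, h2⟩ := ((eventually_circle hf).and
    (eventually_circle (MeromorphicAt.const_smul (c := c) hf))).exists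
  rw [← h1, ← h2]
  have := circleIntegral.integral_smul c f 0 R
  simp only [Pi.smul_apply, smul_eq_mul] at this ⊢
  rw [this]; ring

theorem residueFun_deriv {f : ℂ → ℂ} (hf : MeromorphicAt f 0) :
    residueFun (deriv f) = 0 := by
  obtain ⟨R₀, hR₀, h⟩ := exists_analytic hf
  obtain ⟨R, h1, h2⟩ := ((eventually_circle hf.deriv).and (Ioo_mem_nhdsGT hR₀)).exists
  rw [← h1, circleIntegral.integral_eq_zero_of_hasDerivWithinAt' (f := f), mul_zero]
  intro u hu
  have hu' : ‖u‖ = |R| := by simpa using hu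
  rw [abs_of_pos h2.1] at hu'
  refine (h u ?_ (hu' ▸ h2.2)).differentiableAt.hasDerivAt.hasDerivWithinAt
  rintro rfl
  simp at hu'
  exact h2.1.ne hu'

noncomputable def residue : LocalField →ₗ[ℂ] ℂ where
  toFun := residueGerm
  map_add' s t := by
    obtain ⟨f, hf, rfl⟩ := s.exists_rep
    obtain ⟨g, hg, rfl⟩ := t.exists_rep
    have : mk f hf + mk g hg = mk (f + g) (hf.add hg) := rfl
    rw [this, residueGerm_mk, residueGerm_mk, residueGerm_mk, residueFun_add hf hg]
  map_smul' c s := by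
    obtain ⟨f, hf, rfl⟩ := s.exists_rep
    have : c • mk f hf = mk (c • f) (hf.const_smul c) := rfl
    rw [this, residueGerm_mk, residueGerm_mk, residueFun_smul c hf]; rfl

/-- The derivative of a germ. -/
noncomputable def derivGerm (s : LocalField) : LocalField :=
  mk (deriv s.exists_rep.choose) s.exists_rep.choose_spec.choose.deriv

theorem derivGerm_mk (f : ℂ → ℂ) (hf : MeromorphicAt f 0) :
    derivGerm (mk f hf) = mk (deriv f) hf.deriv := by
  have h := (mk f hf).exists_rep.choose_spec
  exact (mk_eq_mk _ _).2 ((mk_eq_mk hf h.1).1 h.2).symm.nhdsNE_deriv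

noncomputable def derivation : Derivation ℂ LocalField LocalField :=
  Derivation.mk'
    { toFun := derivGerm
      map_add' := fun s t => by
        obtain ⟨f, hf, rfl⟩ := s.exists_rep
        obtain ⟨g, hg, rfl⟩ := t.exists_rep
        have : mk f hf + mk g hg = mk (f + g) (hf.add hg) := rfl
        rw [this, derivGerm_mk, derivGerm_mk, derivGerm_mk]
        refine (mk_eq_mk _ (hf.deriv.add hg.deriv)).2 ?_
        filter_upwards [hf.eventually_analyticAt, hg.eventually_analyticAt] with u h1 h2
        exact deriv_add h1.differentiableAt h2.differentiableAt
      map_smul' := fun c s => by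
        obtain ⟨f, hf, rfl⟩ := s.exists_rep
        have : c • mk f hf = mk (c • f) (hf.const_smul c) := rfl
        rw [this, derivGerm_mk, derivGerm_mk]
        refine (mk_eq_mk _ (hf.deriv.const_smul c)).2 ?_
        filter_upwards [hf.eventually_analyticAt] with u h1
        exact deriv_const_smul c h1.differentiableAt }
    fun s t => by
      obtain ⟨f, hf, rfl⟩ := s.exists_rep
      obtain ⟨g, hg, rfl⟩ := t.exists_rep
      have : mk f hf * mk g hg = mk (f * g) (hf.mul hg) := rfl
      simp only [LinearMap.coe_mk, AddHom.coe_mk]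
      rw [this, derivGerm_mk, derivGerm_mk, derivGerm_mk]
      refine (mk_eq_mk _ ((hf.mul hg.deriv).add (hg.mul hf.deriv))).2 ?_
      filter_upwards [hf.eventually_analyticAt, hg.eventually_analyticAt] with u h1 h2
      rw [deriv_mul h1.differentiableAt h2.differentiableAt]
      simp only [Pi.add_apply, Pi.mul_apply]
      ring

theorem mero_inv : MeromorphicAt (fun u : ℂ => (u - 0)⁻¹) 0 :=
  ((MeromorphicAt.id (0 : ℂ)).sub (MeromorphicAt.const 0 0)).inv

/-- Germs with the pairing `⟨s, t⟩ = res₀ (s t)`. -/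
noncomputable def testAlgebra : TestFunctionAlgebra LocalField where
  D := derivation
  integral := residue
  integral_D s := by
    obtain ⟨f, hf, rfl⟩ := s.exists_rep
    change residueGerm (derivGerm _) = 0
    rw [derivGerm_mk, residueGerm_mk, residueFun_deriv hf]
  nondegenerate s hs := by
    obtain ⟨f, hf, rfl⟩ := s.exists_rep
    rcases hf.eventually_eq_zero_or_eventually_ne_zero with h | h
    · exact (mk_eq_mk hf (MeromorphicAt.const 0 0)).2 h
    · exfalso
      have hg : MeromorphicAt (f⁻¹ * fun u : ℂ => u⁻¹) 0 := hf.inv.mul (MeromorphicAt.id 0).inv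
      have h1 := hs (mk _ hg)
      have h2 : mk f hf * mk _ hg = mk (fun u : ℂ => (u - 0)⁻¹) mero_inv := by
        refine (mk_eq_mk (hf.mul hg) _).2 ?_
        filter_upwards [h] with u hu
        simp [hu]
      rw [h2] at h1
      change residueGerm _ = 0 at h1
      rw [residueGerm_mk] at h1
      obtain ⟨R, h3, h4⟩ := ((eventually_circle mero_inv).and self_mem_nhdsWithin).exists
      rw [circleIntegral.integral_sub_center_inv _ (ne_of_gt h4), h1] at h3
      exact one_ne_zero ((inv_mul_cancel₀ Complex.two_pi_I_ne_zero).symm.trans h3)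

end LocalField

/-! ### Functions on the cylinder -/

/-- Entire functions of period `1` of at most exponential growth in the imaginary direction. -/
def CylFunctions : Subalgebra ℂ (ℂ → ℂ) where
  carrier := {s | Differentiable ℂ s ∧ (∀ u, s (u + 1) = s u) ∧
    ∃ C > 0, ∃ p > 0, ∀ u, ‖s u‖ ≤ C * Real.exp (p * |u.im|)}
  mul_mem' := by
    rintro s t ⟨h1, h2, C, hC, p, hp, h3⟩ ⟨k1, k2, B, hB, q, hq, k3⟩
    refine ⟨h1.mul k1, fun u => by simp [h2, k2], C * B, by positivity, p + q, by positivity,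
      fun u => ?_⟩
    rw [Pi.mul_apply, norm_mul, add_mul, Real.exp_add]
    calc ‖s u‖ * ‖t u‖ ≤ (C * Real.exp (p * |u.im|)) * (B * Real.exp (q * |u.im|)) := by
          gcongr
          exacts [h3 u, k3 u]
      _ = _ := by ring
  add_mem' := by
    rintro s t ⟨h1, h2, C, hC, p, hp, h3⟩ ⟨k1, k2, B, hB, q, hq, k3⟩
    refine ⟨h1.add k1, fun u => by simp [h2, k2], C + B, by positivity, p + q, by positivity,
      fun u => ?_⟩
    have e1 : Real.exp (p * |u.im|) ≤ Real.exp ((p + q) * |u.im|) :=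
      Real.exp_le_exp.2 (by nlinarith [abs_nonneg u.im])
    have e2 : Real.exp (q * |u.im|) ≤ Real.exp ((p + q) * |u.im|) :=
      Real.exp_le_exp.2 (by nlinarith [abs_nonneg u.im])
    calc ‖s u + t u‖ ≤ ‖s u‖ + ‖t u‖ := norm_add_le _ _
      _ ≤ C * Real.exp (p * |u.im|) + B * Real.exp (q * |u.im|) := add_le_add (h3 u) (k3 u)
      _ ≤ C * Real.exp ((p + q) * |u.im|) + B * Real.exp ((p + q) * |u.im|) := by gcongr
      _ = _ := by ring
  algebraMap_mem' c := by
    refine ⟨differentiable_const c, fun u => rfl, ‖c‖ + 1, by positivity, 1, one_pos, fun u => ?_⟩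
    have : (1 : ℝ) ≤ Real.exp (1 * |u.im|) := Real.one_le_exp (by positivity)
    change ‖c‖ ≤ _
    nlinarith [norm_nonneg c]

namespace CylFunctions

theorem deriv_mem {s : ℂ → ℂ} (hs : s ∈ CylFunctions) : deriv s ∈ CylFunctions := by
  obtain ⟨h1, h2, C, hC, p, hp, h3⟩ := hs
  refine ⟨h1.deriv, fun u => ?_, C * Real.exp p, by positivity, p, hp, fun u => ?_⟩
  · rw [← deriv_comp_add_const]
    congr 1
    exact funext h2
  · have := Complex.norm_deriv_le_of_forall_mem_sphere_norm_le (c := u) (R := 1) (f := s)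
      (C := C * Real.exp p * Real.exp (p * |u.im|)) one_pos h1.diffContOnCl ?_
    · simpa using this
    · intro z hz
      refine (h3 z).trans ?_
      rw [mul_assoc, ← Real.exp_add]
      gcongr
      have : |z.im - u.im| ≤ 1 := by
        have := Complex.abs_im_le_norm (z - u)
        rw [Complex.sub_im] at this
        refine this.trans ?_
        rw [← dist_eq_norm]; exact (Metric.mem_sphere.1 hz).le
      have h4 : |z.im| ≤ |u.im| + 1 := by
        have := abs_sub_abs_le_abs_sub z.im u.im
        linarith
      nlinarith

theorem intervalIntegrable (s : CylFunctions) :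
    IntervalIntegrable (fun x : ℝ => s.1 x) MeasureTheory.volume (-(1 / 2)) (1 / 2) :=
  (s.2.1.continuous.comp Complex.continuous_ofReal).intervalIntegrable _ _

noncomputable def derivation : Derivation ℂ CylFunctions CylFunctions :=
  Derivation.mk'
    { toFun := fun s => ⟨deriv s.1, deriv_mem s.2⟩
      map_add' := fun s t => Subtype.ext <| funext fun u =>
        deriv_add (s.2.1 u) (t.2.1 u)
      map_smul' := fun c s => Subtype.ext <| funext fun u =>
        deriv_const_smul c (s.2.1 u) }
    fun s t => Subtype.ext <| funext fun u => by
      refine (deriv_mul (s.2.1 u) (t.2.1 u)).trans ?_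
      change _ = s.1 u * deriv t.1 u + t.1 u * deriv s.1 u
      ring

/-- The functional `s ↦ ∫ s(u) du / (2πi)` over `[-1/2, 1/2]`. -/
noncomputable def average : CylFunctions →ₗ[ℂ] ℂ where
  toFun s := (2 * Real.pi * Complex.I)⁻¹ * ∫ x in (-(1 / 2) : ℝ)..(1 / 2), s.1 x
  map_add' s t := by
    rw [← mul_add, ← intervalIntegral.integral_add (intervalIntegrable s) (intervalIntegrable t)]
    rfl
  map_smul' c s := by
    have := intervalIntegral.integral_const_mul (a := (-(1 / 2) : ℝ)) (b := 1 / 2)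
      (μ := MeasureTheory.volume) c (fun x : ℝ => s.1 x)
    change _ * (∫ x in (-(1 / 2) : ℝ)..(1 / 2), c * s.1 x) = c * _
    rw [this]; ring

theorem conj_mem {s : ℂ → ℂ} (hs : s ∈ CylFunctions) :
    (fun u => (starRingEnd ℂ) (s ((starRingEnd ℂ) u))) ∈ CylFunctions := by
  obtain ⟨h1, h2, C, hC, p, hp, h3⟩ := hs
  refine ⟨fun u => ?_, fun u => by simp [h2], C, hC, p, hp, fun u => ?_⟩
  · have := (h1 ((starRingEnd ℂ) u)).conj_conj
    rwa [Complex.conj_conj] at this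
  · simpa using h3 ((starRingEnd ℂ) u)

/-- Functions on the cylinder with the pairing `⟨s, t⟩ = ∫ s(u) t(u) du / (2πi)` over
`[-1/2, 1/2]`. -/
noncomputable def testAlgebra : TestFunctionAlgebra CylFunctions where
  D := derivation
  integral := average
  integral_D s := by
    change (2 * Real.pi * Complex.I)⁻¹ * (∫ x in (-(1 / 2) : ℝ)..(1 / 2), deriv s.1 x) = 0
    rw [intervalIntegral.integral_eq_sub_of_hasDerivAt (f := fun x : ℝ => s.1 x)
      (fun x _ => (s.2.1 x).hasDerivAt.comp_ofReal)
      (intervalIntegrable ⟨deriv s.1, deriv_mem s.2⟩)]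
    have := s.2.2.1 ((-(1 / 2) : ℝ) : ℂ)
    have e : ((-(1 / 2) : ℝ) : ℂ) + 1 = ((1 / 2 : ℝ) : ℂ) := by push_cast; ring
    rw [e] at this
    rw [this, sub_self, mul_zero]
  nondegenerate s hs := by
    have h := hs ⟨_, conj_mem s.2⟩
    change (2 * Real.pi * Complex.I)⁻¹ * (∫ x in (-(1 / 2) : ℝ)..(1 / 2),
      s.1 x * (starRingEnd ℂ) (s.1 ((starRingEnd ℂ) x))) = 0 at h
    have h0 : (∫ x in (-(1 / 2) : ℝ)..(1 / 2), ‖s.1 x‖ ^ 2) = 0 := by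
      have h' := (mul_eq_zero.1 h).resolve_left (inv_ne_zero Complex.two_pi_I_ne_zero)
      simp only [Complex.conj_ofReal, Complex.mul_conj, Complex.normSq_eq_norm_sq] at h'
      rw [intervalIntegral.integral_ofReal] at h'
      exact_mod_cast h'
    have hc : Continuous fun x : ℝ => ‖s.1 x‖ ^ 2 :=
      (s.2.1.continuous.comp Complex.continuous_ofReal).norm.pow 2
    have hz : ∀ x ∈ Set.Ioo (-(1 / 2) : ℝ) (1 / 2), s.1 x = 0 := by
      intro x hx
      by_contra hne
      have := intervalIntegral.integral_pos (a := (-(1 / 2) : ℝ)) (b := 1 / 2) (by norm_num)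
        hc.continuousOn (fun y _ => by positivity)
        ⟨x, Set.Ioo_subset_Icc_self hx, by positivity⟩
      linarith
    have han : AnalyticOnNhd ℂ s.1 Set.univ := fun u _ => s.2.1.analyticAt u
    have hfreq : ∃ᶠ u in 𝓝[≠] (0 : ℂ), s.1 u = 0 := by
      have ht : Tendsto (fun x : ℝ => (x : ℂ)) (𝓝[>] 0) (𝓝[≠] 0) := by
        refine tendsto_nhdsWithin_iff.2 ⟨?_, ?_⟩
        · have := (Complex.continuous_ofReal.tendsto 0)
          rw [Complex.ofReal_zero] at this
          exact this.mono_left nhdsWithin_le_nhds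
        · filter_upwards [self_mem_nhdsWithin] with x hx
          simpa using (ne_of_gt hx)
      refine ht.frequently (Eventually.frequently ?_)
      filter_upwards [Ioo_mem_nhdsGT (show (0 : ℝ) < 1 / 2 by norm_num)] with x hx
      exact hz x ⟨by linarith [hx.1], hx.2⟩
    refine Subtype.ext <| funext fun u => ?_
    exact han.eqOn_zero_of_preconnected_of_frequently_eq_zero isPreconnected_univ
      (Set.mem_univ 0) hfreq (Set.mem_univ u)

end CylFunctions

/-! ### Current algebras -/

/-- The Lie algebra `𝔰𝔩₂(ℂ)` of traceless matrices. -/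
abbrev Sl2 : Type := LieAlgebra.SpecialLinear.sl (Fin 2) ℂ

namespace Sl2
def h : Sl2 := ⟨!![1, 0; 0, -1], by simp [LieAlgebra.SpecialLinear.sl, Matrix.trace]⟩
def e : Sl2 := ⟨!![0, 1; 0, 0], by simp [LieAlgebra.SpecialLinear.sl, Matrix.trace]⟩
def f : Sl2 := ⟨!![0, 0; 1, 0], by simp [LieAlgebra.SpecialLinear.sl, Matrix.trace]⟩

/-- The invariant form `(x, y) = tr (x y)`. -/
def form : LinearMap.BilinForm ℂ Sl2 :=
  LinearMap.mk₂ ℂ (fun x y => (x.1 * y.1).trace)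
    (fun x y z => by simp [add_mul]) (fun c x y => by simp)
    (fun x y z => by simp [mul_add]) (fun c x y => by simp)

theorem form_apply (x y : Sl2) : form x y = (x.1 * y.1).trace := rfl

theorem form_symm (x y : Sl2) : form x y = form y x := Matrix.trace_mul_comm x.1 y.1

theorem form_lie (x y z : Sl2) : form ⁅x, y⁆ z = form x ⁅y, z⁆ := by
  simp only [form_apply, LieSubalgebra.coe_bracket, Ring.lie_def, sub_mul, mul_sub,
    Matrix.trace_sub]
  rw [Matrix.mul_assoc, Matrix.mul_assoc y.1, ← Matrix.mul_assoc x.1 z.1, Matrix.trace_mul_comm y.1,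
    Matrix.mul_assoc]
end Sl2

/-- The loop algebra `𝔰𝔩₂ ⊗ K` with `[s ⊗ x, t ⊗ y] = st ⊗ [x, y]`. -/
def LoopAlgebra (K : Type*) [CommRing K] [Algebra ℂ K] : Type _ := K ⊗[ℂ] Sl2

namespace LoopAlgebra

variable {K : Type*} [CommRing K] [Algebra ℂ K]

noncomputable instance : LieRing (LoopAlgebra K) := inferInstanceAs (LieRing (K ⊗[ℂ] Sl2))
noncomputable instance : LieAlgebra ℂ (LoopAlgebra K) :=
  LieAlgebra.ExtendScalars.instBaseLieAlgebra ℂ K Sl2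

/-- The bilinear map `(s, x) ↦ s ⊗ x`. -/
noncomputable def tmul : K →ₗ[ℂ] Sl2 →ₗ[ℂ] LoopAlgebra K := TensorProduct.mk ℂ K Sl2

theorem lie_tmul (s t : K) (x y : Sl2) : ⁅tmul s x, tmul t y⁆ = tmul (s * t) ⁅x, y⁆ := rfl

theorem induction {p : LoopAlgebra K → Prop} (zero : p 0) (tmul : ∀ s x, p (tmul s x))
    (add : ∀ X Y, p X → p Y → p (X + Y)) (X : LoopAlgebra K) : p X :=
  TensorProduct.induction_on (motive := p) X zero tmul add

end LoopAlgebra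

namespace TestFunctionAlgebra

variable {K : Type*} [CommRing K] [Algebra ℂ K] (T : TestFunctionAlgebra K)

/-- The pairing `⟨s, t⟩ = ∫ s(u) t(u) du`. -/
def pairing : LinearMap.BilinForm ℂ K := (LinearMap.mul ℂ K).compr₂ T.integral

theorem pairing_apply (s t : K) : T.pairing s t = T.integral (s * t) := rfl

/-- The invariant form `⟨s ⊗ x, t ⊗ y⟩ = (x, y) ⟨s, t⟩` on the loop algebra. -/
noncomputable def loopForm : LinearMap.BilinForm ℂ (LoopAlgebra K) :=
  LinearMap.BilinForm.tmul T.pairing Sl2.form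

/-- The derivation `s ⊗ x ↦ s' ⊗ x` of the loop algebra. -/
noncomputable def loopD : LoopAlgebra K →ₗ[ℂ] LoopAlgebra K :=
  LinearMap.rTensor Sl2 T.D.toLinearMap

theorem loopD_tmul (s : K) (x : Sl2) :
    T.loopD (LoopAlgebra.tmul s x) = LoopAlgebra.tmul (T.D s) x := rfl

theorem loopForm_tmul (s t : K) (x y : Sl2) :
    T.loopForm (LoopAlgebra.tmul s x) (LoopAlgebra.tmul t y) = Sl2.form x y * T.pairing s t := rfl

theorem loopForm_symm (X Y : LoopAlgebra K) : T.loopForm X Y = T.loopForm Y X := by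
  induction X using LoopAlgebra.induction with
  | zero => simp
  | add X X' h h' => simp [h, h']
  | tmul s x =>
    induction Y using LoopAlgebra.induction with
    | zero => simp
    | add Y Y' h h' => simp [h, h']
    | tmul t y =>
      rw [loopForm_tmul, loopForm_tmul, Sl2.form_symm, pairing_apply, pairing_apply, mul_comm s]

theorem loopForm_D (X Y : LoopAlgebra K) :
    T.loopForm (T.loopD X) Y = -T.loopForm X (T.loopD Y) := by
  induction X using LoopAlgebra.induction with
  | zero => simp
  | add X X' h h' => simp [h, h']; ring
  | tmul s x =>
    induction Y using LoopAlgebra.induction with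
    | zero => simp
    | add Y Y' h h' => simp [h, h']; ring
    | tmul t y =>
      have := T.integral_D (s * t)
      rw [T.D.leibniz, map_add, smul_eq_mul, smul_eq_mul] at this
      rw [loopD_tmul, loopD_tmul, loopForm_tmul, loopForm_tmul, pairing_apply, pairing_apply,
        eq_neg_of_add_eq_zero_left this, mul_comm t, mul_neg, neg_neg]

theorem loopForm_lie (X Y Z : LoopAlgebra K) : T.loopForm ⁅X, Y⁆ Z = T.loopForm X ⁅Y, Z⁆ := by
  induction X using LoopAlgebra.induction with
  | zero => simp
  | add X X' h h' => simp [h, h']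
  | tmul s x =>
    induction Y using LoopAlgebra.induction with
    | zero => simp
    | add Y Y' h h' => simp [h, h']
    | tmul t y =>
      induction Z using LoopAlgebra.induction with
      | zero => simp
      | add Z Z' h h' => simp [h, h']
      | tmul r z =>
        rw [LoopAlgebra.lie_tmul, LoopAlgebra.lie_tmul,
          loopForm_tmul, loopForm_tmul, Sl2.form_lie, pairing_apply, pairing_apply, mul_assoc]

theorem loopD_lie (X Y : LoopAlgebra K) :
    T.loopD ⁅X, Y⁆ = ⁅T.loopD X, Y⁆ + ⁅X, T.loopD Y⁆ := by
  induction X using LoopAlgebra.induction with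
  | zero => simp
  | add X X' h h' => simp only [add_lie, map_add, h, h']; abel
  | tmul s x =>
    induction Y using LoopAlgebra.induction with
    | zero => simp
    | add Y Y' h h' => simp only [lie_add, map_add, h, h']; abel
    | tmul t y =>
      simp only [loopD_tmul, LoopAlgebra.lie_tmul, T.D.leibniz, smul_eq_mul, map_add,
        LinearMap.add_apply]
      rw [add_comm, mul_comm t]

/-- The Lie algebra `(𝔰𝔩₂ ⊗ K) ⊕ ℂ c ⊕ ℂ d`, the extension of the loop algebra by the cocycle
`(x ⊗ s, y ⊗ t) ↦ (x, y) ⟨s', t⟩` and by the derivation `d/du`. -/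
@[ext]
structure CurrentAlgebra (T : TestFunctionAlgebra K) where
  loop : LoopAlgebra K
  central : ℂ
  cocentral : ℂ

namespace CurrentAlgebra
variable {T}

def equivProd : CurrentAlgebra T ≃ LoopAlgebra K × ℂ × ℂ where
  toFun X := (X.loop, X.central, X.cocentral)
  invFun X := ⟨X.1, X.2.1, X.2.2⟩

noncomputable instance : AddCommGroup (CurrentAlgebra T) := equivProd.addCommGroup
noncomputable instance : Module ℂ (CurrentAlgebra T) := equivProd.module ℂ

theorem loop_add (X Y : CurrentAlgebra T) : (X + Y).loop = X.loop + Y.loop := rfl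
theorem central_add (X Y : CurrentAlgebra T) : (X + Y).central = X.central + Y.central := rfl
theorem cocentral_add (X Y : CurrentAlgebra T) : (X + Y).cocentral = X.cocentral + Y.cocentral := rfl

/-- `[x ⊗ s, y ⊗ t] = [x, y] ⊗ st + (x, y) ⟨s', t⟩ c`, `[d, x ⊗ s] = x ⊗ s'`, `c` is central. -/
noncomputable instance : Bracket (CurrentAlgebra T) (CurrentAlgebra T) where
  bracket X Y :=
    ⟨⁅X.loop, Y.loop⁆ + X.cocentral • T.loopD Y.loop - Y.cocentral • T.loopD X.loop,
      T.loopForm (T.loopD X.loop) Y.loop, 0⟩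

theorem loop_lie (X Y : CurrentAlgebra T) : ⁅X, Y⁆.loop =
  ⁅X.loop, Y.loop⁆ + X.cocentral • T.loopD Y.loop - Y.cocentral • T.loopD X.loop := rfl
theorem central_lie (X Y : CurrentAlgebra T) : ⁅X, Y⁆.central =
  T.loopForm (T.loopD X.loop) Y.loop := rfl
theorem cocentral_lie (X Y : CurrentAlgebra T) : ⁅X, Y⁆.cocentral = 0 := rfl

noncomputable instance : LieRing (CurrentAlgebra T) where
  add_lie X Y Z := by
    ext
    · simp only [loop_lie, loop_add, cocentral_add, map_add, add_lie, add_smul, smul_add]; abel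
    · simp only [central_lie, central_add, loop_add, map_add, LinearMap.add_apply]
    · simp only [cocentral_lie, cocentral_add, add_zero]
  lie_add X Y Z := by
    ext
    · simp only [loop_lie, loop_add, cocentral_add, map_add, lie_add, add_smul, smul_add]; abel
    · simp only [central_lie, central_add, loop_add, map_add]
    · simp only [cocentral_lie, cocentral_add, add_zero]
  lie_self X := by
    ext
    · rw [loop_lie, lie_self, zero_add, sub_self]; rfl
    · have h1 := T.loopForm_D X.loop X.loop
      rw [T.loopForm_symm X.loop] at h1
      exact self_eq_neg.1 h1
    · rfl
  leibniz_lie X Y Z := by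
    ext
    · simp only [loop_lie, loop_add, cocentral_lie, map_add, map_sub, map_smul, lie_add, lie_sub,
        add_lie, sub_lie, smul_add, smul_sub, T.loopD_lie, zero_smul, lie_smul, smul_lie]
      rw [leibniz_lie X.loop Y.loop Z.loop, smul_comm X.cocentral Y.cocentral]
      rw [smul_comm X.cocentral Z.cocentral, smul_comm Y.cocentral Z.cocentral]
      rw [← lie_skew Y.loop (T.loopD X.loop)]
      simp only [smul_neg]
      abel
    · simp only [central_lie, central_add, loop_lie, map_add, map_sub, map_smul,
        LinearMap.add_apply, LinearMap.sub_apply, LinearMap.smul_apply, T.loopD_lie, smul_eq_mul]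
      rw [T.loopForm_lie, T.loopForm_D (T.loopD X.loop) Z.loop,
        T.loopForm_D (T.loopD Y.loop) Z.loop, ← lie_skew X.loop (T.loopD Y.loop), map_neg,
        LinearMap.neg_apply, T.loopForm_lie, T.loopForm_symm (T.loopD Y.loop) (T.loopD X.loop)]
      ring
    · simp only [cocentral_lie, cocentral_add, add_zero]

noncomputable instance : LieAlgebra ℂ (CurrentAlgebra T) where
  lie_smul a X Y := by
    have hl : ∀ X : CurrentAlgebra T, (a • X).loop = a • X.loop := fun _ => rfl
    have hc : ∀ X : CurrentAlgebra T, (a • X).central = a * X.central := fun _ => rfl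
    have hd : ∀ X : CurrentAlgebra T, (a • X).cocentral = a * X.cocentral := fun _ => rfl
    ext
    · simp only [loop_lie, hl, hd, map_smul, lie_smul, smul_add, smul_sub, mul_smul]
      rw [smul_comm a X.cocentral]
    · simp only [central_lie, hl, hc, map_smul, smul_eq_mul]
    · simp only [cocentral_lie, hd, mul_zero]

/-- The current `x̂[s] = x ⊗ s`. -/
noncomputable def current (T : TestFunctionAlgebra K) : Sl2 →ₗ[ℂ] K →ₗ[ℂ] CurrentAlgebra T :=
  LinearMap.mk₂ ℂ (fun x s => ⟨LoopAlgebra.tmul s x, 0, 0⟩)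
    (fun x y s => by ext <;> simp [loop_add, central_add, cocentral_add])
    (fun a x s => by
      ext
      · exact map_smul _ a x
      · exact (mul_zero a).symm
      · exact (mul_zero a).symm)
    (fun x s t => by ext <;> simp [loop_add, central_add, cocentral_add])
    (fun a x s => by
      ext
      · rfl
      · exact (mul_zero a).symm
      · exact (mul_zero a).symm)

/-- The central element. -/
noncomputable def c (T : TestFunctionAlgebra K) : CurrentAlgebra T := ⟨0, 1, 0⟩
/-- The element acting as `d/du`. -/
noncomputable def d (T : TestFunctionAlgebra K) : CurrentAlgebra T := ⟨0, 0, 1⟩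

end CurrentAlgebra
end TestFunctionAlgebra

/-! ### Theta function and the basic meromorphic functions -/

namespace EllipticTheta

/-- The theta function `ϑ₁(u|τ) = ∑ₖ exp (πiτ(k+1/2)² + 2πi(k+1/2)(u+1/2))`, written through
`jacobiTheta₂ z τ = ∑ₖ exp (2πikz + πik²τ)`. -/
noncomputable def theta1 (τ u : ℂ) : ℂ :=
  Complex.exp (Real.pi * Complex.I * τ / 4 + Real.pi * Complex.I * (u + 1 / 2)) *
    jacobiTheta₂ (u + 1 / 2 + τ / 2) τ

/-- The odd theta function of the lattice `ℤ + ℤτ`, normalized by `θ'(0) = 1`. -/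
noncomputable def theta (τ u : ℂ) : ℂ := theta1 τ u / deriv (theta1 τ) 0

/-- The function `θ(u + λ) / (θ(u) θ(λ))`. -/
noncomputable def phi (τ lam u : ℂ) : ℂ := theta τ (u + lam) / (theta τ u * theta τ lam)

/-- The function `θ'(u) / θ(u)`. -/
noncomputable def zeta (τ u : ℂ) : ℂ := deriv (theta τ) u / theta τ u

theorem differentiable_theta (τ : ℂ) : Differentiable ℂ (theta τ) := by
  have h1 : Differentiable ℂ (theta1 τ) := by
    intro u
    rcases lt_or_ge 0 τ.im with h | h
    · refine DifferentiableAt.mul (by fun_prop) ?_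
      exact DifferentiableAt.comp u (g := fun z => jacobiTheta₂ z τ)
        (f := fun u : ℂ => u + 1 / 2 + τ / 2)
        (differentiableAt_jacobiTheta₂_fst _ h) (by fun_prop)
    · have : theta1 τ = fun _ => 0 := by
        funext u
        rw [theta1, jacobiTheta₂_undef _ h, mul_zero]
      rw [this]
      exact differentiableAt_const _
  exact h1.div_const _

theorem meromorphicAt_theta (τ u : ℂ) : MeromorphicAt (theta τ) u :=
  ((differentiable_theta τ).analyticAt u).meromorphicAt

theorem meromorphicAt_phi (τ lam u : ℂ) : MeromorphicAt (phi τ lam) u := by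
  have h : MeromorphicAt (fun u => theta τ (u + lam)) u :=
    (((differentiable_theta τ).comp (differentiable_id.add_const lam)).analyticAt u).meromorphicAt
  exact h.div ((meromorphicAt_theta τ u).mul (MeromorphicAt.const (theta τ lam) u))

theorem meromorphicAt_zeta (τ u : ℂ) : MeromorphicAt (zeta τ) u :=
  (meromorphicAt_theta τ u).deriv.div (meromorphicAt_theta τ u)

end EllipticTheta

/-! ### Distributions in two variables -/

namespace TestFunctionAlgebra

variable {K : Type*} [CommRing K] [Algebra ℂ K] (T : TestFunctionAlgebra K)

/-- A distribution `a(u, v)` in two variables is given by its values `a s t` on the test functions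
`s(u) t(v)`. It is regular if it acts on test functions in each variable, that is
`a s t = ⟨A s, t⟩ = ⟨s, A' t⟩` for linear operators `A`, `A'` on the space of test functions,
and if it depends on the difference `u - v` only: `∂a/∂u = -∂a/∂v`. -/
def IsRegular (a : K → K → ℂ) : Prop :=
  (∃ A : K →ₗ[ℂ] K, ∀ s t, T.pairing (A s) t = a s t) ∧
    (∃ A : K →ₗ[ℂ] K, ∀ s t, T.pairing s (A t) = a s t) ∧
    ∀ s t, a (T.D s) t = -a s (T.D t)

open Classical in
/-- The operator `s(u) ↦ ∫ a(u, v) s(u) du`, a test function of `v`. -/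
noncomputable def leftAct (a : K → K → ℂ) : K →ₗ[ℂ] K :=
  if h : ∃ A : K →ₗ[ℂ] K, ∀ s t, T.pairing (A s) t = a s t then h.choose else 0

open Classical in
/-- The operator `t(v) ↦ ∫ a(u, v) t(v) dv`, a test function of `u`. -/
noncomputable def rightAct (a : K → K → ℂ) : K →ₗ[ℂ] K :=
  if h : ∃ A : K →ₗ[ℂ] K, ∀ s t, T.pairing s (A t) = a s t then h.choose else 0

theorem leftAct_eq {a : K → K → ℂ} (A : K →ₗ[ℂ] K) (hA : ∀ s t, T.pairing (A s) t = a s t) :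
    T.leftAct a = A := by
  have h : ∃ A : K →ₗ[ℂ] K, ∀ s t, T.pairing (A s) t = a s t := ⟨A, hA⟩
  rw [leftAct, dif_pos h]
  ext s
  refine sub_eq_zero.1 (T.nondegenerate _ fun t => ?_)
  rw [sub_mul, map_sub, ← pairing_apply, ← pairing_apply, h.choose_spec, hA, sub_self]

theorem rightAct_eq {a : K → K → ℂ} (A : K →ₗ[ℂ] K) (hA : ∀ s t, T.pairing s (A t) = a s t) :
    T.rightAct a = A := by
  have h : ∃ A : K →ₗ[ℂ] K, ∀ s t, T.pairing s (A t) = a s t := ⟨A, hA⟩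
  rw [rightAct, dif_pos h]
  ext t
  refine sub_eq_zero.1 (T.nondegenerate _ fun s => ?_)
  rw [sub_mul, map_sub, mul_comm, mul_comm _ s, ← pairing_apply, ← pairing_apply, h.choose_spec,
    hA, sub_self]

end TestFunctionAlgebra

/-- The derivative of a family of distributions with respect to a parameter. -/
noncomputable def paramDeriv {K : Type*} (a : ℂ → K → K → ℂ) (x : ℂ) : K → K → ℂ :=
  fun s t => deriv (fun y => a y s t) x

/-- The Green distributions `G(u, v)` and `G^±_λ(u, v)`. -/
structure GreenSystem (K : Type*) where
  diag : K → K → ℂ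
  plus : ℂ → K → K → ℂ
  minus : ℂ → K → K → ℂ

/-! ### The Green distributions on the local field -/

namespace LocalField

/-- The germ of the coordinate function `u`. -/
noncomputable def coord : LocalField := mk (fun u => u) (MeromorphicAt.id 0)

noncomputable def phiGerm (τ lam : ℂ) : LocalField :=
  mk (EllipticTheta.phi τ lam) (EllipticTheta.meromorphicAt_phi τ lam 0)

noncomputable def zetaGerm (τ : ℂ) : LocalField :=
  mk (EllipticTheta.zeta τ) (EllipticTheta.meromorphicAt_zeta τ 0)

/-- The normalized derivative `s^{(n)} / n!`. -/
noncomputable def divDeriv (n : ℕ) (s : LocalField) : LocalField :=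
  ((n.factorial : ℂ)⁻¹) • (fun x => derivation x)^[n] s

/-- The element `ε^{n;λ}` (`n ≥ 0`) of the basis. -/
noncomputable def epsUp (τ lam : ℂ) (n : ℕ) : LocalField := divDeriv n (phiGerm τ lam)

/-- The element `ε^{n;0}` (`n ≥ 0`) of the basis. -/
noncomputable def epsUpZero (τ : ℂ) (n : ℕ) : LocalField := divDeriv n (zetaGerm τ)

/-- The element `ε_{n;λ}` (`n ≥ 0`, any `λ`) of the dual basis. -/
noncomputable def epsDown (n : ℕ) : LocalField := (-coord) ^ n

/-- The element `ε^{-n-1;λ}` (`n ≥ 0`, any `λ`) of the basis. -/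
noncomputable def epsUpNeg (n : ℕ) : LocalField := coord ^ n

/-- The element `ε_{-n-1;λ}` (`n ≥ 0`) of the dual basis, `(-1)^n / n!` times the `n`-th derivative of
`θ(u - λ) / (θ(u) θ(-λ))`. -/
noncomputable def epsDownNeg (τ lam : ℂ) (n : ℕ) : LocalField :=
  ((-1 : ℂ) ^ n) • divDeriv n (phiGerm τ (-lam))

/-- `G = ∑ ε^{n;0}(u) ε_{n;0}(v)`, `G^+_λ = ∑ ε^{n;λ}(u) ε_{n;λ}(v)`,
`G^-_λ = -∑ ε^{-n-1;λ}(u) ε_{-n-1;λ}(v)`, with `n ≥ 0`. On given test functions, all but finitely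
many terms vanish. -/
noncomputable def green (τ : ℂ) : GreenSystem LocalField where
  diag s t := ∑' n : ℕ,
    testAlgebra.pairing (epsUpZero τ n) s * testAlgebra.pairing (epsDown n) t
  plus lam s t := ∑' n : ℕ,
    testAlgebra.pairing (epsUp τ lam n) s * testAlgebra.pairing (epsDown n) t
  minus lam s t := -∑' n : ℕ,
    testAlgebra.pairing (epsUpNeg n) s * testAlgebra.pairing (epsDownNeg τ lam n) t

end LocalField

/-! ### The Green distributions on the cylinder -/

namespace CylFunctions

/-- The distribution with kernel `k(u - v)`, the contour of integration for `u - v` being the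
unit horizontal segment centred at `b`:
`∫ dz/(2πi) t(z) ∫ dw/(2πi) k(w) s(z + w)`, with `z` in `[-1/2, 1/2]`, `w` in `b + [-1/2, 1/2]`. -/
noncomputable def kernelDist (k : ℂ → ℂ) (b : ℂ) (s t : CylFunctions) : ℂ :=
  (2 * Real.pi * Complex.I)⁻¹ * ∫ z in (-(1 / 2) : ℝ)..(1 / 2), t.1 z *
    ((2 * Real.pi * Complex.I)⁻¹ * ∫ x in (-(1 / 2) : ℝ)..(1 / 2),
      k (x + b) * s.1 (z + (x + b)))

/-- The contours are `Im (u - v) = -Im τ / 2` for `G` and `G^+_λ`, and `Im (u - v) = Im τ / 2` for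
`G^-_λ`. -/
noncomputable def green (τ : ℂ) : GreenSystem CylFunctions where
  diag := kernelDist (EllipticTheta.zeta τ) (-(τ / 2))
  plus lam := kernelDist (EllipticTheta.phi τ lam) (-(τ / 2))
  minus lam := kernelDist (EllipticTheta.phi τ lam) (τ / 2)

end CylFunctions

/-! ### Half-currents, L-operators and r-matrices -/

inductive HalfSign where
  | pos
  | neg

namespace GreenSystem

variable {K : Type*}

/-- The distributions `G(u, v)` and `-G(v, u)`. -/
def kerH (G : GreenSystem K) : HalfSign → K → K → ℂ
  | .pos => G.diag
  | .neg => fun s t => -G.diag t s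

/-- The distributions `G^±_λ(u, v)`. -/
def kerE (G : GreenSystem K) : HalfSign → ℂ → K → K → ℂ
  | .pos => G.plus
  | .neg => G.minus

/-- The distributions `G^±_{-λ}(u, v)`. -/
def kerF (G : GreenSystem K) (σ : HalfSign) (lam : ℂ) : K → K → ℂ := G.kerE σ (-lam)

/-- The matrix `r^+_λ(u, v)`, acting on `ℂ² ⊗ ℂ²` with the ordered basis
`v₁ ⊗ v₁, v₁ ⊗ v₂, v₂ ⊗ v₁, v₂ ⊗ v₂`; its entries are distributions. -/
noncomputable def rMatrix (G : GreenSystem K) (lam : ℂ) :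
    Matrix (Fin 2 × Fin 2) (Fin 2 × Fin 2) (K → K → ℂ) :=
  (!![(1 / 2 : ℂ) • G.diag, 0, 0, 0;
      0, -(1 / 2 : ℂ) • G.diag, G.plus (-lam), 0;
      0, G.plus lam, -(1 / 2 : ℂ) • G.diag, 0;
      0, 0, 0, (1 / 2 : ℂ) • G.diag] : Matrix (Fin 4) (Fin 4) (K → K → ℂ)).submatrix
    finProdFinEquiv finProdFinEquiv

/-- `∂r/∂λ`. -/
noncomputable def rMatrixDeriv (G : GreenSystem K) (lam : ℂ) :
    Matrix (Fin 2 × Fin 2) (Fin 2 × Fin 2) (K → K → ℂ) :=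
  Matrix.of fun p q => paramDeriv (fun x => G.rMatrix x p q) lam

/-- `∂r/∂τ` for a family of Green distributions depending on `τ`. -/
noncomputable def rMatrixModulus (G : ℂ → GreenSystem K) (τ lam : ℂ) :
    Matrix (Fin 2 × Fin 2) (Fin 2 × Fin 2) (K → K → ℂ) :=
  Matrix.of fun p q => paramDeriv (fun x => (G x).rMatrix lam p q) τ

/-- The distributions defining the half-currents and the r-matrix are regular, and their
derivatives in `λ` exist and are regular. -/
structure IsRegular [CommRing K] [Algebra ℂ K] (T : TestFunctionAlgebra K) (G : GreenSystem K)
    (lam : ℂ) : Prop where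
  kerH : ∀ σ, T.IsRegular (G.kerH σ)
  kerE : ∀ σ, T.IsRegular (G.kerE σ lam)
  kerF : ∀ σ, T.IsRegular (G.kerF σ lam)
  differentiable_kerE : ∀ σ s t, DifferentiableAt ℂ (fun x => G.kerE σ x s t) lam
  differentiable_kerF : ∀ σ s t, DifferentiableAt ℂ (fun x => G.kerF σ x s t) lam
  kerE_deriv : ∀ σ, T.IsRegular (paramDeriv (G.kerE σ) lam)
  kerF_deriv : ∀ σ, T.IsRegular (paramDeriv (G.kerF σ) lam)

end GreenSystem

namespace TestFunctionAlgebra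

variable {K : Type*} [CommRing K] [Algebra ℂ K] (T : TestFunctionAlgebra K)

/-- `∂r/∂u`, defined on test functions by `⟨∂a/∂u, s⟩ = -⟨a, s'⟩`. -/
noncomputable def rMatrixU (G : GreenSystem K) (lam : ℂ) :
    Matrix (Fin 2 × Fin 2) (Fin 2 × Fin 2) (K → K → ℂ) :=
  Matrix.of fun p q s t => -G.rMatrix lam p q (T.D s) t

variable {A : Type*} [LieRing A] [LieAlgebra ℂ A]

/-- The half-current `∫ a(u, v) x(v) dv` of a current `x`, a functional with values in `A`: it
takes `s(u)` to the value of `x` on `∫ a(u, v) s(u) du`. -/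
noncomputable def halfCurrent (x : K →ₗ[ℂ] A) (a : K → K → ℂ) : K →ₗ[ℂ] A := x ∘ₗ T.leftAct a

/-- The matrix `((½ h, f), (e, -½ h))` made of the half-currents of `h`, `e`, `f` defined by given
distributions. -/
noncomputable def halfCurrentMatrix (X : Sl2 →ₗ[ℂ] K →ₗ[ℂ] A) (aH aE aF : K → K → ℂ) :
    Matrix (Fin 2) (Fin 2) (K →ₗ[ℂ] A) :=
  !![(1 / 2 : ℂ) • T.halfCurrent (X Sl2.h) aH, T.halfCurrent (X Sl2.f) aF;
     T.halfCurrent (X Sl2.e) aE, -(1 / 2 : ℂ) • T.halfCurrent (X Sl2.h) aH]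

/-- The L-operators `L^±_λ(u)`. -/
noncomputable def lOperator (G : GreenSystem K) (X : Sl2 →ₗ[ℂ] K →ₗ[ℂ] A) (σ : HalfSign)
    (lam : ℂ) : Matrix (Fin 2) (Fin 2) (K →ₗ[ℂ] A) :=
  T.halfCurrentMatrix X (G.kerH σ) (G.kerE σ lam) (G.kerF σ lam)

/-- `∂L^±_λ(u)/∂λ`. -/
noncomputable def lOperatorDeriv (G : GreenSystem K) (X : Sl2 →ₗ[ℂ] K →ₗ[ℂ] A) (σ : HalfSign)
    (lam : ℂ) : Matrix (Fin 2) (Fin 2) (K →ₗ[ℂ] A) :=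
  T.halfCurrentMatrix X (paramDeriv (fun _ => G.kerH σ) lam) (paramDeriv (G.kerE σ) lam)
    (paramDeriv (G.kerF σ) lam)

/-- The commutation relations of the total currents. -/
def CurrentBracket (X : Sl2 →ₗ[ℂ] K →ₗ[ℂ] A) (c : A) : Prop :=
  ∀ x y s t, ⁅X x s, X y t⁆ = X ⁅x, y⁆ (s * t) + (Sl2.form x y * T.pairing (T.D s) t) • c

/-- The action of `d` on the total currents. -/
def CurrentDerivation (X : Sl2 →ₗ[ℂ] K →ₗ[ℂ] A) (d : A) : Prop :=
  ∀ x s, ⁅d, X x s⁆ = X x (T.D s)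

/-- `[d, L^±_λ(u)] = -∂L^±_λ(u)/∂u`, where `∂L/∂u` takes `s` to `-L(s')`. -/
def DerivationRelation (G : GreenSystem K) (lam : ℂ) (X : Sl2 →ₗ[ℂ] K →ₗ[ℂ] A) (d : A) : Prop :=
  ∀ σ i j s, ⁅d, T.lOperator G X σ lam i j s⁆ = -(-T.lOperator G X σ lam i j (T.D s))

/-- `[H + h, L^±_λ(u)] = 0`, where `H = diag (1, -1)` and `h` is the value of the current `h` on the
function `1`. -/
def WeightRelation (G : GreenSystem K) (lam : ℂ) (X : Sl2 →ₗ[ℂ] K →ₗ[ℂ] A) : Prop :=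
  ∀ σ i j s,
    (∑ k, (Sl2.h.1 i k • T.lOperator G X σ lam k j s - Sl2.h.1 k j • T.lOperator G X σ lam i k s)) +
      ⁅X Sl2.h 1, T.lOperator G X σ lam i j s⁆ = 0

/-- The entry at `(p, q)` of the commutator `[M₁(u), r(u, v)]`, where `M₁ = M ⊗ 1`, evaluated on the
test function `s(u) t(v)`. -/
noncomputable def commLeg1 (M : Matrix (Fin 2) (Fin 2) (K →ₗ[ℂ] A))
    (r : Matrix (Fin 2 × Fin 2) (Fin 2 × Fin 2) (K → K → ℂ)) (p q : Fin 2 × Fin 2) (s t : K) : A :=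
  ∑ m, ((if p.2 = m.2 then M p.1 m.1 (s * T.rightAct (r m q) t) else 0) -
    (if m.2 = q.2 then M m.1 q.1 (s * T.rightAct (r p m) t) else 0))

/-- The entry at `(p, q)` of the commutator `[M₂(v), r(u, v)]`, where `M₂ = 1 ⊗ M`, evaluated on the
test function `s(u) t(v)`. -/
noncomputable def commLeg2 (M : Matrix (Fin 2) (Fin 2) (K →ₗ[ℂ] A))
    (r : Matrix (Fin 2 × Fin 2) (Fin 2 × Fin 2) (K → K → ℂ)) (p q : Fin 2 × Fin 2) (s t : K) : A :=
  ∑ m, ((if p.1 = m.1 then M p.2 m.2 (T.leftAct (r m q) s * t) else 0) -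
    (if m.1 = q.1 then M m.2 q.2 (T.leftAct (r p m) s * t) else 0))

/-- The dynamical rLL relation
`[L₁^σ(u), L₂^ρ(v)] = [L₁^σ(u) + L₂^ρ(v), r] + H₁ ∂L₂^ρ(v)/∂λ - H₂ ∂L₁^σ(u)/∂λ + h ∂r/∂λ + c Z`,
all entries being evaluated on test functions `s(u) t(v)`. A factor which does not depend on `u`
(or on `v`) contributes the integral of `s` (or of `t`). -/
def RLLRelation (G : GreenSystem K) (lam : ℂ) (X : Sl2 →ₗ[ℂ] K →ₗ[ℂ] A) (c : A)
    (Z : Matrix (Fin 2 × Fin 2) (Fin 2 × Fin 2) (K → K → ℂ)) (σ ρ : HalfSign) : Prop :=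
  ∀ p q s t,
    ⁅T.lOperator G X σ lam p.1 q.1 s, T.lOperator G X ρ lam p.2 q.2 t⁆ =
      T.commLeg1 (T.lOperator G X σ lam) (G.rMatrix lam) p q s t +
      T.commLeg2 (T.lOperator G X ρ lam) (G.rMatrix lam) p q s t +
      (Sl2.h.1 p.1 q.1 * T.integral s) • T.lOperatorDeriv G X ρ lam p.2 q.2 t -
      (Sl2.h.1 p.2 q.2 * T.integral t) • T.lOperatorDeriv G X σ lam p.1 q.1 s +
      G.rMatrixDeriv lam p q s t • X Sl2.h 1 +
      Z p q s t • c

end TestFunctionAlgebra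

/-! Acting on test functions of u, the Green distributions become operators on 𝔎: `P` for G, `Q μ`
for G^+_μ, and P − 1, Q_μ − 1 for −G(v,u) and G^-_μ. Every entry of L^±_λ is therefore a current
x̂[Ms] with x in 𝔰𝔩₂ and M one of these operators. By (C), the commutator of two entries is
[x,y]^[Ms·Nt] plus (x,y)⟨(Ms)',Nt⟩c, so the relations (B) amount to a formula for the product Ms·Nt
in 𝔎 and a formula for the cocycle. A `Splitting` records exactly what is needed.

The adjoint of P is 1 − P and that of Q_μ is 1 − Q_{−μ}. The product formulas `mul_PQ` and `mul_QQ`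
are Rota–Baxter type identities with correction terms containing ∂_μQ_μ. They are the operator form
of the degenerate Fay identity φ_μ(a+b)(ζ(a)+ζ(b)) − φ_μ(a)φ_μ(b) = ∂_μφ_μ(a+b), and the corrections
are the dynamical terms of (B). `rhs_eq` matches them with the matrix entries, and the lemmas on
`centralTerm` compute the cocycle. Conversely, G^+ − G^- is the delta function, so L^+ − L^-
consists of the full currents and (B) gives back (C): `currentBracket_iff`.

For germs, 𝔎 is the sum of the holomorphic germs and the span of the derivatives of ζ (or of φ_μ),
and the operators are the projections onto holomorphic germs. Products of derivatives of ζ and φ_μ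
are located by orthogonality, since the relevant residues vanish: nearly all are residues of
elliptic functions with poles only on the lattice (`sub_lift_lift_mul_lift`, `lift_mul_lift`).
Holomorphic germs form an isotropic subspace stable under d/du, so the cocycle vanishes on them and
Z = 0.

On the cylinder the test functions are trigonometric polynomials and the operators are Fourier
multipliers, with coefficients 1/(1 − e^{−2πiμ}q^n) for φ_μ and 1/(1 − q^n) for ζ (1/2 at n = 0),
where q = e^{2πiτ}. Moving the contour by τ and taking the residue at 0 yields these values. The
product formulas become identities between rational functions, and the cocycle becomes −∂_τ of the
coefficients because e^{−2πiμ}q^n depends only on nτ − μ.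

Both cases rest on the zeros of θ being exactly the lattice points, with a simple zero at 0. This
comes from the triple product up to a constant factor: entire functions with the quasi-periods of
theta are determined by their zeroth Fourier coefficient, and the infinite product is one of them.
-/

/-! ### The shape of the r-matrix. -/

namespace GreenSystem

variable {K : Type*}

/-- A scalar multiple of `H ⊗ H` plus multiples of `E₁₂ ⊗ E₂₁` and `E₂₁ ⊗ E₁₂`. -/
def sixVertex {α : Type*} [Zero α] (a a' b c : α) : Matrix (Fin 2 × Fin 2) (Fin 2 × Fin 2) α :=
  Matrix.of fun p q =>
    if p = q then (if p.1 = p.2 then a else a')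
    else if p = (0, 1) ∧ q = (1, 0) then b else if p = (1, 0) ∧ q = (0, 1) then c else 0

/-- Conditions on the index pairs replace the list of sixteen entries, so that later operations on
entries split into five cases. -/
theorem rMatrix_eq (G : GreenSystem K) (lam : ℂ) :
    G.rMatrix lam = sixVertex ((1 / 2 : ℂ) • G.diag) (-(1 / 2 : ℂ) • G.diag) (G.plus (-lam))
      (G.plus lam) := by
  ext ⟨i, k⟩ ⟨j, l⟩ : 2
  fin_cases i <;> fin_cases k <;> fin_cases j <;> fin_cases l <;> rfl

theorem map_sixVertex {α β : Type*} [Zero α] [Zero β] (g : α → β) (hg : g 0 = 0) (a a' b c : α)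
    (p q : Fin 2 × Fin 2) :
    g (sixVertex a a' b c p q) = sixVertex (g a) (g a') (g b) (g c) p q := by
  simp only [sixVertex, Matrix.of_apply]
  split_ifs <;> simp [hg]

end GreenSystem

/-! ### Green distributions as operators on test functions. -/

namespace TestFunctionAlgebra

variable {K : Type*} [CommRing K] [Algebra ℂ K]

theorem pairing_comm (T : TestFunctionAlgebra K) (s t : K) : T.pairing s t = T.pairing t s := by
  rw [pairing_apply, pairing_apply, mul_comm]

theorem eq_of_pairing_eq (T : TestFunctionAlgebra K) {s s' : K}
    (h : ∀ t, T.pairing s t = T.pairing s' t) : s = s' := by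
  refine sub_eq_zero.1 (T.nondegenerate _ fun t => ?_)
  rw [sub_mul, map_sub, ← pairing_apply, ← pairing_apply, h, sub_self]

theorem pairing_D (T : TestFunctionAlgebra K) (s t : K) :
    T.pairing (T.D s) t = -T.pairing s (T.D t) := by
  have := T.integral_D (s * t)
  rw [T.D.leibniz, map_add, smul_eq_mul, smul_eq_mul] at this
  rw [pairing_apply, pairing_apply, mul_comm, eq_neg_of_add_eq_zero_right this]

/-- The derivation is skew-adjoint, so an operator commuting with it has a kernel depending on u − v
only. -/
theorem isRegular_of_adjoint (T : TestFunctionAlgebra K) {a : K → K → ℂ} {A B : K →ₗ[ℂ] K}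
    (hA : ∀ s t, T.pairing (A s) t = a s t) (hB : ∀ s t, T.pairing s (B t) = a s t)
    (hD : ∀ s, A (T.D s) = T.D (A s)) : T.IsRegular a :=
  ⟨⟨A, hA⟩, ⟨B, hB⟩, fun s t => by rw [← hA, ← hA, hD, pairing_D]⟩

/-- Operators representing Green distributions, together with the quadratic identities which are
equivalent to the dynamical classical Yang-Baxter relations. The parameters run through `S`, and
`z` represents the central terms of the relations. -/
structure Splitting (T : TestFunctionAlgebra K) (G z : GreenSystem K) (S : Set ℂ) where
  P : K →ₗ[ℂ] K
  Q : ℂ → K →ₗ[ℂ] K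
  dQ : ℂ → K →ₗ[ℂ] K
  isOpen : IsOpen S
  neg_mem : ∀ μ ∈ S, -μ ∈ S
  diag_eq : ∀ s t, T.pairing (P s) t = G.diag s t
  plus_eq : ∀ μ ∈ S, ∀ s t, T.pairing (Q μ s) t = G.plus μ s t
  -- The pairing is the delta function: G^+_μ and G^-_μ have the same kernel with contours on
  -- opposite sides of a simple pole of residue 1.
  minus_eq : ∀ μ ∈ S, ∀ s t, T.pairing (Q μ s) t - T.pairing s t = G.minus μ s t
  P_symm : ∀ s t, T.pairing (P s) t + T.pairing s (P t) = T.pairing s t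
  Q_symm : ∀ μ ∈ S, ∀ s t, T.pairing (Q μ s) t + T.pairing s (Q (-μ) t) = T.pairing s t
  P_D : ∀ s, P (T.D s) = T.D (P s)
  Q_D : ∀ μ ∈ S, ∀ s, Q μ (T.D s) = T.D (Q μ s)
  hasDerivAt_plus : ∀ μ ∈ S, ∀ s t,
    HasDerivAt (fun y => G.plus y s t) (T.pairing (dQ μ s) t) μ
  -- With a = u − w and b = v − u, the three terms have kernels ζ(a)φ_μ(a+b), ζ(b)φ_μ(a+b) and
  -- −φ_μ(a)φ_μ(b), and the right side has kernel ∂_μφ_μ(a+b).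
  mul_PQ : ∀ μ ∈ S, ∀ s t,
    P s * Q μ t - Q μ (P s * t) + Q μ (s * (t - Q μ t)) = T.integral s • dQ μ t
  mul_QQ : ∀ μ ∈ S, ∀ s t,
    Q μ s * Q (-μ) t - P (Q μ s * t) + P (s * (t - Q (-μ) t)) = T.pairing (dQ μ s) t • (1 : K)
  central_diag : ∀ s t, T.pairing (T.D (P s)) (P t) = z.diag s t
  central_plus : ∀ μ ∈ S, ∀ s t, T.pairing (T.D (Q μ s)) (Q (-μ) t) = z.plus μ s t

end TestFunctionAlgebra

/-- `0` for `+` and `1` for `-`. -/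
def HalfSign.defect : HalfSign → ℂ
  | .pos => 0
  | .neg => 1

namespace TestFunctionAlgebra.Splitting

variable {K : Type*} [CommRing K] [Algebra ℂ K] {T : TestFunctionAlgebra K} {G z : GreenSystem K}
  {S : Set ℂ} (W : T.Splitting G z S)
include W

theorem leftAct_plus {μ : ℂ} (hμ : μ ∈ S) : T.leftAct (G.plus μ) = W.Q μ :=
  T.leftAct_eq _ (W.plus_eq μ hμ)

/-- The symmetry of `P` says that its adjoint is 1 − P. This gives the action of G on its second
variable. -/
theorem pairing_P (s t : K) : T.pairing s (t - W.P t) = G.diag s t := by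
  rw [← W.diag_eq, map_sub, ← W.P_symm s t, add_sub_cancel_right]

theorem pairing_Q {μ : ℂ} (hμ : μ ∈ S) (s t : K) :
    T.pairing s (t - W.Q (-μ) t) = G.plus μ s t := by
  rw [← W.plus_eq μ hμ, map_sub, ← W.Q_symm μ hμ s t, add_sub_cancel_right]

/-- The operator of `h^±`. -/
def opH (σ : HalfSign) : K →ₗ[ℂ] K := W.P - σ.defect • LinearMap.id

/-- The operator of `e^±_μ`. -/
def opE (σ : HalfSign) (μ : ℂ) : K →ₗ[ℂ] K := W.Q μ - σ.defect • LinearMap.id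

theorem opH_apply (σ : HalfSign) (s : K) : W.opH σ s = W.P s - σ.defect • s := rfl
theorem opE_apply (σ : HalfSign) (μ : ℂ) (s : K) : W.opE σ μ s = W.Q μ s - σ.defect • s := rfl

/-- Transposing turns P into 1 − P, and the sign in −G(v,u) then gives P − 1. Thus h^+ and h^-
differ by the full current. -/
theorem pairing_opH (σ : HalfSign) (s t : K) : T.pairing (W.opH σ s) t = G.kerH σ s t := by
  cases σ with
  | pos => simp [opH_apply, HalfSign.defect, GreenSystem.kerH, W.diag_eq]
  | neg =>
    rw [pairing_comm]
    simp [opH_apply, HalfSign.defect, GreenSystem.kerH, ← W.pairing_P t s]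

theorem pairing_opE (σ : HalfSign) {μ : ℂ} (hμ : μ ∈ S) (s t : K) :
    T.pairing (W.opE σ μ s) t = G.kerE σ μ s t := by
  cases σ with
  | pos => simp [opE_apply, HalfSign.defect, GreenSystem.kerE, W.plus_eq μ hμ]
  | neg => simp [opE_apply, HalfSign.defect, GreenSystem.kerE, ← W.minus_eq μ hμ]

theorem opH_D (σ : HalfSign) (s : K) : W.opH σ (T.D s) = T.D (W.opH σ s) := by
  simp [opH_apply, W.P_D]

theorem opE_D (σ : HalfSign) {μ : ℂ} (hμ : μ ∈ S) (s : K) :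
    W.opE σ μ (T.D s) = T.D (W.opE σ μ s) := by
  simp [opE_apply, W.Q_D μ hμ]

theorem isRegular_kerH (σ : HalfSign) : T.IsRegular (G.kerH σ) := by
  refine T.isRegular_of_adjoint (W.pairing_opH σ)
    (B := LinearMap.id - W.P - σ.defect • LinearMap.id) (fun s t => ?_) (W.opH_D σ)
  rw [← W.pairing_opH, opH_apply]
  have := W.P_symm s t
  simp only [LinearMap.sub_apply, LinearMap.smul_apply, LinearMap.id_apply, map_sub, map_smul,
    smul_eq_mul]
  linear_combination -this

theorem isRegular_kerE (σ : HalfSign) {μ : ℂ} (hμ : μ ∈ S) : T.IsRegular (G.kerE σ μ) := by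
  refine T.isRegular_of_adjoint (W.pairing_opE σ hμ)
    (B := LinearMap.id - W.Q (-μ) - σ.defect • LinearMap.id) (fun s t => ?_) (W.opE_D σ hμ)
  rw [← W.pairing_opE σ hμ, opE_apply]
  have := W.Q_symm μ hμ s t
  simp only [LinearMap.sub_apply, LinearMap.smul_apply, LinearMap.id_apply, map_sub, map_smul,
    smul_eq_mul]
  linear_combination -this

theorem hasDerivAt_kerE (σ : HalfSign) {μ : ℂ} (hμ : μ ∈ S) (s t : K) :
    HasDerivAt (fun y => G.kerE σ y s t) (T.pairing (W.dQ μ s) t) μ := by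
  cases σ with
  | pos => exact W.hasDerivAt_plus μ hμ s t
  | neg =>
    refine ((W.hasDerivAt_plus μ hμ s t).sub_const (T.pairing s t)).congr_of_eventuallyEq ?_
    -- The formula for `G.minus` is known on `S` only; openness of `S` makes this enough for a
    -- derivative.
    filter_upwards [W.isOpen.mem_nhds hμ] with y hy
    rw [← W.plus_eq y hy]
    exact (W.minus_eq y hy s t).symm

theorem hasDerivAt_kerF (σ : HalfSign) {μ : ℂ} (hμ : μ ∈ S) (s t : K) :
    HasDerivAt (fun y => G.kerF σ y s t) (-T.pairing (W.dQ (-μ) s) t) μ := by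
  have h := W.hasDerivAt_kerE σ (W.neg_mem μ hμ) s t
  have := HasDerivAt.scomp μ h (hasDerivAt_neg μ)
  simpa [Function.comp_def, GreenSystem.kerF] using this

theorem paramDeriv_kerE (σ : HalfSign) {μ : ℂ} (hμ : μ ∈ S) :
    paramDeriv (G.kerE σ) μ = fun s t => T.pairing (W.dQ μ s) t :=
  funext fun s => funext fun t => (W.hasDerivAt_kerE σ hμ s t).deriv

theorem paramDeriv_kerF (σ : HalfSign) {μ : ℂ} (hμ : μ ∈ S) :
    paramDeriv (G.kerF σ) μ = fun s t => T.pairing ((-W.dQ (-μ)) s) t :=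
  funext fun s => funext fun t => by
    rw [LinearMap.neg_apply, map_neg, LinearMap.neg_apply]
    exact (W.hasDerivAt_kerF σ hμ s t).deriv

/-- Derivative in μ of `Q_symm`, whose right side is constant; the sign from −μ and the sign from
moving the term across cancel. -/
theorem dQ_symm {μ : ℂ} (hμ : μ ∈ S) (s t : K) :
    T.pairing (W.dQ μ s) t = T.pairing s (W.dQ (-μ) t) := by
  have h1 := W.hasDerivAt_plus μ hμ s t
  have h2 : HasDerivAt (fun y => T.pairing s t - G.kerF .pos y t s)
      (-(-T.pairing (W.dQ (-μ) t) s)) μ :=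
    (W.hasDerivAt_kerF .pos hμ t s).const_sub (T.pairing s t)
  rw [neg_neg] at h2
  rw [pairing_comm T s]
  refine h1.unique (h2.congr_of_eventuallyEq ?_)
  filter_upwards [W.isOpen.mem_nhds hμ] with y hy
  rw [← W.Q_symm y hy, W.plus_eq y hy, pairing_comm, W.plus_eq _ (W.neg_mem y hy)]
  simp [GreenSystem.kerF, GreenSystem.kerE]

/-- Derivative in μ of `Q_D`, read through the pairing since only matrix coefficients are known to
be differentiable. -/
theorem dQ_D {μ : ℂ} (hμ : μ ∈ S) (s : K) : W.dQ μ (T.D s) = T.D (W.dQ μ s) := by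
  refine T.eq_of_pairing_eq fun t => ?_
  rw [pairing_D]
  have h1 := W.hasDerivAt_plus μ hμ (T.D s) t
  refine h1.unique ((W.hasDerivAt_plus μ hμ s (T.D t)).neg.congr_of_eventuallyEq ?_)
  filter_upwards [W.isOpen.mem_nhds hμ] with y hy
  rw [Pi.neg_apply, ← W.plus_eq y hy, ← W.plus_eq y hy, W.Q_D y hy, pairing_D]

theorem isRegular {lam : ℂ} (hlam : lam ∈ S) : G.IsRegular T lam where
  kerH := W.isRegular_kerH
  kerE σ := W.isRegular_kerE σ hlam
  kerF σ := W.isRegular_kerE σ (W.neg_mem _ hlam)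
  differentiable_kerE σ s t := (W.hasDerivAt_kerE σ hlam s t).differentiableAt
  differentiable_kerF σ s t := (W.hasDerivAt_kerF σ hlam s t).differentiableAt
  kerE_deriv σ := by
    rw [W.paramDeriv_kerE σ hlam]
    exact T.isRegular_of_adjoint (fun _ _ => rfl) (fun s t => (W.dQ_symm hlam s t).symm)
      (W.dQ_D hlam)
  kerF_deriv σ := by
    rw [W.paramDeriv_kerF σ hlam]
    refine T.isRegular_of_adjoint (fun _ _ => rfl) (B := -W.dQ lam) (fun s t => ?_) fun s => ?_
    · have := W.dQ_symm hlam t s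
      rw [pairing_comm, pairing_comm T t] at this
      simpa using this
    · simp [W.dQ_D (W.neg_mem _ hlam)]

end TestFunctionAlgebra.Splitting

/-! ### Brackets and invariant form in the basis h, e, f. -/

namespace Sl2

theorem coe_h : (h : Matrix (Fin 2) (Fin 2) ℂ) = !![1, 0; 0, -1] := rfl

theorem lie_h_e : ⁅h, e⁆ = (2 : ℂ) • e := by
  ext i j; fin_cases i <;> fin_cases j <;> simp [h, e, Ring.lie_def]; norm_num
theorem lie_h_f : ⁅h, f⁆ = (-2 : ℂ) • f := by
  ext i j; fin_cases i <;> fin_cases j <;> simp [h, f, Ring.lie_def]; norm_num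
theorem lie_e_f : ⁅e, f⁆ = h := by
  ext i j; fin_cases i <;> fin_cases j <;> simp [h, e, f, Ring.lie_def]
theorem lie_e_h : ⁅e, h⁆ = (-2 : ℂ) • e := by rw [← lie_skew, lie_h_e, neg_smul]
theorem lie_f_h : ⁅f, h⁆ = (2 : ℂ) • f := by rw [← lie_skew, lie_h_f, neg_smul, neg_neg]
theorem lie_f_e : ⁅f, e⁆ = -h := by rw [← lie_skew, lie_e_f]

theorem form_h_h : form h h = 2 := by simp [form_apply, h, Matrix.trace]; norm_num
theorem form_h_e : form h e = 0 := by simp [form_apply, h, e, Matrix.trace]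
theorem form_h_f : form h f = 0 := by simp [form_apply, h, f, Matrix.trace]
theorem form_e_e : form e e = 0 := by simp [form_apply, e, Matrix.trace]
theorem form_f_f : form f f = 0 := by simp [form_apply, f, Matrix.trace]
theorem form_e_f : form e f = 1 := by simp [form_apply, e, f, Matrix.trace]
theorem form_e_h : form e h = 0 := by rw [form_symm, form_h_e]
theorem form_f_h : form f h = 0 := by rw [form_symm, form_h_f]
theorem form_f_e : form f e = 1 := by rw [form_symm, form_e_f]

theorem eq_combination (x : Sl2) : x = x.1 0 0 • h + x.1 0 1 • e + x.1 1 0 • f := by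
  have hx : x.1 1 1 = -x.1 0 0 := by
    have : x.1.trace = 0 := x.2
    rw [Matrix.trace_fin_two] at this
    linear_combination this
  ext i j; fin_cases i <;> fin_cases j <;> simp [h, e, f, hx]

/-- The matrix `((½ h, f), (e, -½ h))` of elements of `𝔰𝔩₂`. -/
noncomputable def lEntry : Matrix (Fin 2) (Fin 2) Sl2 := !![(1 / 2 : ℂ) • h, f; e, -(1 / 2 : ℂ) • h]

end Sl2

/-! ### The relations between L-operators, from the operator identities. -/

namespace TestFunctionAlgebra.Splitting

variable {K : Type*} [CommRing K] [Algebra ℂ K] {T : TestFunctionAlgebra K} {G z : GreenSystem K}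
  {S : Set ℂ} (W : T.Splitting G z S) {A : Type*} [LieRing A] [LieAlgebra ℂ A]
  (X : Sl2 →ₗ[ℂ] K →ₗ[ℂ] A)

/-- The operators in the entries of `L^±_λ`. -/
def opL (σ : HalfSign) (lam : ℂ) : Matrix (Fin 2) (Fin 2) (K →ₗ[ℂ] K) :=
  !![W.opH σ, W.opE σ (-lam); W.opE σ lam, W.opH σ]

include W

theorem lOperator_apply (σ : HalfSign) {lam : ℂ} (hlam : lam ∈ S) (i j : Fin 2) (s : K) :
    T.lOperator G X σ lam i j s = X (Sl2.lEntry i j) (W.opL σ lam i j s) := by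
  have h1 : T.leftAct (G.kerH σ) = W.opH σ := T.leftAct_eq _ (W.pairing_opH σ)
  have h2 : T.leftAct (G.kerE σ lam) = W.opE σ lam := T.leftAct_eq _ (W.pairing_opE σ hlam)
  have h3 : T.leftAct (G.kerF σ lam) = W.opE σ (-lam) :=
    T.leftAct_eq _ (W.pairing_opE σ (W.neg_mem _ hlam))
  fin_cases i <;> fin_cases j <;>
    simp [lOperator, halfCurrentMatrix, halfCurrent, h1, h2, h3, Sl2.lEntry, opL]

theorem lOperatorDeriv_apply (σ : HalfSign) {lam : ℂ} (hlam : lam ∈ S) (i j : Fin 2) (s : K) :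
    T.lOperatorDeriv G X σ lam i j s = X (Sl2.lEntry i j)
      ((!![0, -W.dQ (-lam); W.dQ lam, 0] : Matrix (Fin 2) (Fin 2) (K →ₗ[ℂ] K)) i j s) := by
  have h1 : T.leftAct (paramDeriv (fun _ => G.kerH σ) lam) = 0 :=
    T.leftAct_eq _ fun s t => by simp [paramDeriv]
  have h2 : T.leftAct (paramDeriv (G.kerE σ) lam) = W.dQ lam :=
    T.leftAct_eq _ fun s t => by rw [W.paramDeriv_kerE σ hlam]
  have h3 : T.leftAct (paramDeriv (G.kerF σ) lam) = -W.dQ (-lam) :=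
    T.leftAct_eq _ fun s t => by rw [W.paramDeriv_kerF σ hlam]
  fin_cases i <;> fin_cases j <;>
    simp [lOperatorDeriv, halfCurrentMatrix, halfCurrent, h1, h2, h3, Sl2.lEntry]

theorem rightAct_rMatrix {lam : ℂ} (hlam : lam ∈ S) (p q : Fin 2 × Fin 2) (t : K) :
    T.rightAct (G.rMatrix lam p q) t = GreenSystem.sixVertex ((1 / 2 : ℂ) • (t - W.P t))
      (-(1 / 2 : ℂ) • (t - W.P t)) (t - W.Q lam t) (t - W.Q (-lam) t) p q := by
  have h0 : T.rightAct (0 : K → K → ℂ) = 0 := T.rightAct_eq _ fun s t => by simp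
  have h1 (a : ℂ) : T.rightAct (a • G.diag) = a • (LinearMap.id - W.P) :=
    T.rightAct_eq _ fun s t => by
      simp only [LinearMap.smul_apply, LinearMap.sub_apply, LinearMap.id_apply, map_smul,
        W.pairing_P, Pi.smul_apply]
  have h2 : T.rightAct (G.plus lam) = LinearMap.id - W.Q (-lam) :=
    T.rightAct_eq _ (W.pairing_Q hlam)
  have h3 : T.rightAct (G.plus (-lam)) = LinearMap.id - W.Q lam :=
    T.rightAct_eq _ fun s t => by
      have := W.pairing_Q (W.neg_mem _ hlam) s t
      rwa [neg_neg] at this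
  rw [G.rMatrix_eq, GreenSystem.map_sixVertex (fun a => T.rightAct a t) (by simp [h0]), h1, h1, h2,
    h3]
  rfl

theorem leftAct_rMatrix {lam : ℂ} (hlam : lam ∈ S) (p q : Fin 2 × Fin 2) (s : K) :
    T.leftAct (G.rMatrix lam p q) s = GreenSystem.sixVertex ((1 / 2 : ℂ) • W.P s)
      (-(1 / 2 : ℂ) • W.P s) (W.Q (-lam) s) (W.Q lam s) p q := by
  have h0 : T.leftAct (0 : K → K → ℂ) = 0 := T.leftAct_eq _ fun s t => by simp
  have h1 (a : ℂ) : T.leftAct (a • G.diag) = a • W.P :=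
    T.leftAct_eq _ fun s t => by
      simp only [LinearMap.smul_apply, map_smul, W.diag_eq, Pi.smul_apply]
  rw [G.rMatrix_eq, GreenSystem.map_sixVertex (fun a => T.leftAct a s) (by simp [h0]), h1, h1,
    W.leftAct_plus hlam, W.leftAct_plus (W.neg_mem _ hlam)]
  rfl

theorem rMatrixDeriv_apply {lam : ℂ} (hlam : lam ∈ S) (p q : Fin 2 × Fin 2) (s t : K) :
    G.rMatrixDeriv lam p q s t = GreenSystem.sixVertex 0 0 (-T.pairing (W.dQ (-lam) s) t)
      (T.pairing (W.dQ lam s) t) p q := by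
  have h : ∀ y, G.rMatrix y p q s t = GreenSystem.sixVertex ((1 / 2 : ℂ) * G.diag s t)
      (-(1 / 2 : ℂ) * G.diag s t) (G.plus (-y) s t) (G.plus y s t) p q := fun y => by
    rw [G.rMatrix_eq, GreenSystem.map_sixVertex (fun a : K → K → ℂ => a s t) rfl]; rfl
  change deriv (fun y => G.rMatrix y p q s t) lam = _
  simp only [h, GreenSystem.sixVertex, Matrix.of_apply]
  split_ifs
  · simp
  · simp
  · exact (W.hasDerivAt_kerF .pos hlam s t).deriv
  · exact (W.hasDerivAt_plus _ hlam s t).deriv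
  · simp

/-- The central term of the commutator of two L-operators. -/
noncomputable def centralTerm (σ ρ : HalfSign) (lam : ℂ) : Matrix (Fin 2 × Fin 2) (Fin 2 × Fin 2) (K → K → ℂ) :=
  Matrix.of fun p q s t =>
    Sl2.form (Sl2.lEntry p.1 q.1) (Sl2.lEntry p.2 q.2) *
      T.pairing (T.D (W.opL σ lam p.1 q.1 s)) (W.opL ρ lam p.2 q.2 t)

-- The form of the mixed product identity for a Cartan entry in the second factor. Expanding the
-- products shows that it is the same identity.
omit W in
theorem mul_PQ_swap (W : T.Splitting G z S) {μ : ℂ} (hμ : μ ∈ S) (s t : K) :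
    W.Q μ s * W.P t - W.Q μ (W.Q μ s * t) + W.Q μ (s * (t - W.P t)) = T.integral t • W.dQ μ s := by
  rw [← W.mul_PQ μ hμ t s]
  rw [mul_sub, mul_sub, map_sub, map_sub, mul_comm s, mul_comm s, mul_comm (W.Q μ s), mul_comm (W.Q μ s)]
  ring

/-- In each entry the right side is a current whose test function is, up to sign, made of the terms
of `mul_PQ` or `mul_QQ` other than the product, so it collapses to the product. With operators M − σ
and N − ρ for the two signs, the discrepancy is a multiple of σ(1 − ρ)st; this is nonzero only for
the pair (−,+), which the hypothesis excludes. -/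
theorem rhs_eq {σ ρ : HalfSign} (hσρ : σ.defect * (1 - ρ.defect) = 0) {lam : ℂ} (hlam : lam ∈ S) (p q : Fin 2 × Fin 2) (s t : K) :
    T.commLeg1 (T.lOperator G X σ lam) (G.rMatrix lam) p q s t +
      T.commLeg2 (T.lOperator G X ρ lam) (G.rMatrix lam) p q s t +
      (Sl2.h.1 p.1 q.1 * T.integral s) • T.lOperatorDeriv G X ρ lam p.2 q.2 t -
      (Sl2.h.1 p.2 q.2 * T.integral t) • T.lOperatorDeriv G X σ lam p.1 q.1 s +
      G.rMatrixDeriv lam p q s t • X Sl2.h 1 =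
    X ⁅Sl2.lEntry p.1 q.1, Sl2.lEntry p.2 q.2⁆
      (W.opL σ lam p.1 q.1 s * W.opL ρ lam p.2 q.2 t) := by
  have h1 := fun s t => congrArg (X Sl2.e) (W.mul_PQ _ hlam s t)
  have h2 := fun s t => congrArg (X Sl2.f) (W.mul_PQ _ (W.neg_mem _ hlam) s t)
  have h3 := congrArg (X Sl2.e) (W.mul_PQ_swap hlam s t)
  have h4 := congrArg (X Sl2.f) (W.mul_PQ_swap (W.neg_mem _ hlam) s t)
  have h5 := congrArg (X Sl2.h) (W.mul_QQ _ hlam s t)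
  have h6 := congrArg (X Sl2.h) (W.mul_QQ _ (W.neg_mem _ hlam) s t)
  replace h1 := h1 s t
  replace h2 := h2 s t
  simp only [neg_neg, map_add, map_sub, map_smul, mul_sub] at h1 h2 h3 h4 h5 h6
  simp only [commLeg1, commLeg2, W.rightAct_rMatrix hlam, W.leftAct_rMatrix hlam,
    W.rMatrixDeriv_apply hlam, W.lOperator_apply X _ hlam, W.lOperatorDeriv_apply X _ hlam,
    Fintype.sum_prod_type, Fin.sum_univ_two]
  obtain ⟨i, k⟩ := p
  obtain ⟨j, l⟩ := q
  fin_cases i <;> fin_cases j <;> fin_cases k <;> fin_cases l <;>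
    simp [GreenSystem.sixVertex, Sl2.lEntry, opL, Sl2.lie_h_e, Sl2.lie_h_f, Sl2.lie_e_f, Sl2.lie_e_h,
      Sl2.lie_f_h, Sl2.lie_f_e, opH_apply, opE_apply, Sl2.coe_h, -one_div, mul_sub, sub_mul]
  -- The ten remaining entries are the eight pairing a Cartan entry with e or f, and the two pairing
  -- e with f.
  · linear_combination (norm := module) h2 - hσρ • X Sl2.f (s * t)
  · linear_combination (norm := module) -h1 + hσρ • X Sl2.e (s * t)
  · linear_combination (norm := module) -h4 + hσρ • X Sl2.f (s * t)
  · linear_combination (norm := module) h6 - hσρ • X Sl2.h (s * t)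
  · linear_combination (norm := module) h4 - hσρ • X Sl2.f (s * t)
  · linear_combination (norm := module) h3 - hσρ • X Sl2.e (s * t)
  · linear_combination (norm := module) -h5 + hσρ • X Sl2.h (s * t)
  · linear_combination (norm := module) -h3 + hσρ • X Sl2.e (s * t)
  · linear_combination (norm := module) -h2 + hσρ • X Sl2.f (s * t)
  · linear_combination (norm := module) h1 - hσρ • X Sl2.e (s * t)

/-- The central values of the bracket of two L-operators. -/
theorem centralTerm_pos_pos {lam : ℂ} (hlam : lam ∈ S) :
    W.centralTerm .pos .pos lam = z.rMatrix lam := by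
  have h1 := W.central_plus _ (W.neg_mem _ hlam)
  rw [neg_neg] at h1
  rw [z.rMatrix_eq]
  ext ⟨i, k⟩ ⟨j, l⟩ s t
  fin_cases i <;> fin_cases j <;> fin_cases k <;> fin_cases l <;>
    simp [centralTerm, GreenSystem.sixVertex, Sl2.lEntry, opL, opH_apply, opE_apply,
      HalfSign.defect, Sl2.form_h_h, Sl2.form_h_e, Sl2.form_h_f, Sl2.form_e_e, Sl2.form_f_f,
      Sl2.form_e_f, Sl2.form_e_h, Sl2.form_f_h, Sl2.form_f_e, W.central_diag, W.central_plus _ hlam,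
      h1]

/-- If N has adjoint 1 − M and M commutes with D, passing from M, N to M − 1, N − 1 changes ⟨D(Ms),
Nt⟩ by ⟨Ds,t⟩ − ⟨M(Ds),t⟩ − ⟨Ds,Nt⟩ = 0. -/
theorem centralTerm_neg_neg {lam : ℂ} (hlam : lam ∈ S) :
    W.centralTerm .neg .neg lam = z.rMatrix lam := by
  have h (M N : K →ₗ[ℂ] K) (hM : ∀ s, M (T.D s) = T.D (M s))
      (hMN : ∀ s t, T.pairing (M s) t + T.pairing s (N t) = T.pairing s t) (s t : K) :
      T.pairing (T.D (M s - s)) (N t - t) = T.pairing (T.D (M s)) (N t) := by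
    have := hMN (T.D s) t
    rw [hM] at this
    simp only [map_sub, LinearMap.sub_apply]
    linear_combination -this
  have hP := h _ _ W.P_D W.P_symm
  have hQ := h _ _ (W.Q_D _ hlam) (W.Q_symm _ hlam)
  have hQ' := h _ _ (W.Q_D _ (W.neg_mem _ hlam)) (W.Q_symm _ (W.neg_mem _ hlam))
  rw [neg_neg] at hQ'
  rw [← W.centralTerm_pos_pos hlam]
  ext ⟨i, k⟩ ⟨j, l⟩ s t
  fin_cases i <;> fin_cases j <;> fin_cases k <;> fin_cases l <;>
    simp [centralTerm, Sl2.lEntry, opL, opH_apply, opE_apply,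
      HalfSign.defect, Sl2.form_h_h, Sl2.form_h_e, Sl2.form_h_f, Sl2.form_e_e, Sl2.form_f_f,
      Sl2.form_e_f, Sl2.form_e_h, Sl2.form_f_h, Sl2.form_f_e, -map_sub, hP, hQ, hQ']

/-- Only the second operator is lowered by 1 here, which subtracts ⟨D(Ms), t⟩. Since ∂_u acts on a
distribution by −D on s, this is the term ∂_u r. -/
theorem centralTerm_pos_neg {lam : ℂ} (hlam : lam ∈ S) :
    W.centralTerm .pos .neg lam = T.rMatrixU G lam + z.rMatrix lam := by
  have h3 : T.rMatrixU G lam = Matrix.of fun p q s t => -GreenSystem.sixVertex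
      ((1 / 2 : ℂ) * T.pairing (T.D (W.P s)) t) (-(1 / 2 : ℂ) * T.pairing (T.D (W.P s)) t)
      (T.pairing (T.D (W.Q (-lam) s)) t) (T.pairing (T.D (W.Q lam s)) t) p q := by
    ext p q s t
    rw [rMatrixU, Matrix.of_apply, Matrix.of_apply, G.rMatrix_eq,
      GreenSystem.map_sixVertex (fun a : K → K → ℂ => a (T.D s) t) rfl]
    simp only [Pi.smul_apply, smul_eq_mul, ← W.diag_eq, ← W.plus_eq _ hlam,
      ← W.plus_eq _ (W.neg_mem _ hlam), W.P_D, W.Q_D _ hlam, W.Q_D _ (W.neg_mem _ hlam)]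
  rw [← W.centralTerm_pos_pos hlam, h3]
  ext ⟨i, k⟩ ⟨j, l⟩ s t
  fin_cases i <;> fin_cases j <;> fin_cases k <;> fin_cases l <;>
    simp [centralTerm, GreenSystem.sixVertex, Sl2.lEntry, opL, opH_apply, opE_apply,
      HalfSign.defect, Sl2.form_h_h, Sl2.form_h_e, Sl2.form_h_f, Sl2.form_e_e, Sl2.form_f_f,
      Sl2.form_e_f, Sl2.form_e_h, Sl2.form_f_h, Sl2.form_f_e] <;> ring

/-- The relation between two L-operators says that their entries have the brackets prescribed by
the commutation relations of the currents. -/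
theorem rllRelation_iff (c : A) {σ ρ : HalfSign} (hσρ : σ.defect * (1 - ρ.defect) = 0) {lam : ℂ} (hlam : lam ∈ S) :
    T.RLLRelation G lam X c (W.centralTerm σ ρ lam) σ ρ ↔ ∀ i j k l s t,
      ⁅X (Sl2.lEntry i j) (W.opL σ lam i j s), X (Sl2.lEntry k l) (W.opL ρ lam k l t)⁆ =
        X ⁅Sl2.lEntry i j, Sl2.lEntry k l⁆ (W.opL σ lam i j s * W.opL ρ lam k l t) +
        (Sl2.form (Sl2.lEntry i j) (Sl2.lEntry k l) *
          T.pairing (T.D (W.opL σ lam i j s)) (W.opL ρ lam k l t)) • c := by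
  simp only [RLLRelation, W.rhs_eq X hσρ hlam]
  simp only [W.lOperator_apply X _ hlam]
  exact ⟨fun h i j k l => h (i, k) (j, l), fun h p q => h p.1 q.1 p.2 q.2⟩

/-- The two halves add up to the delta function. The converse implications use this to recover the
full currents. -/
theorem opL_sub (lam : ℂ) (i j : Fin 2) (s : K) :
    W.opL .pos lam i j s - W.opL .neg lam i j s = s := by
  fin_cases i <;> fin_cases j <;> simp [opL, opH_apply, opE_apply, HalfSign.defect]

omit W in
/-- A statement bilinear in the elements of `𝔰𝔩₂` may be checked on the entries of the L-operator. -/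
theorem eq_of_lEntry {M : Type*} [AddCommGroup M] [Module ℂ M] {F F' : Sl2 →ₗ[ℂ] M}
    (h : ∀ i j, F (Sl2.lEntry i j) = F' (Sl2.lEntry i j)) : F = F' := by
  have hh : F Sl2.h = F' Sl2.h := by
    have := congrArg ((2 : ℂ) • ·) (h 0 0)
    simpa [Sl2.lEntry] using this
  have he : F Sl2.e = F' Sl2.e := h 1 0
  have hf : F Sl2.f = F' Sl2.f := h 0 1
  ext x
  rw [Sl2.eq_combination x]
  simp only [map_add, map_smul, hh, he, hf]

/-- (C) contains the relations as instances. Conversely, write s = s^+ − s^- and t = t^+ − t^- and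
expand the bracket of the full currents into four brackets of half-currents: three are given, and
the pair (−,+) follows from (+,−) by antisymmetry. -/
theorem currentBracket_iff (c : A) {lam : ℂ} (hlam : lam ∈ S) :
    T.CurrentBracket X c ↔ (∀ σ, T.RLLRelation G lam X c (z.rMatrix lam) σ σ) ∧
      T.RLLRelation G lam X c (T.rMatrixU G lam + z.rMatrix lam) .pos .neg := by
  have e1 : (∀ σ, T.RLLRelation G lam X c (z.rMatrix lam) σ σ) ↔
      T.RLLRelation G lam X c (W.centralTerm .pos .pos lam) .pos .pos ∧
      T.RLLRelation G lam X c (W.centralTerm .neg .neg lam) .neg .neg := by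
    rw [W.centralTerm_pos_pos hlam, W.centralTerm_neg_neg hlam]
    exact ⟨fun h => ⟨h _, h _⟩, fun h σ => by cases σ; exacts [h.1, h.2]⟩
  rw [e1, ← W.centralTerm_pos_neg hlam, W.rllRelation_iff X c (by simp [HalfSign.defect]) hlam,
    W.rllRelation_iff X c (by simp [HalfSign.defect]) hlam, W.rllRelation_iff X c (by simp [HalfSign.defect]) hlam]
  refine ⟨fun h => ⟨⟨?_, ?_⟩, ?_⟩, fun ⟨⟨hpp, hnn⟩, hpn⟩ => ?_⟩
  · exact fun i j k l s t => h _ _ _ _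
  · exact fun i j k l s t => h _ _ _ _
  · exact fun i j k l s t => h _ _ _ _
  -- The right side of (C) is itself skew: the form is symmetric and ⟨s',t⟩ is skew by integration
  -- by parts.
  have hskew : ∀ x y s t, X ⁅x, y⁆ (s * t) + (Sl2.form x y * T.pairing (T.D s) t) • c =
      -(X ⁅y, x⁆ (t * s) + (Sl2.form y x * T.pairing (T.D t) s) • c) := by
    intro x y s t
    rw [← lie_skew, mul_comm s t, Sl2.form_symm, pairing_D, pairing_comm T s]
    simp only [map_neg, LinearMap.neg_apply]
    module
  have key : ∀ i j k l s t, ⁅X (Sl2.lEntry i j) s, X (Sl2.lEntry k l) t⁆ =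
      X ⁅Sl2.lEntry i j, Sl2.lEntry k l⁆ (s * t) +
        (Sl2.form (Sl2.lEntry i j) (Sl2.lEntry k l) * T.pairing (T.D s) t) • c := by
    intro i j k l s t
    have h1 := hpp i j k l s t
    have h2 := hnn i j k l s t
    have h3 := hpn i j k l s t
    have h4 := hpn k l i j t s
    -- This supplies the missing bracket of a minus entry in s with a plus entry in t.
    rw [← lie_skew, neg_eq_iff_eq_neg, ← hskew] at h4
    have hs := W.opL_sub lam i j s
    have ht := W.opL_sub lam k l t
    generalize W.opL .pos lam i j s = s1 at *
    generalize W.opL .neg lam i j s = s2 at *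
    generalize W.opL .pos lam k l t = t1 at *
    generalize W.opL .neg lam k l t = t2 at *
    subst hs ht
    simp only [map_sub, sub_lie, lie_sub, sub_mul, mul_sub, LinearMap.sub_apply]
    rw [h1, h2, h3, h4]
    module
  intro x y s t
  -- Both sides are bilinear in x and y, and the entries of the L-operator span 𝔰𝔩₂.
  let B : K → K → Sl2 →ₗ[ℂ] Sl2 →ₗ[ℂ] A := fun s t =>
    LinearMap.mk₂ ℂ (fun x y => ⁅X x s, X y t⁆) (by simp) (by simp) (by simp) (by simp)
  let B' : K → K → Sl2 →ₗ[ℂ] Sl2 →ₗ[ℂ] A := fun s t =>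
    LinearMap.mk₂ ℂ (fun x y => X ⁅x, y⁆ (s * t) + (Sl2.form x y * T.pairing (T.D s) t) • c)
      (fun x x' y => by simp; module) (fun a x y => by simp; module)
      (fun x x' y => by simp; module) (fun a x y => by simp; module)
  have : B s t = B' s t :=
    eq_of_lEntry fun i j => eq_of_lEntry fun k l => key i j k l s t
  exact congrArg (fun F : Sl2 →ₗ[ℂ] Sl2 →ₗ[ℂ] A => F x y) this

/-- The operators commute with D, so the relation for L is that for currents at the functions Ms;
differences of the two signs reach every s. -/
theorem currentDerivation_iff (d : A) {lam : ℂ} (hlam : lam ∈ S) :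
    T.CurrentDerivation X d ↔ T.DerivationRelation G lam X d := by
  have hD (σ i j s) : W.opL σ lam i j (T.D s) = T.D (W.opL σ lam i j s) := by
    fin_cases i <;> fin_cases j <;>
      simp [opL, W.opH_D, W.opE_D _ hlam, W.opE_D _ (W.neg_mem _ hlam)]
  simp only [DerivationRelation, W.lOperator_apply X _ hlam, neg_neg, hD]
  refine ⟨fun h σ i j s => h _ _, fun h x s => ?_⟩
  let B : Sl2 →ₗ[ℂ] A :=
    { toFun := fun x => ⁅d, X x s⁆, map_add' := by simp, map_smul' := by simp }
  have : B = X.flip (T.D s) := by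
    refine eq_of_lEntry fun i j => ?_
    change ⁅d, X (Sl2.lEntry i j) s⁆ = X (Sl2.lEntry i j) (T.D s)
    conv_lhs => rw [← W.opL_sub lam i j s]
    conv_rhs => rw [← W.opL_sub lam i j s]
    simp only [map_sub, lie_sub, h]
  exact congrArg (fun F : Sl2 →ₗ[ℂ] A => F x) this

/-- The function 1 has derivative 0, so the bracket with h has no central part. The weights ±2 of e
and f under ad h cancel the commutator with H, as e stands below the diagonal and f above it. -/
theorem weightRelation {c : A} (h : T.CurrentBracket X c) {lam : ℂ} (hlam : lam ∈ S) :
    T.WeightRelation G lam X := by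
  intro σ i j s
  have h' : ∀ x y s t, ⁅X x s, X y t⁆ = _ := h
  simp only [W.lOperator_apply X _ hlam, h', T.D.map_one_eq_zero, map_zero, LinearMap.zero_apply,
    mul_zero, zero_smul, add_zero, one_mul]
  fin_cases i <;> fin_cases j <;>
    simp [Sl2.lEntry, opL, Sl2.lie_h_e, Sl2.lie_h_f, Sl2.coe_h]
  · module
  · module

omit W in
theorem _root_.TestFunctionAlgebra.CurrentAlgebra.currentBracket (T : TestFunctionAlgebra K) :
    T.CurrentBracket (CurrentAlgebra.current T) (CurrentAlgebra.c T) := by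
  intro x y s t
  ext
  · change ⁅LoopAlgebra.tmul s x, LoopAlgebra.tmul t y⁆ + (0 : ℂ) • T.loopD (LoopAlgebra.tmul t y) -
      (0 : ℂ) • T.loopD (LoopAlgebra.tmul s x) = LoopAlgebra.tmul (s * t) ⁅x, y⁆ +
        (Sl2.form x y * T.pairing (T.D s) t) • (0 : LoopAlgebra K)
    simp [LoopAlgebra.lie_tmul]
  · change T.loopForm (T.loopD (LoopAlgebra.tmul s x)) (LoopAlgebra.tmul t y) =
      0 + Sl2.form x y * T.pairing (T.D s) t * 1
    rw [loopD_tmul, loopForm_tmul, zero_add, mul_one]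
  · change (0 : ℂ) = 0 + Sl2.form x y * T.pairing (T.D s) t * 0
    simp

omit W in
theorem _root_.TestFunctionAlgebra.CurrentAlgebra.currentDerivation (T : TestFunctionAlgebra K) :
    T.CurrentDerivation (CurrentAlgebra.current T) (CurrentAlgebra.d T) := by
  intro x s
  ext
  · change ⁅(0 : LoopAlgebra K), LoopAlgebra.tmul s x⁆ + (1 : ℂ) • T.loopD (LoopAlgebra.tmul s x) -
      (0 : ℂ) • T.loopD 0 = LoopAlgebra.tmul (T.D s) x
    simp [loopD_tmul]
  · change T.loopForm (T.loopD 0) (LoopAlgebra.tmul s x) = 0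
    simp
  · rfl

end TestFunctionAlgebra.Splitting

/-! ### Polar parts of germs and the associated projections. -/

namespace TestFunctionAlgebra

variable {K : Type*} [CommRing K] [Algebra ℂ K]

/-- A test function algebra consisting of germs of meromorphic functions: `hol` is the subalgebra
of holomorphic germs, `x` is a coordinate and `y` its inverse. -/
structure PolarData (T : TestFunctionAlgebra K) where
  hol : Subalgebra ℂ K
  x : K
  y : K
  x_mem : x ∈ hol
  x_mul_y : x * y = 1
  D_x : T.D x = 1
  D_mem : ∀ s ∈ hol, T.D s ∈ hol
  integral_hol : ∀ s ∈ hol, T.integral s = 0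
  integral_y : T.integral y = 1
  exists_eq_const_add : ∀ s ∈ hol, ∃ (c : ℂ) (t : K), t ∈ hol ∧ s = c • 1 + x * t
  exists_pow_mul_mem : ∀ s, ∃ n, x ^ n * s ∈ hol

/-- The normalized derivative `s^{(n)} / n!`. -/
noncomputable def divDeriv (T : TestFunctionAlgebra K) (n : ℕ) (s : K) : K :=
  ((n.factorial : ℂ)⁻¹) • (⇑T.D)^[n] s

theorem D_divDeriv (T : TestFunctionAlgebra K) (n : ℕ) (s : K) :
    T.D (T.divDeriv n s) = ((n + 1 : ℕ) : ℂ) • T.divDeriv (n + 1) s := by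
  rw [divDeriv, divDeriv, Derivation.map_smul, ← Function.iterate_succ_apply' (⇑T.D), smul_smul,
    Nat.factorial_succ]
  congr 1
  have h1 : ((n + 1 : ℕ) : ℂ) ≠ 0 := Nat.cast_ne_zero.2 n.succ_ne_zero
  rw [Nat.cast_mul, mul_inv, ← mul_assoc, mul_inv_cancel₀ h1, one_mul]

theorem pairing_iterate_D (T : TestFunctionAlgebra K) (n : ℕ) (s t : K) :
    T.pairing ((⇑T.D)^[n] s) t = (-1) ^ n * T.pairing s ((⇑T.D)^[n] t) := by
  induction n generalizing s with
  | zero => simp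
  | succ n ih =>
    rw [Function.iterate_succ_apply, ih, pairing_D, Function.iterate_succ_apply', pow_succ]
    ring

namespace PolarData

variable {T : TestFunctionAlgebra K} (V : T.PolarData)

theorem iterate_D_mem {s : K} (hs : s ∈ V.hol) (n : ℕ) : (⇑T.D)^[n] s ∈ V.hol := by
  induction n with
  | zero => exact hs
  | succ n ih => rw [Function.iterate_succ_apply']; exact V.D_mem _ ih

theorem pairing_hol {s t : K} (hs : s ∈ V.hol) (ht : t ∈ V.hol) : T.pairing s t = 0 :=
  V.integral_hol _ (V.hol.mul_mem hs ht)

theorem D_y : T.D V.y = -V.y ^ 2 := by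
  have h : T.D (V.x * V.y) = 0 := by
    rw [V.x_mul_y, Derivation.map_one_eq_zero]
  rw [Derivation.leibniz, V.D_x, smul_eq_mul, smul_eq_mul, mul_one] at h
  linear_combination V.y * h - T.D V.y * V.x_mul_y

theorem D_y_pow (n : ℕ) : T.D (V.y ^ (n + 1)) = -((n + 1 : ℕ) : ℂ) • V.y ^ (n + 2) := by
  rw [Derivation.leibniz_pow, V.D_y, Nat.add_sub_cancel, smul_eq_mul, ← Nat.cast_smul_eq_nsmul ℂ,
    mul_neg, ← pow_add, smul_neg, neg_smul]

theorem iterate_D_y (n : ℕ) :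
    (⇑T.D)^[n] V.y = ((-1) ^ n * n.factorial : ℂ) • V.y ^ (n + 1) := by
  induction n with
  | zero => simp
  | succ n ih =>
    rw [Function.iterate_succ_apply', ih, Derivation.map_smul, D_y_pow, smul_smul, Nat.factorial_succ]
    congr 1
    push_cast; ring

theorem y_pow_eq (m : ℕ) : V.y ^ (m + 1) = (-1 : ℂ) ^ m • T.divDeriv m V.y := by
  rw [divDeriv, iterate_D_y, smul_smul, smul_smul]
  have : (-1 : ℂ) ^ m * (m.factorial : ℂ)⁻¹ * ((-1) ^ m * m.factorial) = 1 := by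
    have h1 : (-1 : ℂ) ^ m * (-1) ^ m = 1 := by rw [← mul_pow]; simp
    have h2 : (m.factorial : ℂ) ≠ 0 := Nat.cast_ne_zero.2 m.factorial_ne_zero
    field_simp
    linear_combination h1
  rw [this, one_smul]

/-- Powers from the second on are multiples of derivatives, and derivatives have no residue. -/
theorem integral_y_pow (n : ℕ) : T.integral (V.y ^ (n + 2)) = 0 := by
  have h := T.integral_D (V.y ^ (n + 1))
  rw [D_y_pow, map_smul, smul_eq_mul] at h
  exact (mul_eq_zero.1 h).resolve_left (neg_ne_zero.2 (Nat.cast_ne_zero.2 (Nat.succ_ne_zero n)))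

/-- Every germ is the sum of a holomorphic germ and a combination of negative powers. -/
theorem polar_induction {p : K → Prop} (hol : ∀ s ∈ V.hol, p s)
    (pow : ∀ n, p (V.y ^ (n + 1))) (add : ∀ s t, p s → p t → p (s + t))
    (smul : ∀ (c : ℂ) s, p s → p (c • s)) (s : K) : p s := by
  obtain ⟨n, hn⟩ := V.exists_pow_mul_mem s
  induction n generalizing s with
  | zero => exact hol s (by simpa using hn)
  | succ n ih =>
    obtain ⟨c, t, ht, h⟩ := V.exists_eq_const_add _ hn
    have e (k : ℕ) : V.x ^ k * V.y ^ k = 1 := by rw [← mul_pow, V.x_mul_y, one_pow]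
    -- If x^{n+1}s = c + xt, subtracting the leading term c y^{n+1} lowers the order of the pole.
    have h' : s - c • V.y ^ (n + 1) = V.y ^ n * t := by
      rw [Algebra.smul_def] at h ⊢
      linear_combination V.y ^ (n + 1) * h - s * e (n + 1) + V.y ^ n * t * V.x_mul_y
    have h2 : p (s - c • V.y ^ (n + 1)) := by
      refine ih _ ?_
      rw [h', ← mul_assoc, e, one_mul]
      exact ht
    simpa using add _ _ h2 (smul c _ (pow n))

/-- The coefficient of `u ^ (-n - 1)`. -/
noncomputable def polarCoeff (n : ℕ) : K →ₗ[ℂ] ℂ := T.pairing (V.x ^ n)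

theorem polarCoeff_hol {s : K} (hs : s ∈ V.hol) (n : ℕ) : V.polarCoeff n s = 0 :=
  V.pairing_hol (V.hol.pow_mem V.x_mem n) hs

theorem polarCoeff_y_pow (n m : ℕ) :
    V.polarCoeff n (V.y ^ (m + 1)) = if n = m then 1 else 0 := by
  rw [polarCoeff, TestFunctionAlgebra.pairing_apply]
  have e (k : ℕ) : V.x ^ k * V.y ^ k = 1 := by rw [← mul_pow, V.x_mul_y, one_pow]
  rcases lt_trichotomy n m with h | rfl | h
  · obtain ⟨k, rfl⟩ := Nat.exists_eq_add_of_lt h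
    rw [show n + k + 1 + 1 = n + (k + 2) by ring, pow_add, ← mul_assoc, e, one_mul,
      integral_y_pow, if_neg (by omega)]
  · rw [pow_succ V.y, ← mul_assoc, e, one_mul, V.integral_y, if_pos rfl]
  · obtain ⟨k, rfl⟩ := Nat.exists_eq_add_of_lt h
    rw [show m + k + 1 = (m + 1) + k by ring, pow_add, mul_right_comm, e, one_mul,
      V.integral_hol _ (V.hol.pow_mem V.x_mem k), if_neg (by omega)]

theorem finite_support_polarCoeff (s : K) :
    (Function.support fun n => V.polarCoeff n s).Finite := by
  induction s using V.polar_induction with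
  | hol s hs => simp [V.polarCoeff_hol hs]
  | pow m =>
    refine (Set.finite_singleton m).subset fun n hn => ?_
    rw [Function.mem_support, polarCoeff_y_pow] at hn
    by_contra h
    exact hn (if_neg h)
  | add s t hs ht =>
    refine (hs.union ht).subset ?_
    simp only [map_add]
    exact Function.support_add _ _
  | smul c s hs =>
    refine hs.subset fun n hn h => hn ?_
    simp only [map_smul, smul_eq_mul] at h ⊢
    rw [h, mul_zero]

variable {M N : Type*} [AddCommGroup M] [Module ℂ M] [AddCommGroup N] [Module ℂ N]

theorem finite_support_polarCoeff_smul (w : ℕ → M) (s : K) :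
    (Function.support fun n => V.polarCoeff n s • w n).Finite :=
  (V.finite_support_polarCoeff s).subset fun n hn h => hn (by
    change V.polarCoeff n s • w n = 0
    rw [show V.polarCoeff n s = 0 from h, zero_smul])

/-- The map `s ↦ ∑ sₙ wₙ`, where `sₙ` is the coefficient of `u ^ (-n - 1)` in `s`. -/
noncomputable def polarMap (w : ℕ → M) : K →ₗ[ℂ] M where
  toFun s := ∑ᶠ n, V.polarCoeff n s • w n
  map_add' s t := by
    rw [← finsum_add_distrib (V.finite_support_polarCoeff_smul w s)
      (V.finite_support_polarCoeff_smul w t)]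
    simp only [map_add, add_smul]
  map_smul' c s := by
    rw [RingHom.id_apply, smul_finsum' c (V.finite_support_polarCoeff_smul w s)]
    simp only [map_smul, smul_assoc]

theorem polarMap_apply (w : ℕ → M) (s : K) :
    V.polarMap w s = ∑ᶠ n, V.polarCoeff n s • w n := rfl

theorem polarMap_hol (w : ℕ → M) {s : K} (hs : s ∈ V.hol) : V.polarMap w s = 0 := by
  simp [polarMap_apply, V.polarCoeff_hol hs]

theorem polarMap_y_pow (w : ℕ → M) (m : ℕ) : V.polarMap w (V.y ^ (m + 1)) = w m := by
  simp only [polarMap_apply, polarCoeff_y_pow]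
  rw [finsum_eq_single _ m fun n hn => by simp [hn]]
  simp

theorem map_polarMap (g : M →ₗ[ℂ] N) (w : ℕ → M) (s : K) :
    g (V.polarMap w s) = V.polarMap (fun n => g (w n)) s := by
  induction s using V.polar_induction with
  | hol s hs => rw [V.polarMap_hol _ hs, V.polarMap_hol _ hs, map_zero]
  | pow m => rw [polarMap_y_pow, polarMap_y_pow]
  | add s t hs ht => rw [map_add, map_add, map_add, hs, ht]
  | smul c s hs => rw [map_smul, map_smul, map_smul, hs]

/-- The combination of the derivatives of `k` whose polar part is that of `s`, if the polar part
of `k` is `1 / u`. -/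
noncomputable def lift (k : K) : K →ₗ[ℂ] K :=
  V.polarMap fun n => (-1 : ℂ) ^ n • T.divDeriv n k

theorem lift_hol (k : K) {s : K} (hs : s ∈ V.hol) : V.lift k s = 0 := V.polarMap_hol _ hs

theorem lift_y_pow (k : K) (n : ℕ) :
    V.lift k (V.y ^ (n + 1)) = ((-1 : ℂ) ^ n * (n.factorial : ℂ)⁻¹) • (⇑T.D)^[n] k := by
  rw [lift, polarMap_y_pow, divDeriv, smul_smul]

theorem lift_y (k : K) : V.lift k V.y = k := by simpa using V.lift_y_pow k 0

/-- If k and y have the same polar part, so do their derivatives, because D preserves holomorphic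
germs; and every y^{m+1} is a multiple of a derivative of y. -/
theorem sub_lift_mem {k : K} (hk : k - V.y ∈ V.hol) (s : K) : s - V.lift k s ∈ V.hol := by
  induction s using V.polar_induction with
  | hol s hs => rw [V.lift_hol _ hs, sub_zero]; exact hs
  | pow m =>
    rw [lift, polarMap_y_pow, y_pow_eq, ← smul_sub, divDeriv, divDeriv, ← smul_sub,
      ← iterate_map_sub]
    refine V.hol.smul_mem (V.hol.smul_mem (V.iterate_D_mem ?_ m) _) _
    rw [← neg_sub]
    exact V.hol.neg_mem hk
  | add s t hs ht =>
    rw [map_add, add_sub_add_comm]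
    exact V.hol.add_mem hs ht
  | smul c s hs =>
    rw [map_smul, ← smul_sub]
    exact V.hol.smul_mem hs c

theorem lift_induction (k : K) {p : K → Prop} (zero : p 0) (D : ∀ n, p ((⇑T.D)^[n] k))
    (add : ∀ s t, p s → p t → p (s + t)) (smul : ∀ (c : ℂ) s, p s → p (c • s)) (s : K) :
    p (V.lift k s) := by
  induction s using V.polar_induction with
  | hol s hs => rw [V.lift_hol _ hs]; exact zero
  | pow m => rw [V.lift_y_pow]; exact smul _ _ (D m)
  | add s t hs ht => rw [map_add]; exact add _ _ hs ht
  | smul c s hs => rw [map_smul]; exact smul _ _ hs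

/-- No condition on k is needed: D acts on the powers of y by the same factors as on the signed
normalized derivatives of k. -/
theorem lift_D (k s : K) : V.lift k (T.D s) = T.D (V.lift k s) := by
  induction s using V.polar_induction with
  | hol s hs => rw [V.lift_hol _ hs, V.lift_hol _ (V.D_mem _ hs), map_zero]
  | pow m =>
    rw [V.D_y_pow, map_smul, lift, polarMap_y_pow, polarMap_y_pow, Derivation.map_smul, D_divDeriv, smul_smul,
      smul_smul, pow_succ]
    congr 1; ring
  | add s t hs ht => simp only [map_add, hs, ht]
  | smul c s hs => simp only [map_smul, Derivation.map_smul, hs]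

theorem pairing_lift_eq_zero {k r : K} (h : ∀ n, T.pairing r ((⇑T.D)^[n] k) = 0) (s : K) :
    T.pairing r (V.lift k s) = 0 :=
  V.lift_induction k (p := fun w => T.pairing r w = 0) (map_zero _) h
    (fun s t hs ht => by rw [map_add, hs, ht, add_zero])
    (fun c s hs => by rw [map_smul, hs, smul_zero]) s

/-- Integration by parts moves all derivatives from k to l, so orthogonality of k to the derivatives
of l suffices. -/
theorem pairing_lift_lift {k l : K} (h : ∀ n, T.pairing k ((⇑T.D)^[n] l) = 0) (s t : K) :
    T.pairing (V.lift k s) (V.lift l t) = 0 := by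
  refine V.pairing_lift_eq_zero (fun n => ?_) t
  rw [pairing_comm]
  refine V.pairing_lift_eq_zero (fun m => ?_) s
  rw [pairing_comm, pairing_iterate_D, ← Function.iterate_add_apply, h, mul_zero]

/-- Expand ⟨s − s₁, t − t₁⟩ = 0, where s₁ and t₁ are the lifts: the two differences are holomorphic,
and ⟨s₁,t₁⟩ = 0. So the adjoint of one lift is 1 minus the other. -/
theorem pairing_lift_add {k l : K} (hk : k - V.y ∈ V.hol) (hl : l - V.y ∈ V.hol)
    (h : ∀ n, T.pairing k ((⇑T.D)^[n] l) = 0) (s t : K) :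
    T.pairing (V.lift k s) t + T.pairing s (V.lift l t) = T.pairing s t := by
  have h1 := V.pairing_hol (V.sub_lift_mem hk s) (V.sub_lift_mem hl t)
  have h2 := V.pairing_lift_lift h s t
  simp only [map_sub, LinearMap.sub_apply] at h1
  linear_combination -h1 + h2

/-- A lift is a finite combination of derivatives of the germ, and these can be moved to the test
function. -/
theorem hasDerivAt_pairing_lift {φ : ℂ → K} {dφ : K} {μ : ℂ}
    (h : ∀ s, HasDerivAt (fun ν => T.pairing (φ ν) s) (T.pairing dφ s) μ) (s t : K) :
    HasDerivAt (fun ν => T.pairing (V.lift (φ ν) s) t) (T.pairing (V.lift dφ s) t) μ := by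
  induction s using V.polar_induction with
  | hol s hs => simpa [V.lift_hol _ hs] using hasDerivAt_const μ (0 : ℂ)
  | pow m =>
    simp only [V.lift_y_pow, map_smul, LinearMap.smul_apply, pairing_iterate_D, smul_eq_mul]
    exact ((h _).const_mul _).const_mul _
  | add s s' hs hs' => simpa using hs.fun_add hs'
  | smul c s hs => simpa using hs.const_mul c

/-- The conditions on a germ `ζ`, a family of germs `φ` and its derivative `dφ` under which they
define a splitting. -/
structure Kernels (ζ : K) (φ dφ : ℂ → K) (S : Set ℂ) : Prop where
  isOpen : IsOpen S
  neg_mem : ∀ μ ∈ S, -μ ∈ S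
  zeta_sub : ζ - V.y ∈ V.hol
  phi_sub : ∀ μ ∈ S, φ μ - V.y ∈ V.hol
  dphi_mem : ∀ μ ∈ S, dφ μ ∈ V.hol
  zeta_zeta : ∀ n, T.pairing ζ ((⇑T.D)^[n] ζ) = 0
  phi_phi : ∀ μ ∈ S, ∀ n, T.pairing (φ μ) ((⇑T.D)^[n] (φ (-μ))) = 0
  zeta_phi : ∀ μ ∈ S, ∀ n, T.pairing (ζ * φ μ - dφ μ) ((⇑T.D)^[n] (φ (-μ))) = 0
  D_zeta_phi : ∀ μ ∈ S, ∀ m n,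
    T.pairing ((⇑T.D)^[m + 1] ζ * φ μ) ((⇑T.D)^[n] (φ (-μ))) = 0
  phi_phi_zeta : ∀ μ ∈ S, ∀ k m n,
    T.pairing ((⇑T.D)^[m] (φ (-μ)) * (⇑T.D)^[n] (φ μ)) ((⇑T.D)^[k + 1] ζ) = 0
  hasDerivAt : ∀ μ ∈ S, ∀ s, HasDerivAt (fun ν => T.pairing (φ ν) s) (T.pairing (dφ μ) s) μ

namespace Kernels

variable {V} {ζ : K} {φ dφ : ℂ → K} {S : Set ℂ} (W : V.Kernels ζ φ dφ S)
include W

/-- The combinations of derivatives of φ_μ are the whole orthogonal complement of those of φ_{−μ}: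
⟨r − lift r, t⟩ equals r paired with a combination of derivatives of φ_{−μ}. This turns vanishing
residues into membership statements. -/
theorem sub_lift_eq_zero {μ : ℂ} (hμ : μ ∈ S) {r : K}
    (h : ∀ n, T.pairing r ((⇑T.D)^[n] (φ (-μ))) = 0) : r - V.lift (φ μ) r = 0 := by
  refine T.eq_of_pairing_eq fun t => ?_
  rw [map_sub, LinearMap.sub_apply, map_zero, LinearMap.zero_apply,
    ← V.pairing_lift_add (W.phi_sub μ hμ) (W.phi_sub _ (W.neg_mem μ hμ)) (W.phi_phi μ hμ) r t,
    add_sub_cancel_left, V.pairing_lift_eq_zero h]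

/-- Orthogonality settles n = 0. Differentiating the case (m, n) produces (m, n+1) and (m+1, n), and
the latter is known, so induction on n with m arbitrary works. -/
theorem sub_lift_D_mul_D {μ : ℂ} (hμ : μ ∈ S) (m n : ℕ) :
    (⇑T.D)^[m] ζ * (⇑T.D)^[n] (φ μ) - V.lift (φ μ) ((⇑T.D)^[m] ζ * (⇑T.D)^[n] (φ μ)) =
      if m = 0 then (⇑T.D)^[n] (dφ μ) else 0 := by
  induction n generalizing m with
  | zero =>
    cases m with
    | zero =>
      -- It is ζφ_μ − ∂_μφ_μ that is a combination of derivatives of φ_μ; the subtracted germ is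
      -- holomorphic, hence killed by the lift.
      have := W.sub_lift_eq_zero hμ (W.zeta_phi μ hμ)
      rw [map_sub, V.lift_hol _ (W.dphi_mem μ hμ)] at this
      simp only [Function.iterate_zero, id_eq, if_true]
      linear_combination this
    | succ m => exact W.sub_lift_eq_zero hμ (W.D_zeta_phi μ hμ m)
  | succ n ih =>
    have h1 := ih (m + 1)
    have h2 := congrArg T.D (ih m)
    rw [if_neg m.succ_ne_zero] at h1
    rw [map_sub, ← V.lift_D, Derivation.leibniz, smul_eq_mul, smul_eq_mul, map_add,
      ← Function.iterate_succ_apply' (⇑T.D), ← Function.iterate_succ_apply' (⇑T.D),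
      mul_comm _ ((⇑T.D)^[m + 1] ζ)] at h2
    have h3 : (if m = 0 then (⇑T.D)^[n + 1] (dφ μ) else 0) =
        T.D (if m = 0 then (⇑T.D)^[n] (dφ μ) else 0) := by
      split_ifs
      · rw [Function.iterate_succ_apply']
      · rw [map_zero]
    rw [h3]
    linear_combination h2 - h1

/-- Bilinear extension from powers of y. Only ζ itself, not its derivatives, gives a holomorphic
remainder, and its coefficient is the residue of s. -/
theorem sub_lift_lift_mul_lift {μ : ℂ} (hμ : μ ∈ S) (s t : K) :
    V.lift ζ s * V.lift (φ μ) t - V.lift (φ μ) (V.lift ζ s * V.lift (φ μ) t) =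
      T.integral s • V.lift (dφ μ) t := by
  induction s using V.polar_induction with
  | hol s hs => simp [V.lift_hol _ hs, V.integral_hol s hs]
  | pow m =>
    induction t using V.polar_induction with
    | hol t ht => simp [V.lift_hol _ ht]
    | pow n =>
      rw [V.lift_y_pow, V.lift_y_pow, V.lift_y_pow, smul_mul_smul_comm, map_smul, ← smul_sub,
        W.sub_lift_D_mul_D hμ]
      cases m with
      | zero => simp [V.integral_y]
      | succ m => simp [V.integral_y_pow]
    | add t t' h h' => simp only [map_add, mul_add, smul_add, ← h, ← h']; ring
    | smul c t h =>
      simp only [map_smul, mul_smul_comm]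
      rw [smul_comm _ c, ← h, smul_sub]
  | add s s' h h' => simp only [map_add, add_mul, add_smul, ← h, ← h']; ring
  | smul c s h => simp only [map_smul, smul_mul_assoc, smul_assoc, ← h, smul_sub]

/-- The product of the two lifts is orthogonal to all proper derivatives of ζ, but not to ζ. As 1 is
orthogonal to these derivatives and ⟨1,ζ⟩ = 1, subtracting the right constant makes it orthogonal to
ζ too, hence a combination of derivatives of ζ. -/
theorem lift_mul_lift {μ : ℂ} (hμ : μ ∈ S) (s t : K) :
    V.lift (φ (-μ)) s * V.lift (φ μ) t - V.lift ζ (V.lift (φ (-μ)) s * V.lift (φ μ) t) =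
      T.pairing (V.lift (dφ (-μ)) s) t • (1 : K) := by
  have hμ' := W.neg_mem μ hμ
  set c := T.pairing (V.lift (dφ (-μ)) s) t with hc
  set w := V.lift (φ (-μ)) s with hw
  set w' := V.lift (φ μ) t with hw'
  have hint : T.integral ζ = 1 := by
    have := V.integral_hol _ W.zeta_sub
    rw [map_sub, V.integral_y] at this
    linear_combination this
  -- The constant is ⟨ζw, w'⟩. Adjointness rewrites this as the pairing of t with the holomorphic
  -- part of ζw, which the preceding product formula identifies.
  have h0 : T.pairing (w * w') ζ = c := by
    have h1 := W.sub_lift_lift_mul_lift hμ' V.y s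
    rw [V.lift_y, V.integral_y, one_smul] at h1
    have h2 := V.pairing_lift_add (W.phi_sub _ hμ') (W.phi_sub μ hμ)
      (by have := W.phi_phi _ hμ'; rwa [neg_neg] at this) (ζ * w) t
    rw [hc, ← h1, map_sub, LinearMap.sub_apply, ← h2, add_sub_cancel_left, pairing_apply,
      pairing_apply]
    congr 1; ring
  have h1 : ∀ r, T.pairing (w * w' - c • 1) (V.lift ζ r) = 0 := by
    refine V.pairing_lift_eq_zero fun n => ?_
    cases n with
    | zero =>
      rw [Function.iterate_zero, id, map_sub, LinearMap.sub_apply, h0, map_smul,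
        LinearMap.smul_apply, pairing_apply, one_mul, hint, smul_eq_mul, mul_one, sub_self]
    | succ k =>
      have h2 : T.pairing (1 : K) ((⇑T.D)^[k + 1] ζ) = 0 := by
        rw [pairing_apply, one_mul, Function.iterate_succ_apply', T.integral_D]
      have h3 : T.pairing (w * w') ((⇑T.D)^[k + 1] ζ) = 0 := by
        refine V.lift_induction (φ (-μ))
          (p := fun w => T.pairing (w * w') ((⇑T.D)^[k + 1] ζ) = 0) (by simp) (fun m => ?_)
          (fun a b ha hb => by rw [add_mul, map_add, LinearMap.add_apply, ha, hb, add_zero])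
          (fun a b hb => by rw [smul_mul_assoc, map_smul, LinearMap.smul_apply, hb, smul_zero]) s
        refine V.lift_induction (φ μ)
          (p := fun w' => T.pairing (_ * w') ((⇑T.D)^[k + 1] ζ) = 0) (by simp)
          (fun n => W.phi_phi_zeta μ hμ k m n)
          (fun a b ha hb => by rw [mul_add, map_add, LinearMap.add_apply, ha, hb, add_zero])
          (fun a b hb => by rw [mul_smul_comm, map_smul, LinearMap.smul_apply, hb, smul_zero]) t
      rw [map_sub, LinearMap.sub_apply, h3, map_smul, LinearMap.smul_apply, h2, smul_zero, sub_zero]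
  have h2 : w * w' - c • 1 - V.lift ζ (w * w' - c • 1) = 0 := by
    refine T.eq_of_pairing_eq fun r => ?_
    rw [map_sub, LinearMap.sub_apply, map_zero, LinearMap.zero_apply,
      ← V.pairing_lift_add W.zeta_sub W.zeta_sub W.zeta_zeta (w * w' - c • 1) r,
      add_sub_cancel_left, h1]
  rw [map_sub, V.lift_hol _ (V.hol.smul_mem V.hol.one_mem c)] at h2
  linear_combination h2

/-- The splittings of germs into a holomorphic part and a combination of derivatives of `ζ`, or of
a germ `φ`. -/
noncomputable def splitting {G : GreenSystem K}
    (hdiag : ∀ s t, G.diag s t = T.pairing s (V.lift ζ t))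
    (hplus : ∀ μ s t, G.plus μ s t = T.pairing s (V.lift (φ μ) t))
    (hminus : ∀ μ s t, G.minus μ s t = -T.pairing (V.lift (φ (-μ)) s) t) :
    T.Splitting G ⟨0, 0, 0⟩ S :=
  have hP : ∀ s t, T.pairing (V.lift ζ s) t + T.pairing s (V.lift ζ t) = T.pairing s t :=
    V.pairing_lift_add W.zeta_sub W.zeta_sub W.zeta_zeta
  have hQ : ∀ μ ∈ S, ∀ s t, T.pairing (V.lift (φ (-μ)) s) t + T.pairing s (V.lift (φ μ) t) =
      T.pairing s t := fun μ hμ =>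
    V.pairing_lift_add (W.phi_sub _ (W.neg_mem μ hμ)) (W.phi_sub μ hμ)
      (by have := W.phi_phi _ (W.neg_mem μ hμ); rwa [neg_neg] at this)
  have hplus_eq : ∀ μ ∈ S, ∀ s t, T.pairing (s - V.lift (φ (-μ)) s) t = G.plus μ s t := by
    intro μ hμ s t
    rw [hplus, map_sub, LinearMap.sub_apply, ← hQ μ hμ, add_sub_cancel_left]
  -- The lifts appear in the action of G and G^+_μ on v. The action on u is the adjoint, that is 1
  -- minus a lift, with μ replaced by −μ for G^+_μ.
  { P := LinearMap.id - V.lift ζ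
    Q := fun μ => LinearMap.id - V.lift (φ (-μ))
    dQ := fun μ => V.lift (dφ (-μ))
    isOpen := W.isOpen
    neg_mem := W.neg_mem
    diag_eq := fun s t => by
      rw [hdiag, LinearMap.sub_apply, LinearMap.id_apply, map_sub, LinearMap.sub_apply, ← hP,
        add_sub_cancel_left]
    plus_eq := hplus_eq
    minus_eq := fun μ hμ s t => by simp [hminus]
    P_symm := fun s t => by
      simp only [LinearMap.sub_apply, LinearMap.id_apply, map_sub]
      linear_combination -hP s t
    Q_symm := fun μ hμ s t => by
      simp only [LinearMap.sub_apply, LinearMap.id_apply, map_sub, neg_neg]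
      linear_combination -hQ μ hμ s t
    P_D := fun s => by simp only [LinearMap.sub_apply, LinearMap.id_apply, V.lift_D, map_sub]
    Q_D := fun μ hμ s => by simp only [LinearMap.sub_apply, LinearMap.id_apply, V.lift_D, map_sub]
    hasDerivAt_plus := fun μ hμ s t => by
      have h1 := V.hasDerivAt_pairing_lift (W.hasDerivAt (-μ) (W.neg_mem μ hμ)) s t
      have h2 := (HasDerivAt.scomp μ h1 (hasDerivAt_neg μ)).const_sub (T.pairing s t)
      simp only [neg_smul, one_smul, neg_neg] at h2
      refine h2.congr_of_eventuallyEq ?_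
      filter_upwards [W.isOpen.mem_nhds hμ] with y hy
      rw [← hplus_eq y hy, map_sub, LinearMap.sub_apply]
      rfl
    mul_PQ := fun μ hμ s t => by
      have h1 := W.sub_lift_lift_mul_lift (W.neg_mem μ hμ) s t
      -- The product of the two holomorphic parts is holomorphic, so the lift kills it. Adding this
      -- to the formula for the product of the lifts gives the identity.
      have h2 := V.lift_hol (φ (-μ)) (V.hol.mul_mem (V.sub_lift_mem W.zeta_sub s)
        (V.sub_lift_mem (W.phi_sub _ (W.neg_mem μ hμ)) t))
      simp only [LinearMap.sub_apply, LinearMap.id_apply, mul_sub, sub_mul, map_sub,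
        sub_sub_cancel] at h1 h2 ⊢
      linear_combination h1 + h2
    mul_QQ := fun μ hμ s t => by
      have h1 := W.lift_mul_lift hμ s t
      have h2 := V.lift_hol ζ (V.hol.mul_mem
        (V.sub_lift_mem (W.phi_sub _ (W.neg_mem μ hμ)) s) (V.sub_lift_mem (W.phi_sub μ hμ) t))
      simp only [LinearMap.sub_apply, LinearMap.id_apply, mul_sub, sub_mul, map_sub, neg_neg,
        sub_sub_cancel] at h1 h2 ⊢
      linear_combination h1 + h2
    -- Holomorphic germs are stable under D and isotropic; hence there is no central term.
    central_diag := fun s t =>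
      V.pairing_hol (V.D_mem _ (V.sub_lift_mem W.zeta_sub s)) (V.sub_lift_mem W.zeta_sub t)
    central_plus := fun μ hμ s t =>
      V.pairing_hol (V.D_mem _ (V.sub_lift_mem (W.phi_sub _ (W.neg_mem μ hμ)) s))
        (V.sub_lift_mem (by rw [neg_neg]; exact W.phi_sub μ hμ) t) }

end Kernels

end PolarData

end TestFunctionAlgebra

/-! ### Holomorphic germs and the coordinate at the origin. -/

namespace LocalField

theorem mk_add {f g : ℂ → ℂ} (hf : MeromorphicAt f 0) (hg : MeromorphicAt g 0) :
    mk f hf + mk g hg = mk (f + g) (hf.add hg) := rfl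

theorem mk_sub {f g : ℂ → ℂ} (hf : MeromorphicAt f 0) (hg : MeromorphicAt g 0) :
    mk f hf - mk g hg = mk (f - g) (hf.sub hg) := rfl

theorem mk_mul {f g : ℂ → ℂ} (hf : MeromorphicAt f 0) (hg : MeromorphicAt g 0) :
    mk f hf * mk g hg = mk (f * g) (hf.mul hg) := rfl

theorem mk_smul (c : ℂ) {f : ℂ → ℂ} (hf : MeromorphicAt f 0) :
    c • mk f hf = mk (c • f) (hf.const_smul c) := rfl

theorem mk_one : mk (fun _ => 1) (MeromorphicAt.const 1 0) = 1 := rfl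

theorem D_mk {f : ℂ → ℂ} (hf : MeromorphicAt f 0) :
    testAlgebra.D (mk f hf) = mk (deriv f) hf.deriv := derivGerm_mk f hf

theorem integral_mk {f : ℂ → ℂ} (hf : MeromorphicAt f 0) :
    testAlgebra.integral (mk f hf) = residueFun f := residueGerm_mk f hf

theorem meromorphicAt_iterate_deriv {f : ℂ → ℂ} (hf : MeromorphicAt f 0) (n : ℕ) :
    MeromorphicAt (deriv^[n] f) 0 := by
  induction n with
  | zero => exact hf
  | succ n ih => rw [Function.iterate_succ_apply']; exact ih.deriv

theorem iterate_D_mk {f : ℂ → ℂ} (hf : MeromorphicAt f 0) (n : ℕ) :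
    (⇑testAlgebra.D)^[n] (mk f hf) = mk (deriv^[n] f) (meromorphicAt_iterate_deriv hf n) := by
  induction n with
  | zero => rfl
  | succ n ih => simp only [Function.iterate_succ_apply', ih, D_mk]

/-- The germs of holomorphic functions. -/
def hol : Subalgebra ℂ LocalField where
  carrier := {s | ∃ f, ∃ hf : AnalyticAt ℂ f 0, s = mk f hf.meromorphicAt}
  mul_mem' := by
    rintro _ _ ⟨f, hf, rfl⟩ ⟨g, hg, rfl⟩
    exact ⟨f * g, hf.mul hg, rfl⟩
  add_mem' := by
    rintro _ _ ⟨f, hf, rfl⟩ ⟨g, hg, rfl⟩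
    exact ⟨f + g, hf.add hg, rfl⟩
  algebraMap_mem' c := ⟨fun _ => c, analyticAt_const, rfl⟩

theorem mk_mem_hol {f : ℂ → ℂ} (hf : AnalyticAt ℂ f 0) : mk f hf.meromorphicAt ∈ hol :=
  ⟨f, hf, rfl⟩

theorem D_mem_hol {s : LocalField} (hs : s ∈ hol) : testAlgebra.D s ∈ hol := by
  obtain ⟨f, hf, rfl⟩ := hs
  exact ⟨deriv f, hf.deriv, D_mk _⟩

theorem integral_hol {s : LocalField} (hs : s ∈ hol) : testAlgebra.integral s = 0 := by
  obtain ⟨f, hf, rfl⟩ := hs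
  rw [integral_mk]
  obtain ⟨ε, hε, h⟩ := Metric.eventually_nhds_iff.1 hf.eventually_analyticAt
  obtain ⟨R, h1, h2⟩ := ((eventually_circle hf.meromorphicAt).and (Ioo_mem_nhdsGT hε)).exists
  rw [← h1, Complex.circleIntegral_eq_zero_of_differentiable_on_off_countable h2.1.le
    Set.countable_empty, mul_zero]
  · exact fun u hu => (h (lt_of_le_of_lt (Metric.mem_closedBall.1 hu)
      h2.2)).continuousAt.continuousWithinAt
  · exact fun u hu => (h (lt_trans (Metric.mem_ball.1 hu.1) h2.2)).differentiableAt

/-- The germ of `1 / u`. -/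
noncomputable def coordInv : LocalField := mk (fun u => u⁻¹) (MeromorphicAt.id 0).inv

theorem coord_mem_hol : coord ∈ hol := mk_mem_hol (f := fun u => u) analyticAt_id

theorem coord_mul_coordInv : coord * coordInv = 1 := by
  rw [coord, coordInv, mk_mul, ← mk_one, mk_eq_mk]
  filter_upwards [self_mem_nhdsWithin] with u hu
  exact mul_inv_cancel₀ hu

theorem D_coord : testAlgebra.D coord = 1 := by
  rw [coord, D_mk, ← mk_one, mk_eq_mk]
  exact Eventually.of_forall fun u => deriv_id u

theorem integral_coordInv : testAlgebra.integral coordInv = 1 := by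
  have hm : MeromorphicAt (fun u : ℂ => u⁻¹) 0 := (MeromorphicAt.id (0 : ℂ)).inv
  rw [coordInv, integral_mk]
  obtain ⟨R, h3, h4⟩ := ((eventually_circle hm).and self_mem_nhdsWithin).exists
  rw [← h3]
  have := circleIntegral.integral_sub_center_inv (0 : ℂ) (ne_of_gt h4)
  simp only [sub_zero] at this
  rw [this, inv_mul_cancel₀ Complex.two_pi_I_ne_zero]

theorem exists_eq_const_add {s : LocalField} (hs : s ∈ hol) :
    ∃ (c : ℂ) (t : LocalField), t ∈ hol ∧ s = c • 1 + coord * t := by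
  obtain ⟨f, hf, rfl⟩ := hs
  obtain ⟨g, hg⟩ : ∃ g : ℂ → ℂ, AnalyticAt ℂ g 0 ∧ ∀ u, f u = f 0 + u * g u := by
    refine ⟨dslope f 0, ?_, fun u => ?_⟩
    · obtain ⟨p, hp⟩ := hf
      exact ⟨_, hp.has_fpower_series_dslope_fslope⟩
    · have := sub_smul_dslope f 0 u
      rw [sub_zero, smul_eq_mul] at this
      rw [this]; ring
  refine ⟨f 0, mk g hg.1.meromorphicAt, mk_mem_hol hg.1, ?_⟩
  rw [← mk_one, mk_smul, coord, mk_mul, mk_add, mk_eq_mk]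
  exact Eventually.of_forall fun u => by simp [hg.2 u]

theorem exists_coord_pow_mul_mem (s : LocalField) : ∃ n, coord ^ n * s ∈ hol := by
  obtain ⟨f, hf, rfl⟩ := s.exists_rep
  obtain ⟨n, hn⟩ := id hf
  refine ⟨n, _, hn, ?_⟩
  have hc : coord ^ n = mk (fun u => u ^ n) ((MeromorphicAt.id 0).pow n) := by
    clear hn
    induction n with
    | zero => simp [← mk_one]
    | succ n ih =>
      rw [pow_succ, ih, coord, mk_mul, mk_eq_mk]
      exact Eventually.of_forall fun u => (pow_succ u n).symm
  rw [hc, mk_mul, mk_eq_mk]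
  exact Eventually.of_forall fun u => by simp

/-- The algebra of germs with the coordinate `u`. -/
noncomputable def polarData : testAlgebra.PolarData where
  hol := hol
  x := coord
  y := coordInv
  x_mem := coord_mem_hol
  x_mul_y := coord_mul_coordInv
  D_x := D_coord
  D_mem _ := D_mem_hol
  integral_hol _ := integral_hol
  integral_y := integral_coordInv
  exists_eq_const_add _ := exists_eq_const_add
  exists_pow_mul_mem := exists_coord_pow_mul_mem

end LocalField

/-! ### Contour integrals of periodic functions -/

/-- The integral over the unit horizontal segment centred at `b`. -/
noncomputable def lineIntegral (F : ℂ → ℂ) (b : ℂ) : ℂ :=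
  ∫ x in (-(1 / 2) : ℝ)..(1 / 2), F (x + b)

theorem lineIntegral_add_real {F : ℂ → ℂ} (hF : ∀ u, F (u + 1) = F u) (b : ℂ) (r : ℝ) :
    lineIntegral F (b + r) = lineIntegral F b := by
  have hp : Function.Periodic (fun x : ℝ => F (x + b)) 1 := fun x => by
    change F ((x + 1 : ℝ) + b) = F (x + b)
    rw [← hF (x + b)]; push_cast; congr 1; ring
  have h1 := hp.intervalIntegral_add_eq (-(1 / 2)) (-(1 / 2) + r)
  have h2 := intervalIntegral.integral_comp_add_right (fun x : ℝ => F (x + b)) (a := -(1 / 2))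
    (b := 1 / 2) r
  rw [lineIntegral, lineIntegral]
  calc _ = ∫ x in (-(1 / 2) : ℝ)..(1 / 2), F ((x + r : ℝ) + b) := by
        refine intervalIntegral.integral_congr fun x _ => ?_
        push_cast; congr 1; ring
    _ = _ := by
      rw [h2, show (1 / 2 + r : ℝ) = -(1 / 2) + r + 1 by ring, ← h1]
      norm_num

theorem lineIntegral_eq_im {F : ℂ → ℂ} (hF : ∀ u, F (u + 1) = F u) (b : ℂ) :
    lineIntegral F b = lineIntegral F (b.im * Complex.I) := by
  rw [← lineIntegral_add_real hF (b.im * Complex.I) b.re]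
  congr 1
  rw [add_comm]; exact (Complex.re_add_im b).symm

theorem lineIntegral_congr {F G : ℂ → ℂ} {b : ℂ} (h : ∀ x : ℝ, F (x + b) = G (x + b)) :
    lineIntegral F b = lineIntegral G b :=
  intervalIntegral.integral_congr fun x _ => h x

/-- Cauchy's theorem on a rectangle, where the vertical sides cancel. Periodicity is asked for on
these sides only, so that the function may be altered at the origin. -/
theorem lineIntegral_eq_lineIntegral {F : ℂ → ℂ} {a b : ℝ}
    (hF : ∀ y : ℝ, F (1 / 2 + y * Complex.I) = F (-(1 / 2) + y * Complex.I))
    (hd : ∀ u : ℂ, u.re ∈ Set.Icc (-(1 / 2) : ℝ) (1 / 2) → u.im ∈ Set.uIcc a b →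
      DifferentiableAt ℂ F u) :
    lineIntegral F (a * Complex.I) = lineIntegral F (b * Complex.I) := by
  have h := Complex.integral_boundary_rect_eq_zero_of_differentiableOn F
    ⟨-(1 / 2), a⟩ ⟨1 / 2, b⟩ (fun u hu => by
      rw [Complex.mem_reProdIm] at hu
      refine (hd u ?_ hu.2).differentiableWithinAt
      have := hu.1
      rwa [Set.uIcc_of_le (by norm_num)] at this)
  simp only [smul_eq_mul] at h
  have e : (∫ y in a..b, F (((1 / 2 : ℝ) : ℂ) + y * Complex.I)) =
      ∫ y in a..b, F (((-(1 / 2) : ℝ) : ℂ) + y * Complex.I) :=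
    intervalIntegral.integral_congr fun y _ => by simpa using hF y
  rw [e, add_sub_cancel_right, sub_eq_zero] at h
  exact h

theorem lineIntegral_deriv {F : ℂ → ℂ} (hF : ∀ u, F (u + 1) = F u) {b : ℂ}
    (hd : ∀ x : ℝ, AnalyticAt ℂ F (x + b)) : lineIntegral (deriv F) b = 0 := by
  rw [lineIntegral, intervalIntegral.integral_eq_sub_of_hasDerivAt
    (f := fun x : ℝ => F (x + b))]
  · rw [← hF ((-(1 / 2) : ℝ) + b)]
    push_cast
    rw [show (-(1 / 2) + b + 1 : ℂ) = 1 / 2 + b by ring, sub_self]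
  · intro x _
    exact ((hd x).differentiableAt.hasDerivAt.comp_add_const (x : ℂ) b).comp_ofReal
  · refine Continuous.intervalIntegrable (continuous_iff_continuousAt.2 fun x => ?_) _ _
    exact ContinuousAt.comp (f := fun x : ℝ => (x + b : ℂ)) (hd x).deriv.continuousAt (by fun_prop)

theorem lineIntegral_add {F G : ℂ → ℂ} {b : ℂ} (hF : Continuous fun x : ℝ => F (x + b))
    (hG : Continuous fun x : ℝ => G (x + b)) :
    lineIntegral (F + G) b = lineIntegral F b + lineIntegral G b :=
  intervalIntegral.integral_add (hF.intervalIntegrable _ _) (hG.intervalIntegrable _ _)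

theorem lineIntegral_smul (c : ℂ) (F : ℂ → ℂ) (b : ℂ) :
    lineIntegral (c • F) b = c * lineIntegral F b :=
  intervalIntegral.integral_const_mul _ _

/-! ### Simple poles, and a periodic function with pole 1/u. -/

namespace LocalField

/-- Quotients with a simple pole at the origin. -/
theorem div_sub_coordInv_mem {N f : ℂ → ℂ} (hN : AnalyticAt ℂ N 0) (hf : AnalyticAt ℂ f 0)
    (h0 : f 0 = 0) (h1 : deriv f 0 = N 0) (h2 : N 0 ≠ 0)
    (hm : MeromorphicAt (fun u => N u / f u) 0) : mk (fun u => N u / f u) hm - coordInv ∈ hol := by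
  have key : ∀ F : ℂ → ℂ, AnalyticAt ℂ F 0 → F 0 = 0 →
      ∃ g : ℂ → ℂ, AnalyticAt ℂ g 0 ∧ (∀ u, F u = u * g u) ∧ g 0 = deriv F 0 := by
    intro F hF hF0
    refine ⟨dslope F 0, ?_, fun u => ?_, dslope_same F 0⟩
    · obtain ⟨p, hp⟩ := hF
      exact ⟨_, hp.has_fpower_series_dslope_fslope⟩
    · have := sub_smul_dslope F 0 u
      rw [sub_zero, smul_eq_mul, hF0, sub_zero] at this
      exact this.symm
  obtain ⟨g, hg, hfg, hg0⟩ := key f hf h0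
  -- With f = ug one has N/f − 1/u = (N − g)/(ug), and N − g = uk vanishes at 0 because g(0) = f'(0)
  -- = N(0).
  obtain ⟨k, hk, hNk, -⟩ := key (N - g) (hN.sub hg) (by simp [hg0, h1])
  have hg0' : g 0 ≠ 0 := by rw [hg0, h1]; exact h2
  have ha : AnalyticAt ℂ (k / g) 0 := hk.div hg hg0'
  refine ⟨_, ha, ?_⟩
  rw [coordInv, mk_sub, mk_eq_mk]
  filter_upwards [self_mem_nhdsWithin,
    (hg.continuousAt.eventually_ne hg0').filter_mono nhdsWithin_le_nhds] with u hu hgu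
  have hu : u ≠ 0 := hu
  have := hNk u
  simp only [Pi.sub_apply, Pi.div_apply, hfg] at this ⊢
  field_simp
  exact this

/-- The quotient is the difference of (N + f'(0))/f and f'(0)/f, which both have polar part 1/u. -/
theorem div_mem_hol {N f : ℂ → ℂ} (hN : AnalyticAt ℂ N 0) (hf : AnalyticAt ℂ f 0)
    (h0 : f 0 = 0) (h1 : deriv f 0 ≠ 0) (h2 : N 0 = 0)
    (hm : MeromorphicAt (fun u => N u / f u) 0) : mk (fun u => N u / f u) hm ∈ hol := by
  have hm' : MeromorphicAt (fun u => (N u + deriv f 0) / f u) 0 :=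
    (hN.add analyticAt_const).meromorphicAt.div hf.meromorphicAt
  have hm'' : MeromorphicAt (fun u => deriv f 0 / f u) 0 :=
    analyticAt_const.meromorphicAt.div hf.meromorphicAt
  have h3 := div_sub_coordInv_mem (hN.add (analyticAt_const (v := deriv f 0))) hf h0
    (by simp [h2]) (by simpa [h2] using h1) hm'
  have h4 := div_sub_coordInv_mem (analyticAt_const (v := deriv f 0)) hf h0 rfl h1 hm''
  have h5 := hol.sub_mem h3 h4
  have e : mk (fun u => N u / f u) hm = mk _ hm' - coordInv - (mk _ hm'' - coordInv) := by
    rw [sub_sub_sub_cancel_right, mk_sub, mk_eq_mk]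
    refine Eventually.of_forall fun u => ?_
    simp only [Pi.sub_apply]; ring
  rw [e]; exact h5

/-- `2πi / (e^{2πiu} - 1)`. -/
noncomputable def kappa (u : ℂ) : ℂ :=
  2 * Real.pi * Complex.I / (Complex.exp (2 * Real.pi * Complex.I * u) - 1)

theorem kappa_add_one (u : ℂ) : kappa (u + 1) = kappa u := by
  rw [kappa, kappa, mul_add, mul_one, Complex.exp_add, Complex.exp_two_pi_mul_I, mul_one]

theorem exp_sub_one_ne_zero {u : ℂ} (h : ∀ n : ℤ, u ≠ n) :
    Complex.exp (2 * Real.pi * Complex.I * u) - 1 ≠ 0 := by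
  intro h0
  obtain ⟨n, hn⟩ := Complex.exp_eq_one_iff.1 (sub_eq_zero.1 h0)
  refine h n (mul_left_cancel₀ Complex.two_pi_I_ne_zero ?_)
  rw [hn]; ring

theorem analyticAt_kappa {u : ℂ} (h : ∀ n : ℤ, u ≠ n) : AnalyticAt ℂ kappa u := by
  refine AnalyticAt.div (by fun_prop) (by fun_prop) (exp_sub_one_ne_zero h)

theorem meromorphicAt_kappa : MeromorphicAt kappa 0 :=
  (MeromorphicAt.const _ _).div (AnalyticAt.meromorphicAt (by fun_prop))

theorem kappa_sub_mem : mk kappa meromorphicAt_kappa - coordInv ∈ hol := by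
  refine div_sub_coordInv_mem (N := fun _ => 2 * Real.pi * Complex.I)
    (f := fun u => Complex.exp (2 * Real.pi * Complex.I * u) - 1) analyticAt_const (by fun_prop)
    (by simp) ?_ Complex.two_pi_I_ne_zero _
  have h : HasDerivAt (fun u : ℂ => Complex.exp (2 * Real.pi * Complex.I * u) - 1)
      (Complex.exp (2 * Real.pi * Complex.I * 0) * (2 * Real.pi * Complex.I * 1)) 0 :=
    (((hasDerivAt_id (0 : ℂ)).const_mul _).cexp).sub_const _
  rw [h.deriv]; simp

/-- The substitution z = e^{2πiu} maps the segment to the circle of radius e^{−2πy} and κ du to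
dz/(z−1) − dz/z. The pole at 0 is always enclosed, the pole at 1 only for y < 0. -/
theorem lineIntegral_kappa {y : ℝ} (hy : y ≠ 0) :
    lineIntegral kappa (y * Complex.I) = if 0 < y then -(2 * Real.pi * Complex.I) else 0 := by
  set R := Real.exp (-(2 * Real.pi * y)) with hR
  have hR0 : 0 < R := Real.exp_pos _
  have h1 : lineIntegral kappa (y * Complex.I) = ∫ x in (0 : ℝ)..1, kappa (x + y * Complex.I) := by
    rw [← lineIntegral_add_real kappa_add_one _ (1 / 2), lineIntegral]
    have h2 := intervalIntegral.integral_comp_add_right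
      (fun x : ℝ => kappa (x + y * Complex.I)) (a := -(1 / 2)) (b := 1 / 2) (1 / 2)
    rw [show (-(1 / 2) + 1 / 2 : ℝ) = 0 by ring, show (1 / 2 + 1 / 2 : ℝ) = 1 by norm_num] at h2
    rw [← h2]
    refine intervalIntegral.integral_congr fun x _ => ?_
    push_cast; congr 1; ring
  have hcm (x : ℝ) : Complex.exp (2 * Real.pi * Complex.I * (x + y * Complex.I)) =
      circleMap 0 R (2 * Real.pi * x) := by
    rw [circleMap_zero, hR, Complex.ofReal_exp, ← Complex.exp_add]
    congr 1
    push_cast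
    linear_combination (2 * Real.pi * y : ℂ) * Complex.I_sq
  have hRne : R ≠ 1 := by
    intro h
    rw [hR, Real.exp_eq_one_iff, neg_eq_zero] at h
    rcases mul_eq_zero.1 h with h | h
    · exact absurd h (by positivity)
    · exact hy h
  have hzne (θ : ℝ) : circleMap 0 R θ - 1 ≠ 0 := by
    intro h
    have := congrArg norm (sub_eq_zero.1 h)
    rw [norm_circleMap_zero, abs_of_pos hR0, norm_one] at this
    exact hRne this
  have hzne' (θ : ℝ) : circleMap 0 R θ ≠ 0 := circleMap_ne_center hR0.ne'
  have h2 : (∫ x in (0 : ℝ)..1, kappa (x + y * Complex.I)) =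
      (∮ z in C(0, R), (z - 1)⁻¹) - ∮ z in C(0, R), (z - 0)⁻¹ := by
    rw [← circleIntegral.integral_sub, circleIntegral]
    · have h3 := intervalIntegral.smul_integral_comp_mul_left (a := 0) (b := 1)
        (fun θ : ℝ => deriv (circleMap 0 R) θ •
          ((circleMap 0 R θ - 1)⁻¹ - (circleMap 0 R θ - 0)⁻¹)) (2 * Real.pi)
      rw [mul_zero, mul_one] at h3
      rw [← h3, Complex.real_smul, ← intervalIntegral.integral_const_mul]
      refine intervalIntegral.integral_congr fun x _ => ?_
      simp only [kappa, hcm, deriv_circleMap, smul_eq_mul, sub_zero]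
      have h4 := hzne (2 * Real.pi * x)
      have h5 := hzne' (2 * Real.pi * x)
      field_simp
      push_cast
      ring
    · refine ContinuousOn.circleIntegrable hR0.le ?_
      refine ContinuousOn.inv₀ (by fun_prop) fun z hz => ?_
      intro h
      rw [sub_eq_zero] at h
      rw [h, mem_sphere_zero_iff_norm, norm_one] at hz
      exact hRne hz.symm
    · refine ContinuousOn.circleIntegrable hR0.le ?_
      refine ContinuousOn.inv₀ (by fun_prop) fun z hz => ?_
      intro h
      rw [sub_zero] at h
      rw [h, mem_sphere_zero_iff_norm, norm_zero] at hz
      exact hR0.ne hz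
  rw [h1, h2, circleIntegral.integral_sub_center_inv _ hR0.ne']
  split_ifs with hpos
  · have hR1 : R < 1 := by
      rw [hR, Real.exp_lt_one_iff]
      have := mul_pos Real.two_pi_pos hpos
      linarith
    rw [Complex.circleIntegral_eq_zero_of_differentiable_on_off_countable hR0.le
      Set.countable_empty, zero_sub]
    · refine ContinuousOn.inv₀ (by fun_prop) fun z hz h => ?_
      rw [sub_eq_zero] at h
      rw [h, mem_closedBall_zero_iff, norm_one] at hz
      linarith
    · intro z hz
      refine DifferentiableAt.inv (by fun_prop) fun h => ?_
      rw [sub_eq_zero] at h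
      have := hz.1
      rw [h, mem_ball_zero_iff, norm_one] at this
      linarith
  · have hR1 : 1 < R := by
      rw [hR, Real.one_lt_exp_iff]
      have hy' : y < 0 := lt_of_le_of_ne (not_lt.1 hpos) hy
      have := mul_pos Real.two_pi_pos (neg_pos.2 hy')
      linarith
    rw [circleIntegral.integral_sub_inv_of_mem_ball, sub_self]
    rw [mem_ball_zero_iff, norm_one]; exact hR1

end LocalField

/-- The functions of period `1` which are analytic in the strip `|Im u| ≤ β` except at the integers
and meromorphic at the integers. -/
structure IsStripFunction (β : ℝ) (F : ℂ → ℂ) : Prop where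
  periodic : ∀ u, F (u + 1) = F u
  meromorphicAt : MeromorphicAt F 0
  analyticAt : ∀ u : ℂ, |u.im| ≤ β → (∀ n : ℤ, u ≠ n) → AnalyticAt ℂ F u

/-! ### The residue theorem on a periodic strip. -/

namespace IsStripFunction

variable {β : ℝ} {F G : ℂ → ℂ}

theorem add (hF : IsStripFunction β F) (hG : IsStripFunction β G) : IsStripFunction β (F + G) :=
  ⟨fun u => by simp [hF.periodic, hG.periodic], hF.meromorphicAt.add hG.meromorphicAt,
    fun u h h' => (hF.analyticAt u h h').add (hG.analyticAt u h h')⟩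

theorem mul (hF : IsStripFunction β F) (hG : IsStripFunction β G) : IsStripFunction β (F * G) :=
  ⟨fun u => by simp [hF.periodic, hG.periodic], hF.meromorphicAt.mul hG.meromorphicAt,
    fun u h h' => (hF.analyticAt u h h').mul (hG.analyticAt u h h')⟩

theorem const_smul (c : ℂ) (hF : IsStripFunction β F) : IsStripFunction β (c • F) :=
  ⟨fun u => by simp [hF.periodic], hF.meromorphicAt.const_smul c,
    fun u h h' => (hF.analyticAt u h h').const_smul⟩

theorem deriv (hF : IsStripFunction β F) : IsStripFunction β (deriv F) :=
  ⟨fun u => (deriv_comp_add_const F 1 u).symm.trans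
      (congrArg (fun f => _root_.deriv f u) (funext hF.periodic)),
    hF.meromorphicAt.deriv, fun u h h' => (hF.analyticAt u h h').deriv⟩

theorem iterate_deriv (hF : IsStripFunction β F) (n : ℕ) :
    IsStripFunction β (_root_.deriv^[n] F) := by
  induction n with
  | zero => exact hF
  | succ n ih => rw [Function.iterate_succ_apply']; exact ih.deriv

theorem analyticAt_line (hF : IsStripFunction β F) {b : ℂ} (hb : b.im ≠ 0) (hb' : |b.im| ≤ β)
    (x : ℝ) : AnalyticAt ℂ F (x + b) :=
  hF.analyticAt _ (by simpa using hb') fun n h => hb (by simpa using congrArg Complex.im h)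

theorem continuous_line (hF : IsStripFunction β F) {b : ℂ} (hb : b.im ≠ 0) (hb' : |b.im| ≤ β) :
    Continuous fun x : ℝ => F (x + b) :=
  continuous_iff_continuousAt.2 fun x =>
    ContinuousAt.comp (f := fun x : ℝ => (x + b : ℂ)) (hF.analyticAt_line hb hb' x).continuousAt
      (by fun_prop)

/-- The case of a removable singularity: 0 is the only integer in the rectangle |Re u| ≤ 1/2, and
correcting the value there allows Cauchy's theorem. -/
theorem lineIntegral_sub_eq_residue_aux (hβ : 0 < β) (hF : IsStripFunction β F) {w : LocalField}
    (hw : w ∈ LocalField.hol) (h : LocalField.mk F hF.meromorphicAt = w) :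
    lineIntegral F ((-β : ℝ) * Complex.I) = lineIntegral F (β * Complex.I) := by
  obtain ⟨g, hg, rfl⟩ := hw
  rw [LocalField.mk_eq_mk] at h
  have hup : ∀ u : ℂ, u ≠ 0 → Function.update F 0 (g 0) u = F u := fun u hu =>
    Function.update_of_ne hu _ _
  have hev : Function.update F 0 (g 0) =ᶠ[𝓝 0] g := by
    rw [eventuallyEq_nhdsWithin_iff] at h
    filter_upwards [h] with u hu
    by_cases h0 : u = 0
    · rw [h0, Function.update_self]
    · rw [hup u h0]; exact hu h0
  have hline : ∀ y : ℝ, y ≠ 0 → lineIntegral F (y * Complex.I) =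
      lineIntegral (Function.update F 0 (g 0)) (y * Complex.I) := fun y hy =>
    lineIntegral_congr fun x => (hup _ fun h => hy (by simpa using congrArg Complex.im h)).symm
  rw [hline _ hβ.ne', hline _ (neg_ne_zero.2 hβ.ne')]
  refine lineIntegral_eq_lineIntegral (fun y => ?_) fun u h1 h2 => ?_
  · rw [hup, hup, ← hF.periodic (-(1 / 2) + y * Complex.I)]
    · congr 1; ring
    · intro h
      have := congrArg Complex.re h
      norm_num at this
    · intro h
      have := congrArg Complex.re h
      norm_num at this
  · by_cases h0 : u = 0
    · rw [h0]; exact (hg.congr hev.symm).differentiableAt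
    · refine DifferentiableAt.congr_of_eventuallyEq (f := F) ?_ ?_
      · refine (hF.analyticAt u ?_ fun n hn => ?_).differentiableAt
        · rw [Set.uIcc_of_le (by linarith)] at h2
          exact abs_le.2 h2
        · have h3 : u.re = n := by rw [hn]; simp
          have h4 : n = 0 := by
            rw [h3] at h1
            have h5 : (n : ℝ) < 1 := lt_of_le_of_lt h1.2 (by norm_num)
            have h6 : (-1 : ℝ) < n := lt_of_lt_of_le (by norm_num) h1.1
            have h5' : n < 1 := by exact_mod_cast h5
            have h6' : -1 < n := by exact_mod_cast h6
            omega
          exact h0 (by rw [hn, h4]; simp)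
      · filter_upwards [eventually_ne_nhds h0] with v hv
        exact hup v hv

/-- Subtract a combination of derivatives of `kappa` with the same polar part. The formula is
explicit for `kappa`, reads 0 = 0 for its derivatives, and the remainder is the removable case. -/
theorem lineIntegral_sub_eq_residue (hβ : 0 < β) (hF : IsStripFunction β F) :
    lineIntegral F ((-β : ℝ) * Complex.I) - lineIntegral F (β * Complex.I) =
      2 * Real.pi * Complex.I * LocalField.residueFun F := by
  have hβ1 : ((-β : ℝ) * Complex.I).im ≠ 0 := by simpa using hβ.ne'
  have hβ2 : ((β : ℝ) * Complex.I).im ≠ 0 := by simpa using hβ.ne'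
  have hβ3 : |((-β : ℝ) * Complex.I).im| ≤ β := by simp [abs_of_pos hβ]
  have hβ4 : |((β : ℝ) * Complex.I).im| ≤ β := by simp [abs_of_pos hβ]
  have hk : IsStripFunction β LocalField.kappa := ⟨LocalField.kappa_add_one,
    LocalField.meromorphicAt_kappa, fun u _ h => LocalField.analyticAt_kappa h⟩
  set k := LocalField.mk LocalField.kappa LocalField.meromorphicAt_kappa with hkdef
  -- The lift is only a germ; the induction carries along a function on the strip that represents
  -- it.
  have key : ∃ (F' : ℂ → ℂ) (hF' : IsStripFunction β F'),
      LocalField.mk F' hF'.meromorphicAt =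
        LocalField.polarData.lift k (LocalField.mk F hF.meromorphicAt) ∧
      lineIntegral F' ((-β : ℝ) * Complex.I) - lineIntegral F' (β * Complex.I) =
        2 * Real.pi * Complex.I * LocalField.residueFun F' := by
    refine LocalField.polarData.lift_induction k (p := fun w => ∃ (F' : ℂ → ℂ)
      (hF' : IsStripFunction β F'), LocalField.mk F' hF'.meromorphicAt = w ∧
      lineIntegral F' ((-β : ℝ) * Complex.I) - lineIntegral F' (β * Complex.I) =
        2 * Real.pi * Complex.I * LocalField.residueFun F') ?_ (fun n => ?_) ?_ ?_ _
    · refine ⟨0, ⟨fun u => rfl, MeromorphicAt.const 0 0, fun _ _ _ => analyticAt_const⟩, rfl, ?_⟩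
      have : LocalField.residueFun 0 = 0 := by
        have := LocalField.residueFun_smul 0 (MeromorphicAt.const (0 : ℂ) 0)
        rwa [zero_smul, zero_mul] at this
      rw [this]
      simp [lineIntegral]
    · refine ⟨_root_.deriv^[n] LocalField.kappa, hk.iterate_deriv n,
        (LocalField.iterate_D_mk _ n).symm, ?_⟩
      cases n with
      | zero =>
        have h1 := LocalField.integral_hol LocalField.kappa_sub_mem
        rw [map_sub, LocalField.integral_coordInv, LocalField.integral_mk, sub_eq_zero] at h1
        rw [Function.iterate_zero, id, h1, LocalField.lineIntegral_kappa hβ.ne',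
          LocalField.lineIntegral_kappa (neg_ne_zero.2 hβ.ne'), if_pos hβ, if_neg (by linarith)]
        ring
      | succ n =>
        rw [Function.iterate_succ_apply',
          lineIntegral_deriv (hk.iterate_deriv n).periodic
            ((hk.iterate_deriv n).analyticAt_line hβ1 hβ3),
          lineIntegral_deriv (hk.iterate_deriv n).periodic
            ((hk.iterate_deriv n).analyticAt_line hβ2 hβ4),
          LocalField.residueFun_deriv (hk.iterate_deriv n).meromorphicAt]
        simp
    · rintro _ _ ⟨F₁, h₁, rfl, e₁⟩ ⟨F₂, h₂, rfl, e₂⟩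
      refine ⟨F₁ + F₂, h₁.add h₂, rfl, ?_⟩
      rw [lineIntegral_add (h₁.continuous_line hβ1 hβ3) (h₂.continuous_line hβ1 hβ3),
        lineIntegral_add (h₁.continuous_line hβ2 hβ4) (h₂.continuous_line hβ2 hβ4),
        LocalField.residueFun_add h₁.meromorphicAt h₂.meromorphicAt]
      linear_combination e₁ + e₂
    · rintro c _ ⟨F₁, h₁, rfl, e₁⟩
      refine ⟨c • F₁, h₁.const_smul c, rfl, ?_⟩
      rw [lineIntegral_smul, lineIntegral_smul, LocalField.residueFun_smul c h₁.meromorphicAt]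
      linear_combination c * e₁
  obtain ⟨F', hF', h1, h2⟩ := key
  have h3 := LocalField.polarData.sub_lift_mem LocalField.kappa_sub_mem
    (LocalField.mk F hF.meromorphicAt)
  have hsub : IsStripFunction β (F + (-1 : ℂ) • F') := hF.add (hF'.const_smul _)
  have h4 : LocalField.mk (F + (-1 : ℂ) • F') hsub.meromorphicAt =
      LocalField.mk F hF.meromorphicAt - LocalField.polarData.lift k
        (LocalField.mk F hF.meromorphicAt) := by
    rw [← h1, LocalField.mk_sub, LocalField.mk_eq_mk]
    exact Eventually.of_forall fun u => by simp [sub_eq_add_neg]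
  have h5 := lineIntegral_sub_eq_residue_aux hβ hsub h3 h4
  have h6 : LocalField.residueFun (F + (-1 : ℂ) • F') = 0 := by
    rw [← LocalField.integral_mk hsub.meromorphicAt, h4]
    exact LocalField.integral_hol h3
  rw [lineIntegral_add (hF.continuous_line hβ1 hβ3) ((hF'.const_smul _).continuous_line hβ1 hβ3),
    lineIntegral_add (hF.continuous_line hβ2 hβ4) ((hF'.const_smul _).continuous_line hβ2 hβ4),
    lineIntegral_smul, lineIntegral_smul] at h5
  rw [LocalField.residueFun_add hF.meromorphicAt (hF'.const_smul _).meromorphicAt,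
    LocalField.residueFun_smul _ hF'.meromorphicAt] at h6
  linear_combination h5 + h2 - 2 * Real.pi * Complex.I * h6

end IsStripFunction

/-! ### Fourier coefficients of entire periodic functions -/

/-- The function `e^{2πinu}`. -/
noncomputable def fourierMode (n : ℤ) (u : ℂ) : ℂ := Complex.exp (2 * Real.pi * Complex.I * n * u)

theorem fourierMode_add_one (n : ℤ) (u : ℂ) : fourierMode n (u + 1) = fourierMode n u := by
  rw [fourierMode, fourierMode, mul_add, Complex.exp_add, mul_one, mul_comm _ (n : ℂ),
    Complex.exp_int_mul_two_pi_mul_I, mul_one]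

theorem differentiable_fourierMode (n : ℤ) : Differentiable ℂ (fourierMode n) := by
  unfold fourierMode; fun_prop

theorem fourierMode_add (n : ℤ) (u v : ℂ) :
    fourierMode n (u + v) = fourierMode n u * fourierMode n v := by
  rw [fourierMode, mul_add, Complex.exp_add]; rfl

theorem fourierMode_mul (m n : ℤ) (u : ℂ) :
    fourierMode m u * fourierMode n u = fourierMode (m + n) u := by
  rw [fourierMode, fourierMode, fourierMode, ← Complex.exp_add]; congr 1; push_cast; ring

theorem fourierMode_zero (u : ℂ) : fourierMode 0 u = 1 := by simp [fourierMode]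

theorem lineIntegral_fourierMode (n : ℤ) : lineIntegral (fourierMode n) 0 = if n = 0 then 1 else 0 := by
  split_ifs with h
  · subst h; norm_num [lineIntegral, fourierMode_zero]
  · have hc : 2 * Real.pi * Complex.I * n ≠ 0 :=
      mul_ne_zero Complex.two_pi_I_ne_zero (Int.cast_ne_zero.2 h)
    simp only [lineIntegral, add_zero, fourierMode]
    rw [integral_exp_mul_complex hc, div_eq_zero_iff, sub_eq_zero]
    left
    have := fourierMode_add_one n (-(1 / 2))
    rw [fourierMode, fourierMode] at this
    rw [show ((1 / 2 : ℝ) : ℂ) = -(1 / 2) + 1 by push_cast; ring, this]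
    push_cast; rfl

/-- An entire function which vanishes on the real line is zero. -/
theorem eq_zero_of_forall_real {F : ℂ → ℂ} (hF : Differentiable ℂ F) (h : ∀ x : ℝ, F x = 0)
    (u : ℂ) : F u = 0 := by
  have hfreq : ∃ᶠ u in 𝓝[≠] (0 : ℂ), F u = 0 := by
    have ht : Tendsto (fun x : ℝ => (x : ℂ)) (𝓝[>] 0) (𝓝[≠] 0) := by
      refine tendsto_nhdsWithin_iff.2 ⟨?_, ?_⟩
      · have := (Complex.continuous_ofReal.tendsto 0)
        rw [Complex.ofReal_zero] at this
        exact this.mono_left nhdsWithin_le_nhds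
      · filter_upwards [self_mem_nhdsWithin] with x hx
        simpa using (ne_of_gt hx)
    exact ht.frequently (Eventually.of_forall h).frequently
  exact AnalyticOnNhd.eqOn_zero_of_preconnected_of_frequently_eq_zero
    (fun u _ => hF.analyticAt u) isPreconnected_univ (Set.mem_univ 0) hfreq (Set.mem_univ u)

/-- An entire periodic function is determined by its Fourier coefficients. -/
theorem eq_zero_of_lineIntegral_eq_zero {F : ℂ → ℂ} (hF : Differentiable ℂ F)
    (hp : ∀ u, F (u + 1) = F u)
    (h : ∀ n : ℤ, lineIntegral (fun u => F u * fourierMode (-n) u) 0 = 0) (u : ℂ) : F u = 0 := by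
  have : Fact ((0 : ℝ) < 1) := ⟨one_pos⟩
  refine eq_zero_of_forall_real hF (fun x => ?_) u
  have hper : Function.Periodic (fun x : ℝ => F x) 1 := fun x => by
    change F ((x + 1 : ℝ)) = F x
    rw [← hp x]; push_cast; rfl
  have hcont : Continuous fun x : ℝ => F x := hF.continuous.comp Complex.continuous_ofReal
  let f : C(AddCircle (1 : ℝ), ℂ) := ⟨hper.lift, continuous_coinduced_dom.2 hcont⟩
  have hf : ∀ n, fourierCoeff f n = 0 := fun n => by
    have e : (-(1 / 2) + 1 : ℝ) = 1 / 2 := by norm_num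
    rw [fourierCoeff_eq_intervalIntegral f n (-(1 / 2)), e]
    refine (congrArg _ (Eq.trans ?_ (h n))).trans (smul_zero _)
    refine intervalIntegral.integral_congr fun x _ => ?_
    change _ • F x = F (x + 0) * fourierMode (-n) (x + 0)
    rw [add_zero, fourier_coe_apply, smul_eq_mul, mul_comm, fourierMode]
    simp
  have hs := has_pointwise_sum_fourier_series_of_summable (f := f)
    (by rw [show fourierCoeff f = 0 from funext hf]; exact summable_zero) (x : AddCircle (1 : ℝ))
  simp only [hf, zero_smul] at hs
  exact hs.unique hasSum_zero

/-! ### Entire functions with the quasi-periods of the theta function -/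

/-- Entire functions with the quasi-periods of `jacobiTheta₂ · τ`. -/
structure IsThetaFunction (τ : ℂ) (F : ℂ → ℂ) : Prop where
  differentiable : Differentiable ℂ F
  add_one : ∀ z, F (z + 1) = F z
  add_tau : ∀ z, F (z + τ) = Complex.exp (-Real.pi * Complex.I * (τ + 2 * z)) * F z

namespace IsThetaFunction

variable {τ : ℂ} {F G : ℂ → ℂ}

/-- Moving the contour from ℝ to ℝ + τ, the quasi-period e^{−πiτ−2πiu} turns the mode n into the
mode n + 1. -/
theorem recursion (hF : IsThetaFunction τ F) (n : ℤ) :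
    lineIntegral (fun u => F u * fourierMode (-n) u) 0 =
      Complex.exp (-Real.pi * Complex.I * τ * (2 * n + 1)) *
        lineIntegral (fun u => F u * fourierMode (-(n + 1)) u) 0 := by
  have hper : ∀ u, F (u + 1) * fourierMode (-n) (u + 1) = F u * fourierMode (-n) u := fun u => by
    rw [hF.add_one, fourierMode_add_one]
  have h1 : lineIntegral (fun u => F u * fourierMode (-n) u) 0 =
      lineIntegral (fun u => F u * fourierMode (-n) u) τ := by
    rw [lineIntegral_eq_im hper τ]
    have := lineIntegral_eq_lineIntegral (F := fun u => F u * fourierMode (-n) u) (a := 0)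
      (b := τ.im) (fun y => by
        rw [← hper (-(1 / 2) + _)]
        ring_nf)
      (fun u _ _ => (hF.differentiable u).mul (differentiable_fourierMode _ u))
    simpa using this
  rw [h1, ← smul_eq_mul, lineIntegral, lineIntegral, ← intervalIntegral.integral_smul]
  refine intervalIntegral.integral_congr fun x _ => ?_
  change _ = Complex.exp _ * (_ * _)
  rw [add_zero, hF.add_tau, fourierMode, fourierMode]
  rw [mul_right_comm, ← mul_assoc, mul_right_comm _ (F x), ← Complex.exp_add, ← Complex.exp_add]
  congr 2
  push_cast; ring

/-- By the recursion, all Fourier coefficients are multiples of the zeroth one; so the theta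
functions form a space of dimension at most one. -/
theorem eq_zero (hF : IsThetaFunction τ F) (h : lineIntegral F 0 = 0) (u : ℂ) : F u = 0 := by
  refine eq_zero_of_lineIntegral_eq_zero hF.differentiable hF.add_one (fun n => ?_) u
  induction n using Int.induction_on with
  | zero => simpa [fourierMode_zero] using h
  | succ n ih =>
    rw [hF.recursion] at ih
    exact (mul_eq_zero.1 ih).resolve_left (Complex.exp_ne_zero _)
  | pred n ih =>
    rw [hF.recursion, sub_add_cancel, ih, mul_zero]

theorem add (hF : IsThetaFunction τ F) (hG : IsThetaFunction τ G) : IsThetaFunction τ (F + G) :=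
  ⟨hF.differentiable.add hG.differentiable, fun z => by simp [hF.add_one, hG.add_one],
    fun z => by simp only [Pi.add_apply, hF.add_tau, hG.add_tau]; ring⟩

theorem const_smul (c : ℂ) (hF : IsThetaFunction τ F) : IsThetaFunction τ (c • F) :=
  ⟨hF.differentiable.const_smul c, fun z => by simp [hF.add_one],
    fun z => by simp only [Pi.smul_apply, hF.add_tau, smul_eq_mul]; ring⟩

theorem lineIntegral_smul_eq (hF : IsThetaFunction τ F) (hG : IsThetaFunction τ G) (u : ℂ) :
    lineIntegral G 0 * F u = lineIntegral F 0 * G u := by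
  have hc : ∀ {F : ℂ → ℂ}, IsThetaFunction τ F → Continuous fun x : ℝ => F (x + 0) := fun hF =>
    hF.differentiable.continuous.comp (by fun_prop)
  have h := ((hF.const_smul (lineIntegral G 0)).add (hG.const_smul (-lineIntegral F 0))).eq_zero
    (by
      rw [lineIntegral_add (hc (hF.const_smul _)) (hc (hG.const_smul _)), lineIntegral_smul,
        lineIntegral_smul]
      ring) u
  simp only [Pi.add_apply, Pi.smul_apply, smul_eq_mul] at h
  linear_combination h

end IsThetaFunction

theorem isThetaFunction_jacobiTheta₂ {τ : ℂ} (hτ : 0 < τ.im) :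
    IsThetaFunction τ fun z => jacobiTheta₂ z τ :=
  ⟨fun z => differentiableAt_jacobiTheta₂_fst z hτ, fun z => jacobiTheta₂_add_left z τ,
    fun z => jacobiTheta₂_add_left' z τ⟩

theorem lineIntegral_jacobiTheta₂ {τ : ℂ} (hτ : 0 < τ.im) :
    lineIntegral (fun z => jacobiTheta₂ z τ) 0 = 1 := by
  have hterm : ∀ (n : ℤ) (x : ℂ), jacobiTheta₂_term n x τ =
      Complex.exp (Real.pi * Complex.I * n ^ 2 * τ) * fourierMode n x := fun n x => by
    rw [jacobiTheta₂_term, fourierMode, ← Complex.exp_add, add_comm]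
  have hs := ((summable_jacobiTheta₂_term_iff 0 τ).2 hτ).norm
  have h := intervalIntegral.hasSum_integral_of_dominated_convergence
    (F := fun (n : ℤ) (x : ℝ) => jacobiTheta₂_term n x τ) (f := fun x : ℝ => jacobiTheta₂ x τ)
    (a := -(1 / 2)) (b := 1 / 2) (μ := MeasureTheory.volume)
    (fun n _ => ‖jacobiTheta₂_term n 0 τ‖)
    (fun n => by
      simp only [hterm]
      exact (Continuous.aestronglyMeasurable (continuous_const.mul
        ((differentiable_fourierMode n).continuous.comp Complex.continuous_ofReal))))
    (fun n => Eventually.of_forall fun x _ => by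
      rw [norm_jacobiTheta₂_term, norm_jacobiTheta₂_term]; simp)
    (Eventually.of_forall fun x _ => hs) intervalIntegrable_const
    (Eventually.of_forall fun x _ => hasSum_jacobiTheta₂_term x hτ)
  have h2 : ∀ n : ℤ, (∫ x in (-(1 / 2) : ℝ)..(1 / 2), jacobiTheta₂_term n x τ) =
      if n = 0 then 1 else 0 := fun n => by
    have := lineIntegral_smul (Complex.exp (Real.pi * Complex.I * n ^ 2 * τ)) (fourierMode n) 0
    rw [lineIntegral_fourierMode] at this
    simp only [lineIntegral, add_zero, Pi.smul_apply, smul_eq_mul, ← hterm] at this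
    rw [this]
    split_ifs with h <;> simp [h]
  simp only [h2] at h
  simp only [lineIntegral, add_zero]
  exact h.unique (hasSum_ite_eq 0 1)

/-! ### The product formula -/

/-- The infinite product `∏ (1 + x^{2n+1} w)`. -/
noncomputable def oddProduct (x w : ℂ) : ℂ := ∏' n : ℕ, (1 + x ^ (2 * n + 1) * w)

theorem summable_oddProduct {x : ℂ} (hx : ‖x‖ < 1) (w : ℂ) :
    Summable fun n : ℕ => ‖x ^ (2 * n + 1) * w‖ := by
  have h : Summable fun n : ℕ => ‖x‖ * ‖w‖ * (‖x‖ ^ 2) ^ n :=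
    (summable_geometric_of_lt_one (by positivity) (by nlinarith [norm_nonneg x])).mul_left _
  refine h.congr fun n => ?_
  rw [norm_mul, norm_pow, ← pow_mul]; ring

theorem oddProduct_eq_mul {x : ℂ} (hx : ‖x‖ < 1) (w : ℂ) :
    oddProduct x w = (1 + x * w) * oddProduct x (x ^ 2 * w) := by
  have h : ∀ n : ℕ, x ^ (2 * (n + 1) + 1) * w = x ^ (2 * n + 1) * (x ^ 2 * w) := fun n => by ring
  rw [oddProduct, tprod_eq_zero_mul', oddProduct]
  · simp only [h, mul_zero, zero_add, pow_one]
  · simp only [h]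
    exact multipliable_one_add_of_summable (summable_oddProduct hx _)

theorem oddProduct_eq_zero_iff {x : ℂ} (hx : ‖x‖ < 1) (w : ℂ) :
    oddProduct x w = 0 ↔ ∃ n : ℕ, 1 + x ^ (2 * n + 1) * w = 0 := by
  refine ⟨fun h => ?_, fun h => tprod_of_exists_eq_zero h⟩
  by_contra! hn
  exact tprod_one_add_ne_zero_of_summable hn (summable_oddProduct hx w) h

theorem differentiable_oddProduct {x : ℂ} (hx : ‖x‖ < 1) : Differentiable ℂ (oddProduct x) := by
  intro w
  set R := ‖w‖ + 1 with hR
  have h := Summable.hasProdLocallyUniformlyOn_nat_one_add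
    (f := fun (n : ℕ) (w : ℂ) => x ^ (2 * n + 1) * w) (u := fun n => ‖x ^ (2 * n + 1) * (R : ℂ)‖)
    (K := Metric.ball 0 R) Metric.isOpen_ball (summable_oddProduct hx _)
    (Eventually.of_forall fun n v hv => by
      have h1 : ‖v‖ < R := by simpa using hv
      rw [norm_mul, norm_mul, Complex.norm_real, Real.norm_of_nonneg (by positivity)]
      gcongr)
    (fun n => by fun_prop)
  rw [hasProdLocallyUniformlyOn_iff_tendstoLocallyUniformlyOn] at h
  have hd := h.differentiableOn (Eventually.of_forall fun s => by fun_prop) Metric.isOpen_ball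
  exact hd.differentiableAt (Metric.isOpen_ball.mem_nhds (by simp [hR]))

/-- The product side of the triple product identity. -/
noncomputable def thetaProduct (τ z : ℂ) : ℂ :=
  oddProduct (Complex.exp (Real.pi * Complex.I * τ)) (fourierMode 1 z) *
    oddProduct (Complex.exp (Real.pi * Complex.I * τ)) (fourierMode (-1) z)

theorem norm_nome_lt_one {τ : ℂ} (hτ : 0 < τ.im) :
    ‖Complex.exp (Real.pi * Complex.I * τ)‖ < 1 := by
  rw [Complex.norm_exp, Real.exp_lt_one_iff]
  simp
  positivity

/-- With w = e^{2πiz}, the shift by τ multiplies w by x². The first product loses the factor 1 + xw,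
the second gains 1 + x⁻¹w⁻¹, and their ratio x⁻¹w⁻¹ is the quasi-period. -/
theorem isThetaFunction_thetaProduct {τ : ℂ} (hτ : 0 < τ.im) :
    IsThetaFunction τ (thetaProduct τ) := by
  have hx := norm_nome_lt_one hτ
  refine ⟨?_, fun z => by simp only [thetaProduct, fourierMode_add_one], fun z => ?_⟩
  · exact ((differentiable_oddProduct hx).comp (differentiable_fourierMode 1)).mul
      ((differentiable_oddProduct hx).comp (differentiable_fourierMode (-1)))
  · set x := Complex.exp (Real.pi * Complex.I * τ) with hxdef
    have hx0 : x ≠ 0 := Complex.exp_ne_zero _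
    have e1 : fourierMode 1 τ = x ^ 2 := by
      rw [fourierMode, hxdef, ← Complex.exp_nat_mul]; congr 1; push_cast; ring
    have e2 : x ^ 2 * fourierMode (-1) τ = 1 := by
      rw [← e1, fourierMode_mul]; exact fourierMode_zero τ
    have e3 : fourierMode 1 z * fourierMode (-1) z = 1 := by
      rw [fourierMode_mul]; exact fourierMode_zero z
    have e4 : Complex.exp (-Real.pi * Complex.I * (τ + 2 * z)) = x⁻¹ * fourierMode (-1) z := by
      rw [hxdef, ← Complex.exp_neg, fourierMode, ← Complex.exp_add]; congr 1; push_cast; ring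
    rw [e4, thetaProduct, thetaProduct, ← hxdef, fourierMode_add, fourierMode_add,
      oddProduct_eq_mul hx (fourierMode 1 z), oddProduct_eq_mul hx (_ * fourierMode (-1) τ), e1,
      mul_comm _ (x ^ 2), show x ^ 2 * (fourierMode (-1) z * fourierMode (-1) τ) =
        fourierMode (-1) z * (x ^ 2 * fourierMode (-1) τ) by ring, e2, mul_one]
    have e5 : x * (fourierMode (-1) z * fourierMode (-1) τ) = x⁻¹ * fourierMode (-1) z := by
      rw [eq_inv_mul_iff_mul_eq₀ hx0]
      linear_combination fourierMode (-1) z * e2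
    rw [e5]
    have e6 : x⁻¹ * x = 1 := inv_mul_cancel₀ hx0
    linear_combination (-oddProduct x (x ^ 2 * fourierMode 1 z) * oddProduct x (fourierMode (-1) z)) *
      (e3 + (fourierMode 1 z * fourierMode (-1) z) * e6 - e3) +
      (-oddProduct x (x ^ 2 * fourierMode 1 z) * oddProduct x (fourierMode (-1) z)) * e3

/-- The factors with w vanish at the points with a negative multiple of τ, those with w⁻¹ at the
points with a nonnegative one. -/
theorem thetaProduct_eq_zero_iff {τ : ℂ} (hτ : 0 < τ.im) (z : ℂ) :
    thetaProduct τ z = 0 ↔ ∃ m n : ℤ, z = 1 / 2 + τ / 2 + m + n * τ := by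
  have hx := norm_nome_lt_one hτ
  have key : ∀ (n : ℕ) (k : ℤ), (1 + Complex.exp (Real.pi * Complex.I * τ) ^ (2 * n + 1) *
      fourierMode k z = 0 ↔ ∃ m : ℤ, k * z = 1 / 2 + τ / 2 + m - (n + 1) * τ) := fun n k => by
    rw [← Complex.exp_nat_mul, fourierMode, ← Complex.exp_add, add_comm, ← sub_neg_eq_add,
      sub_eq_zero, ← Complex.exp_pi_mul_I, Complex.exp_eq_exp_iff_exists_int]
    refine exists_congr fun m => ⟨fun h => ?_, fun h => ?_⟩
    · refine mul_left_cancel₀ Complex.two_pi_I_ne_zero ?_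
      push_cast at h ⊢
      linear_combination h
    · push_cast at h ⊢
      linear_combination (2 * Real.pi * Complex.I) * h
  rw [thetaProduct, mul_eq_zero, oddProduct_eq_zero_iff hx, oddProduct_eq_zero_iff hx]
  simp only [key]
  constructor
  · rintro (⟨n, m, h⟩ | ⟨n, m, h⟩)
    · refine ⟨m, -(n + 1), ?_⟩
      push_cast at h ⊢
      linear_combination h
    · refine ⟨-1 - m, n, ?_⟩
      push_cast at h ⊢
      linear_combination -h
  · rintro ⟨m, n, h⟩
    rcases lt_or_ge n 0 with hn | hn
    · obtain ⟨k, rfl⟩ : ∃ k : ℕ, n = -(k + 1) := ⟨(-n - 1).toNat, by omega⟩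
      refine Or.inl ⟨k, m, ?_⟩
      push_cast at h ⊢
      linear_combination h
    · obtain ⟨k, rfl⟩ : ∃ k : ℕ, n = k := ⟨n.toNat, by omega⟩
      refine Or.inr ⟨k, -1 - m, ?_⟩
      push_cast at h ⊢
      linear_combination -h

/-- Proportionality of theta functions. The product has nonzero mean, since otherwise it would
vanish identically, and 0 is not among its zeros. The value of the constant plays no role. -/
theorem exists_jacobiTheta₂_eq {τ : ℂ} (hτ : 0 < τ.im) :
    ∃ c ≠ 0, ∀ z, jacobiTheta₂ z τ = c * thetaProduct τ z := by
  have hP := isThetaFunction_thetaProduct hτ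
  have hP0 : lineIntegral (thetaProduct τ) 0 ≠ 0 := fun h => by
    have h0 := hP.eq_zero h 0
    obtain ⟨m, n, h0⟩ := (thetaProduct_eq_zero_iff hτ 0).1 h0
    have h1 := congrArg Complex.im h0
    simp at h1
    have h2 : τ.im * (2 * n + 1) = 0 := by linarith
    rcases mul_eq_zero.1 h2 with h3 | h3
    · exact hτ.ne' h3
    · have : (2 * n + 1 : ℤ) = 0 := by exact_mod_cast h3
      omega
  refine ⟨(lineIntegral (thetaProduct τ) 0)⁻¹, inv_ne_zero hP0, fun z => ?_⟩
  have h := (isThetaFunction_jacobiTheta₂ hτ).lineIntegral_smul_eq hP z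
  rw [lineIntegral_jacobiTheta₂ hτ, one_mul] at h
  rw [← h, inv_mul_cancel_left₀ hP0]

theorem jacobiTheta₂_eq_zero_iff {τ : ℂ} (hτ : 0 < τ.im) (z : ℂ) :
    jacobiTheta₂ z τ = 0 ↔ ∃ m n : ℤ, z = 1 / 2 + τ / 2 + m + n * τ := by
  obtain ⟨c, hc, h⟩ := exists_jacobiTheta₂_eq hτ
  rw [h, mul_eq_zero, or_iff_right hc, thetaProduct_eq_zero_iff hτ]

namespace EllipticTheta

variable {τ : ℂ}

/-! ### The odd theta function -/

theorem theta1_eq_zero_iff (hτ : 0 < τ.im) (u : ℂ) :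
    theta1 τ u = 0 ↔ ∃ m n : ℤ, u = m + n * τ := by
  rw [theta1, mul_eq_zero, or_iff_right (Complex.exp_ne_zero _), jacobiTheta₂_eq_zero_iff hτ]
  refine exists_congr fun m => exists_congr fun n => ⟨fun h => ?_, fun h => ?_⟩
  · linear_combination h
  · linear_combination h

theorem theta1_add_one (u : ℂ) : theta1 τ (u + 1) = -theta1 τ u := by
  rw [theta1, theta1, show u + 1 + 1 / 2 + τ / 2 = u + 1 / 2 + τ / 2 + 1 by ring,
    jacobiTheta₂_add_left, ← neg_mul, ← neg_one_mul, ← Complex.exp_pi_mul_I, ← Complex.exp_add]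
  congr 2; ring

theorem theta1_add_tau (u : ℂ) :
    theta1 τ (u + τ) = -Complex.exp (-Real.pi * Complex.I * (τ + 2 * u)) * theta1 τ u := by
  rw [theta1, theta1, show u + τ + 1 / 2 + τ / 2 = u + 1 / 2 + τ / 2 + τ by ring,
    jacobiTheta₂_add_left', ← neg_one_mul (Complex.exp _), ← Complex.exp_neg_pi_mul_I,
    ← Complex.exp_add, ← mul_assoc, ← mul_assoc, ← Complex.exp_add, ← Complex.exp_add]
  congr 2; ring

theorem theta1_neg (u : ℂ) : theta1 τ (-u) = -theta1 τ u := by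
  have h1 : jacobiTheta₂ (u + 1 / 2 + τ / 2) τ =
      Complex.exp (-Real.pi * Complex.I * (2 * u - 1)) * jacobiTheta₂ (-u + 1 / 2 + τ / 2) τ := by
    rw [show u + 1 / 2 + τ / 2 = -(-u + 1 / 2 + τ / 2) + τ + 1 by ring, jacobiTheta₂_add_left,
      jacobiTheta₂_add_left', jacobiTheta₂_neg_left]
    congr 2; ring
  rw [theta1, theta1, h1, ← neg_one_mul (Complex.exp _ * _), ← Complex.exp_neg_pi_mul_I, ← mul_assoc,
    ← mul_assoc, ← Complex.exp_add, ← Complex.exp_add]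
  congr 2; ring

/-- At u = 0 only one factor of the product vanishes, namely 1 − e^{−2πiu}. It has a simple zero,
and the remaining product is nonzero at 0 because |x| < 1. -/
theorem deriv_theta1_ne_zero (hτ : 0 < τ.im) : deriv (theta1 τ) 0 ≠ 0 := by
  obtain ⟨c, hc, h⟩ := exists_jacobiTheta₂_eq hτ
  have hx := norm_nome_lt_one hτ
  set x := Complex.exp (Real.pi * Complex.I * τ) with hxdef
  have hx0 : x ≠ 0 := Complex.exp_ne_zero _
  let R : ℂ → ℂ := fun u => Complex.exp (Real.pi * Complex.I * τ / 4 +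
    Real.pi * Complex.I * (u + 1 / 2)) * (c * (oddProduct x (-x * fourierMode 1 u) *
      oddProduct x (-x * fourierMode (-1) u)))
  have hR : ∀ u, theta1 τ u = (1 - fourierMode (-1) u) * R u := by
    intro u
    have e1 : fourierMode 1 (u + 1 / 2 + τ / 2) = -x * fourierMode 1 u := by
      rw [← neg_one_mul x, ← Complex.exp_pi_mul_I, hxdef, fourierMode, fourierMode,
        ← Complex.exp_add, ← Complex.exp_add]
      congr 1; push_cast; ring
    have e2 : fourierMode (-1) (u + 1 / 2 + τ / 2) = -x⁻¹ * fourierMode (-1) u := by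
      rw [← neg_one_mul x⁻¹, ← Complex.exp_neg_pi_mul_I, hxdef, ← Complex.exp_neg, fourierMode,
        fourierMode, ← Complex.exp_add, ← Complex.exp_add]
      congr 1; push_cast; ring
    have e3 : x * (-x⁻¹ * fourierMode (-1) u) = -fourierMode (-1) u := by field_simp
    have e4 : x ^ 2 * (-x⁻¹ * fourierMode (-1) u) = -x * fourierMode (-1) u := by field_simp
    rw [theta1, h, thetaProduct, ← hxdef, e1, e2, oddProduct_eq_mul hx (-x⁻¹ * _), e3, e4]
    simp only [R]
    ring
  have hne : oddProduct x (-x) ≠ 0 := by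
    rw [Ne, oddProduct_eq_zero_iff hx]
    rintro ⟨n, hn⟩
    have h1 : x ^ (2 * n + 2) = 1 := by linear_combination -hn
    have h2 := congrArg norm h1
    rw [norm_pow, norm_one] at h2
    exact (pow_lt_one₀ (norm_nonneg x) hx (by omega)).ne h2
  have hRd : DifferentiableAt ℂ R 0 := by
    have h3 : ∀ k, DifferentiableAt ℂ (fun u => oddProduct x (-x * fourierMode k u)) 0 := fun k =>
      ((differentiable_oddProduct hx).comp
        ((differentiable_const (-x)).mul (differentiable_fourierMode k))) 0
    have h4 : DifferentiableAt ℂ (fun u : ℂ => Complex.exp (Real.pi * Complex.I * τ / 4 +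
      Real.pi * Complex.I * (u + 1 / 2))) 0 := by fun_prop
    exact h4.mul (((h3 1).mul (h3 (-1))).const_mul c)
  have hm : HasDerivAt (fourierMode (-1)) (-(2 * Real.pi * Complex.I)) 0 := by
    have := ((hasDerivAt_id (0 : ℂ)).const_mul (2 * Real.pi * Complex.I * ((-1 : ℤ) : ℂ))).cexp
    rw [show (2 * Real.pi * Complex.I * ((-1 : ℤ) : ℂ)) * id (0 : ℂ) = 0 by simp, Complex.exp_zero]
      at this
    exact this.congr_deriv (by push_cast; ring)
  have hd : HasDerivAt (theta1 τ) (-(-(2 * Real.pi * Complex.I)) * R 0 +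
      (1 - fourierMode (-1) 0) * deriv R 0) 0 := by
    rw [show theta1 τ = fun u => (1 - fourierMode (-1) u) * R u from funext hR]
    exact (hm.const_sub 1).mul hRd.hasDerivAt
  rw [hd.deriv]
  have hf0 : ∀ k, fourierMode k 0 = 1 := fun k => by simp [fourierMode]
  simp only [hf0, sub_self, zero_mul, add_zero, neg_neg, R, mul_one]
  exact mul_ne_zero Complex.two_pi_I_ne_zero (mul_ne_zero (Complex.exp_ne_zero _)
    (mul_ne_zero hc (mul_ne_zero hne hne)))

theorem theta_eq_zero_iff (hτ : 0 < τ.im) (u : ℂ) : theta τ u = 0 ↔ ∃ m n : ℤ, u = m + n * τ := by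
  rw [theta, div_eq_zero_iff, or_iff_left (deriv_theta1_ne_zero hτ), theta1_eq_zero_iff hτ]

theorem theta_add_one (u : ℂ) : theta τ (u + 1) = -theta τ u := by
  rw [theta, theta1_add_one, neg_div]; rfl

theorem theta_add_tau (u : ℂ) :
    theta τ (u + τ) = -Complex.exp (-Real.pi * Complex.I * (τ + 2 * u)) * theta τ u := by
  rw [theta, theta1_add_tau, mul_div_assoc]; rfl

theorem theta_neg (u : ℂ) : theta τ (-u) = -theta τ u := by
  rw [theta, theta1_neg, neg_div]; rfl

theorem theta_zero : theta τ 0 = 0 := by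
  have := theta_neg (τ := τ) 0
  rw [neg_zero] at this
  linear_combination this / 2

theorem analyticAt_theta (u : ℂ) : AnalyticAt ℂ (theta τ) u := (differentiable_theta τ).analyticAt u

theorem deriv_theta_zero (hτ : 0 < τ.im) : deriv (theta τ) 0 = 1 := by
  have : theta τ = fun u => theta1 τ u / deriv (theta1 τ) 0 := rfl
  rw [this, deriv_div_const, div_self (deriv_theta1_ne_zero hτ)]

theorem deriv_theta_add_one (u : ℂ) : deriv (theta τ) (u + 1) = -deriv (theta τ) u := by
  rw [← deriv_comp_add_const, funext (theta_add_one (τ := τ)), deriv.fun_neg]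

theorem deriv_theta_neg (u : ℂ) : deriv (theta τ) (-u) = deriv (theta τ) u := by
  have h := deriv_comp_neg (theta τ) u
  rw [funext (theta_neg (τ := τ)), deriv.fun_neg] at h
  exact (neg_injective h).symm

theorem deriv_theta_add_tau (u : ℂ) : deriv (theta τ) (u + τ) =
    -Complex.exp (-Real.pi * Complex.I * (τ + 2 * u)) *
      (deriv (theta τ) u - 2 * Real.pi * Complex.I * theta τ u) := by
  rw [← deriv_comp_add_const, funext (theta_add_tau (τ := τ))]
  have h1 : HasDerivAt (fun u : ℂ => -Complex.exp (-Real.pi * Complex.I * (τ + 2 * u)))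
      (-(Complex.exp (-Real.pi * Complex.I * (τ + 2 * u)) *
        (-Real.pi * Complex.I * (2 * 1)))) u :=
    (((((hasDerivAt_id u).const_mul 2).const_add τ).const_mul (-Real.pi * Complex.I)).cexp).neg
  refine (h1.mul (differentiable_theta τ u).hasDerivAt).deriv.trans ?_
  ring

/-! ### The functions `φ` and `ζ` -/

theorem phi_add_tau (lam u : ℂ) :
    phi τ lam (u + τ) = fourierMode (-1) lam * phi τ lam u := by
  have h : Complex.exp (-Real.pi * Complex.I * (τ + 2 * (u + lam))) =
      Complex.exp (-Real.pi * Complex.I * (τ + 2 * u)) * fourierMode (-1) lam := by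
    rw [fourierMode, ← Complex.exp_add]; congr 1; push_cast; ring
  have h0 := Complex.exp_ne_zero (-Real.pi * Complex.I * (τ + 2 * u))
  rw [phi, phi, add_right_comm, theta_add_tau, theta_add_tau, h]
  set E := Complex.exp (-Real.pi * Complex.I * (τ + 2 * u))
  rw [show -(E * fourierMode (-1) lam) * theta τ (u + lam) =
    -E * (fourierMode (-1) lam * theta τ (u + lam)) by ring, mul_assoc (-E),
    mul_div_mul_left _ _ (neg_ne_zero.2 h0), mul_div_assoc]

theorem zeta_add_tau {u : ℂ} (hu : theta τ u ≠ 0) :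
    zeta τ (u + τ) = zeta τ u - 2 * Real.pi * Complex.I := by
  have h0 := Complex.exp_ne_zero (-Real.pi * Complex.I * (τ + 2 * u))
  rw [zeta, zeta, deriv_theta_add_tau, theta_add_tau, mul_div_mul_left _ _ (neg_ne_zero.2 h0),
    sub_div, mul_div_cancel_right₀ _ hu]

theorem zeta_neg (u : ℂ) : zeta τ (-u) = -zeta τ u := by
  rw [zeta, zeta, deriv_theta_neg, theta_neg, div_neg]

theorem theta_ne_zero_of_strip (hτ : 0 < τ.im) {u : ℂ} (h : |u.im| ≤ τ.im / 2)
    (h' : ∀ n : ℤ, u ≠ n) : theta τ u ≠ 0 := by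
  rw [Ne, theta_eq_zero_iff hτ]
  rintro ⟨m, n, rfl⟩
  have h1 : |(n : ℝ)| * τ.im ≤ τ.im / 2 := by
    simpa [abs_mul, abs_of_pos hτ] using h
  have h2 : |(n : ℝ)| < 1 := by nlinarith
  have h3 : n = 0 := by
    rw [← Int.cast_abs] at h2
    exact Int.abs_lt_one_iff.1 (by exact_mod_cast h2)
  subst h3
  exact h' m (by simp)

theorem theta_ne_zero_of_im (hτ : 0 < τ.im) {u : ℂ} (h : |u.im| = τ.im / 2) : theta τ u ≠ 0 :=
  theta_ne_zero_of_strip hτ h.le fun n hn => by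
    rw [hn] at h
    simp only [Complex.intCast_im, abs_zero] at h
    linarith

theorem isStripFunction_div_theta (hτ : 0 < τ.im) {N : ℂ → ℂ} (hN : ∀ u, AnalyticAt ℂ N u)
    (hN' : ∀ u, N (u + 1) = -N u) : IsStripFunction (τ.im / 2) fun u => N u / theta τ u :=
  ⟨fun u => by rw [hN', theta_add_one, neg_div_neg_eq],
    (hN 0).meromorphicAt.div (meromorphicAt_theta τ 0),
    fun u h h' => (hN u).div (analyticAt_theta u) (theta_ne_zero_of_strip hτ h h')⟩

theorem phi_eq (lam : ℂ) : phi τ lam = fun u => (theta τ (u + lam) / theta τ lam) / theta τ u := by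
  funext u
  rw [phi, div_div, mul_comm]

theorem analyticAt_theta_add (lam u : ℂ) : AnalyticAt ℂ (fun u => theta τ (u + lam)) u :=
  ((differentiable_theta τ).comp (differentiable_id.add_const lam)).analyticAt u

theorem isStripFunction_phi (hτ : 0 < τ.im) (lam : ℂ) :
    IsStripFunction (τ.im / 2) (phi τ lam) := by
  rw [phi_eq]
  exact isStripFunction_div_theta hτ (fun u => (analyticAt_theta_add lam u).div_const)
    fun u => by rw [add_right_comm, theta_add_one, neg_div]

theorem isStripFunction_zeta (hτ : 0 < τ.im) : IsStripFunction (τ.im / 2) (zeta τ) :=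
  isStripFunction_div_theta hτ (fun u => (analyticAt_theta u).deriv) deriv_theta_add_one

theorem residueFun_div_theta (hτ : 0 < τ.im) {N : ℂ → ℂ} (hN : AnalyticAt ℂ N 0) :
    LocalField.residueFun (fun u => N u / theta τ u) = N 0 := by
  have hm : ∀ {N : ℂ → ℂ}, AnalyticAt ℂ N 0 → MeromorphicAt (fun u => N u / theta τ u) 0 :=
    fun hN => hN.meromorphicAt.div (meromorphicAt_theta τ 0)
  have h0 : deriv (theta τ) 0 ≠ 0 := by rw [deriv_theta_zero hτ]; exact one_ne_zero
  have hc : AnalyticAt ℂ (fun _ : ℂ => (1 : ℂ)) 0 := analyticAt_const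
  have h1 := LocalField.div_sub_coordInv_mem (f := theta τ) hc (analyticAt_theta 0) theta_zero
    (deriv_theta_zero hτ) one_ne_zero (hm hc)
  have hd : AnalyticAt ℂ (fun u => N u - N 0) 0 := hN.sub analyticAt_const
  have h2 := LocalField.div_mem_hol hd (analyticAt_theta (τ := τ) 0) theta_zero h0 (sub_self _)
    (hm hd)
  have e : (fun u => N u / theta τ u) =
      (fun u => (N u - N 0) / theta τ u) + N 0 • fun u => 1 / theta τ u := by
    funext u
    simp only [Pi.add_apply, Pi.smul_apply, smul_eq_mul]; ring
  have h3 := LocalField.integral_hol h1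
  have h4 := LocalField.integral_hol h2
  rw [map_sub, LocalField.integral_coordInv, LocalField.integral_mk, sub_eq_zero] at h3
  rw [LocalField.integral_mk] at h4
  rw [e, LocalField.residueFun_add (hm hd) ((hm hc).const_smul _),
    LocalField.residueFun_smul _ (hm hc), h3, h4, zero_add, mul_one]

/-- The residue theorem for the cylinder. -/
theorem lineIntegral_sub_eq_residue (hτ : 0 < τ.im) {F : ℂ → ℂ}
    (hF : IsStripFunction (τ.im / 2) F) : lineIntegral F (-(τ / 2)) - lineIntegral F (τ / 2) =
      2 * Real.pi * Complex.I * LocalField.residueFun F := by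
  rw [← hF.lineIntegral_sub_eq_residue (half_pos hτ), lineIntegral_eq_im hF.periodic (-(τ / 2)),
    lineIntegral_eq_im hF.periodic (τ / 2)]
  congr 4 <;> simp

/-- The residue theorem for elliptic functions. -/
theorem residueFun_eq_zero_of_elliptic (hτ : 0 < τ.im) {F : ℂ → ℂ}
    (hF : IsStripFunction (τ.im / 2) F) (h : ∀ u, theta τ u ≠ 0 → F (u + τ) = F u) :
    LocalField.residueFun F = 0 := by
  have h1 := lineIntegral_sub_eq_residue hτ hF
  have h2 : lineIntegral F (-(τ / 2)) = lineIntegral F (τ / 2) := by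
    refine intervalIntegral.integral_congr fun x _ => ?_
    rw [← h _ (theta_ne_zero_of_im hτ (by simp [abs_of_pos hτ, abs_div]))]
    congr 1; ring
  rw [h2, sub_self] at h1
  exact (mul_eq_zero.1 h1.symm).resolve_left Complex.two_pi_I_ne_zero

end EllipticTheta

namespace CylFunctions

/-! ### Fourier modes -/

theorem norm_fourierMode (n : ℤ) (u : ℂ) :
    ‖fourierMode n u‖ = Real.exp (-(2 * Real.pi * n * u.im)) := by
  rw [fourierMode, Complex.norm_exp]
  congr 1
  simp

/-- The function `e^{2πinu}`. -/
noncomputable def mode (n : ℤ) : CylFunctions :=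
  ⟨fourierMode n, differentiable_fourierMode n, fourierMode_add_one n, 1, one_pos,
    -- The summand 1 keeps the exponent positive for n = 0.
    2 * Real.pi * |(n : ℝ)| + 1, by positivity, fun u => by
      rw [norm_fourierMode, one_mul]
      refine Real.exp_le_exp.2 ?_
      have h1 : -((n : ℝ) * u.im) ≤ |(n : ℝ)| * |u.im| := by
        rw [← abs_mul]; exact neg_le_abs _
      nlinarith [Real.pi_pos, abs_nonneg u.im]⟩

theorem mode_mul (m n : ℤ) : mode m * mode n = mode (m + n) :=
  Subtype.ext <| funext fun u => fourierMode_mul m n u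

theorem mode_zero : mode 0 = 1 := Subtype.ext <| funext fun u => fourierMode_zero u

theorem D_mode (n : ℤ) : testAlgebra.D (mode n) = (2 * Real.pi * Complex.I * n) • mode n := by
  refine Subtype.ext <| funext fun u => ?_
  have h : HasDerivAt (fourierMode n) (fourierMode n u * (2 * Real.pi * Complex.I * n * 1)) u :=
    ((hasDerivAt_id u).const_mul (2 * Real.pi * Complex.I * n)).cexp
  refine h.deriv.trans ?_
  change _ = (2 * Real.pi * Complex.I * n) * fourierMode n u
  ring

theorem integral_eq_lineIntegral (s : CylFunctions) :
    testAlgebra.integral s = (2 * Real.pi * Complex.I)⁻¹ * lineIntegral s.1 0 := by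
  simp only [lineIntegral, add_zero]; rfl

theorem integral_mode (n : ℤ) :
    testAlgebra.integral (mode n) = if n = 0 then (2 * Real.pi * Complex.I)⁻¹ else 0 := by
  rw [integral_eq_lineIntegral]
  change _ * lineIntegral (fourierMode n) 0 = _
  rw [lineIntegral_fourierMode]
  split_ifs <;> simp

theorem pairing_mode (m n : ℤ) : testAlgebra.pairing (mode m) (mode n) =
    if m + n = 0 then (2 * Real.pi * Complex.I)⁻¹ else 0 := by
  rw [testAlgebra.pairing_apply, mode_mul, integral_mode]

/-- The Fourier coefficients. -/
noncomputable def coeff (n : ℤ) : CylFunctions →ₗ[ℂ] ℂ :=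
  (2 * Real.pi * Complex.I) • testAlgebra.pairing (mode (-n))

theorem coeff_eq_lineIntegral (n : ℤ) (s : CylFunctions) :
    coeff n s = lineIntegral (fun u => s.1 u * fourierMode (-n) u) 0 := by
  rw [coeff, LinearMap.smul_apply, testAlgebra.pairing_apply, integral_eq_lineIntegral, smul_eq_mul,
    mul_inv_cancel_left₀ Complex.two_pi_I_ne_zero]
  exact lineIntegral_congr fun x => mul_comm _ _

theorem coeff_mode (m n : ℤ) : coeff m (mode n) = if n = m then 1 else 0 := by
  rw [coeff, LinearMap.smul_apply, pairing_mode, smul_eq_mul, mul_ite, mul_zero,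
    mul_inv_cancel₀ Complex.two_pi_I_ne_zero]
  congr 1
  rw [neg_add_eq_zero, eq_comm (a := m)]

theorem eq_zero_of_coeff {s : CylFunctions} (h : ∀ n, coeff n s = 0) : s = 0 :=
  Subtype.ext <| funext fun u => eq_zero_of_lineIntegral_eq_zero s.2.1 s.2.2.1
    (fun n => by rw [← coeff_eq_lineIntegral, h]) u

/-- Move the contour to height −sign(n)r: the mode decays like e^{−2π|n|r} while s grows at most
like e^{pr}. Let r tend to infinity. -/
theorem coeff_eq_zero {s : CylFunctions} {C p : ℝ}
    (hs : ∀ u, ‖s.1 u‖ ≤ C * Real.exp (p * |u.im|)) {n : ℤ} (hn : p < 2 * Real.pi * |(n : ℝ)|)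
    (hn0 : n ≠ 0) : coeff n s = 0 := by
  have hper : ∀ u, s.1 (u + 1) * fourierMode (-n) (u + 1) = s.1 u * fourierMode (-n) u := fun u => by
    rw [s.2.2.1, fourierMode_add_one]
  have hshift : ∀ y : ℝ, coeff n s =
      lineIntegral (fun u => s.1 u * fourierMode (-n) u) (y * Complex.I) := fun y => by
    have := lineIntegral_eq_lineIntegral (F := fun u => s.1 u * fourierMode (-n) u) (a := 0)
      (b := y) (fun y => by
        rw [← hper (-(1 / 2) + _)]
        ring_nf)
      (fun u _ _ => (s.2.1 u).mul (differentiable_fourierMode _ u))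
    rw [coeff_eq_lineIntegral, ← this]
    simp
  have hsign : (n : ℝ) * (n.sign : ℝ) = |(n : ℝ)| := by
    rcases lt_or_gt_of_ne hn0 with h | h
    · rw [Int.sign_eq_neg_one_of_neg h, abs_of_neg (by exact_mod_cast h)]; push_cast; ring
    · rw [Int.sign_eq_one_of_pos h, abs_of_pos (by exact_mod_cast h)]; push_cast; ring
  have hsign' : |(n.sign : ℝ)| = 1 := by
    rcases lt_or_gt_of_ne hn0 with h | h
    · rw [Int.sign_eq_neg_one_of_neg h]; simp
    · rw [Int.sign_eq_one_of_pos h]; simp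
  have hbound : ∀ r : ℝ, 0 ≤ r →
      ‖coeff n s‖ ≤ C * Real.exp (-((2 * Real.pi * |(n : ℝ)| - p) * r)) := by
    intro r hr
    rw [hshift (-(n.sign * r)), lineIntegral]
    refine (intervalIntegral.norm_integral_le_of_norm_le_const
      (C := C * Real.exp (-((2 * Real.pi * |(n : ℝ)| - p) * r))) fun x _ => ?_).trans ?_
    · rw [norm_mul, norm_fourierMode]
      have him : ((x : ℂ) + ((-(n.sign * r) : ℝ) : ℂ) * Complex.I).im = -(n.sign * r) := by simp
      refine (mul_le_mul_of_nonneg_right (hs _) (Real.exp_nonneg _)).trans ?_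
      rw [mul_assoc, ← Real.exp_add, him, abs_neg, abs_mul, hsign', abs_of_nonneg hr]
      refine le_of_eq ?_
      congr 2
      push_cast
      linear_combination (-2 * Real.pi * r) * hsign
    · norm_num
  have hlim : Tendsto (fun r : ℝ => C * Real.exp (-((2 * Real.pi * |(n : ℝ)| - p) * r))) atTop
      (𝓝 (C * 0)) := by
    refine (Real.tendsto_exp_neg_atTop_nhds_zero.comp ?_).const_mul C
    exact tendsto_id.const_mul_atTop (sub_pos.2 hn)
  rw [mul_zero] at hlim
  refine norm_le_zero_iff.1 (ge_of_tendsto hlim ?_)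
  filter_upwards [eventually_ge_atTop 0] with r hr
  exact hbound r hr

/-- The growth condition leaves finitely many modes: the test functions are trigonometric
polynomials, so identities may be checked on modes. -/
theorem finite_support_coeff (s : CylFunctions) : (Function.support fun n => coeff n s).Finite := by
  obtain ⟨C, -, p, hp, h⟩ := s.2.2.2
  refine (Set.finite_Icc (-(⌈p⌉ : ℤ)) ⌈p⌉).subset fun n hn => ?_
  by_contra hn'
  refine hn (coeff_eq_zero h ?_ ?_)
  · have h1 : (⌈p⌉ : ℤ) < |n| := by
      by_contra hle
      exact hn' (Set.mem_Icc.2 (abs_le.1 (not_lt.1 hle)))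
    have h2 : (⌈p⌉ : ℝ) < |(n : ℝ)| := by exact_mod_cast h1
    have h3 := Int.le_ceil p
    nlinarith [Real.pi_gt_three]
  · rintro rfl
    exact hn' (Set.mem_Icc.2 ⟨by simpa using (Int.ceil_nonneg hp.le), Int.ceil_nonneg hp.le⟩)

theorem finite_support_coeff_smul (w : ℤ → CylFunctions) (s : CylFunctions) :
    (Function.support fun n => coeff n s • w n).Finite :=
  (finite_support_coeff s).subset fun n hn h => hn (by
    change coeff n s • w n = 0
    rw [show coeff n s = 0 from h, zero_smul])

/-- The Fourier multiplier with coefficients `a`. -/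
noncomputable def multiplier (a : ℤ → ℂ) : CylFunctions →ₗ[ℂ] CylFunctions where
  toFun s := ∑ᶠ n, coeff n s • a n • mode n
  map_add' s t := by
    rw [← finsum_add_distrib (finite_support_coeff_smul _ s) (finite_support_coeff_smul _ t)]
    simp only [map_add, add_smul]
  map_smul' c s := by
    rw [RingHom.id_apply, smul_finsum' c (finite_support_coeff_smul _ s)]
    simp only [map_smul, smul_assoc]

theorem multiplier_mode (a : ℤ → ℂ) (n : ℤ) : multiplier a (mode n) = a n • mode n := by
  change ∑ᶠ m, coeff m (mode n) • a m • mode m = _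
  rw [finsum_eq_single _ n fun m hm => by rw [coeff_mode, if_neg hm.symm, zero_smul], coeff_mode,
    if_pos rfl, one_smul]

theorem mode_induction {p : CylFunctions → Prop} (mode : ∀ n, p (mode n))
    (add : ∀ s t, p s → p t → p (s + t)) (smul : ∀ (c : ℂ) s, p s → p (c • s))
    (s : CylFunctions) : p s := by
  have h0 : p 0 := by simpa using smul 0 _ (mode 0)
  set F := (finite_support_coeff s).toFinset with hF
  have h : s = ∑ n ∈ F, coeff n s • CylFunctions.mode n := by
    refine sub_eq_zero.1 (eq_zero_of_coeff fun m => ?_)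
    simp only [map_sub, map_sum, map_smul, coeff_mode, smul_eq_mul, mul_ite, mul_one, mul_zero,
      Finset.sum_ite_eq']
    rw [ite_eq_left_iff.2, sub_self]
    intro hm
    rw [hF, Set.Finite.mem_toFinset, Function.mem_support, not_not] at hm
    exact hm.symm
  rw [h]
  exact Finset.sum_induction _ p add h0 fun n _ => smul _ _ (mode n)

/-! ### Multipliers and kernels -/

theorem multiplier_D (a : ℤ → ℂ) (s : CylFunctions) :
    multiplier a (testAlgebra.D s) = testAlgebra.D (multiplier a s) := by
  induction s using mode_induction with
  | mode n =>
    rw [D_mode, map_smul, multiplier_mode, Derivation.map_smul, D_mode, smul_comm]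
  | add s t hs ht => simp only [map_add, hs, ht]
  | smul c s hs => rw [Derivation.map_smul, map_smul, hs, map_smul, Derivation.map_smul]

/-- The pairing couples the mode n to the mode −n only, so the adjoint of a multiplier has its
coefficients reflected. -/
theorem multiplier_symm {a b : ℤ → ℂ} (h : ∀ n, a n + b (-n) = 1) (s t : CylFunctions) :
    testAlgebra.pairing (multiplier a s) t + testAlgebra.pairing s (multiplier b t) =
      testAlgebra.pairing s t := by
  induction s using mode_induction with
  | mode m =>
    induction t using mode_induction with
    | mode n =>
      simp only [multiplier_mode, map_smul, LinearMap.smul_apply, smul_eq_mul, pairing_mode]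
      split_ifs with hmn
      · obtain rfl : n = -m := by omega
        linear_combination (2 * Real.pi * Complex.I)⁻¹ * h m
      · ring
    | add s t hs ht =>
      simp only [map_add]
      linear_combination hs + ht
    | smul c s hs =>
      simp only [map_smul, smul_eq_mul]
      linear_combination c * hs
  | add s t hs ht =>
    simp only [map_add, LinearMap.add_apply]
    linear_combination hs + ht
  | smul c s hs =>
    simp only [map_smul, smul_eq_mul, LinearMap.smul_apply]
    linear_combination c * hs

theorem hasDerivAt_multiplier {a : ℂ → ℤ → ℂ} {a' : ℤ → ℂ} {x : ℂ}
    (h : ∀ n, HasDerivAt (fun y => a y n) (a' n) x) (s t : CylFunctions) :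
    HasDerivAt (fun y => testAlgebra.pairing (multiplier (a y) s) t)
      (testAlgebra.pairing (multiplier a' s) t) x := by
  induction s using mode_induction with
  | mode n =>
    simp only [multiplier_mode, map_smul, LinearMap.smul_apply, smul_eq_mul]
    exact (h n).mul_const _
  | add s t hs ht =>
    simp only [map_add, LinearMap.add_apply]
    exact hs.add ht
  | smul c s hs =>
    simp only [map_smul, LinearMap.smul_apply, smul_eq_mul]
    exact hs.const_mul c

/-- The Fourier coefficients of a kernel. -/
noncomputable def kernelCoeff (k : ℂ → ℂ) (b : ℂ) (n : ℤ) : ℂ :=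
  (2 * Real.pi * Complex.I)⁻¹ * lineIntegral (k * fourierMode n) b

/-- A kernel in u − v is a convolution, which the modes diagonalize since e^{2πin(z+w)} factors. -/
theorem kernelDist_eq {k : ℂ → ℂ} {b : ℂ} (hk : Continuous fun x : ℝ => k (x + b))
    (s t : CylFunctions) :
    kernelDist k b s t = testAlgebra.pairing (multiplier (kernelCoeff k b) s) t := by
  have h : ∀ z : ℂ, (2 * Real.pi * Complex.I)⁻¹ * ∫ x in (-(1 / 2) : ℝ)..(1 / 2),
      k (x + b) * s.1 (z + (x + b)) = (multiplier (kernelCoeff k b) s).1 z := by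
    intro z
    have hc : ∀ s : CylFunctions, IntervalIntegrable
        (fun x : ℝ => k (x + b) * s.1 (z + (x + b))) MeasureTheory.volume (-(1 / 2)) (1 / 2) :=
      fun s => (hk.mul (s.2.1.continuous.comp (by fun_prop))).intervalIntegrable _ _
    induction s using mode_induction with
    | mode n =>
      rw [multiplier_mode]
      change _ = kernelCoeff k b n * fourierMode n z
      rw [kernelCoeff, mul_assoc (_⁻¹), mul_comm (lineIntegral _ _), lineIntegral,
        ← intervalIntegral.integral_const_mul (fourierMode n z)]
      refine congrArg _ (intervalIntegral.integral_congr fun x _ => ?_)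
      change _ * fourierMode n (z + (x + b)) = fourierMode n z * (k (x + b) * fourierMode n (x + b))
      rw [fourierMode_add]
      ring
    | add s t hs ht =>
      rw [map_add]
      change _ = (multiplier (kernelCoeff k b) s).1 z + (multiplier (kernelCoeff k b) t).1 z
      rw [← hs, ← ht, ← mul_add, ← intervalIntegral.integral_add (hc s) (hc t)]
      congr 1
      refine intervalIntegral.integral_congr fun x _ => ?_
      exact mul_add _ _ _
    | smul c s hs =>
      rw [map_smul]
      change _ = c * (multiplier (kernelCoeff k b) s).1 z
      rw [← hs, mul_left_comm, ← smul_eq_mul c, ← intervalIntegral.integral_smul]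
      congr 1
      refine intervalIntegral.integral_congr fun x _ => ?_
      exact mul_left_comm _ _ _
  rw [testAlgebra.pairing_comm]
  change _ = (2 * Real.pi * Complex.I)⁻¹ * ∫ x in (-(1 / 2) : ℝ)..(1 / 2),
    t.1 x * (multiplier (kernelCoeff k b) s).1 x
  simp only [← h]
  rfl

end CylFunctions

/-! ### Fourier coefficients of the Green kernels. -/

namespace CylFunctions

open EllipticTheta

variable {τ μ : ℂ}

theorem lineIntegral_fourierMode_eq (n : ℤ) (b : ℂ) :
    lineIntegral (fourierMode n) b = if n = 0 then 1 else 0 := by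
  have h : lineIntegral (fourierMode n) b = fourierMode n b * lineIntegral (fourierMode n) 0 := by
    rw [lineIntegral, lineIntegral, ← intervalIntegral.integral_const_mul]
    refine intervalIntegral.integral_congr fun x _ => ?_
    change fourierMode n (x + b) = fourierMode n b * fourierMode n (x + 0)
    rw [add_zero, fourierMode_add, mul_comm]
  rw [h, lineIntegral_fourierMode]
  split_ifs with hn
  · rw [hn, fourierMode_zero, mul_one]
  · rw [mul_zero]

theorem isStripFunction_fourierMode (β : ℝ) (n : ℤ) : IsStripFunction β (fourierMode n) :=
  ⟨fourierMode_add_one n, ((differentiable_fourierMode n).analyticAt 0).meromorphicAt,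
    fun u _ _ => (differentiable_fourierMode n).analyticAt u⟩

/-- The residue of `N / θ` as a difference of Fourier coefficients. -/
theorem kernelCoeff_sub (hτ : 0 < τ.im) {k N : ℂ → ℂ} (hk : IsStripFunction (τ.im / 2) k)
    (hN : AnalyticAt ℂ N 0) (h : ∀ u, k u = N u / theta τ u) (n : ℤ) :
    kernelCoeff k (-(τ / 2)) n - kernelCoeff k (τ / 2) n = N 0 := by
  have h1 := lineIntegral_sub_eq_residue hτ (hk.mul (isStripFunction_fourierMode _ n))
  have h2 := residueFun_div_theta hτ (hN.mul ((differentiable_fourierMode n).analyticAt 0))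
  have h3 : k * fourierMode n = fun u => (N * fourierMode n) u / theta τ u := funext fun u => by
    rw [Pi.mul_apply, Pi.mul_apply, h]; ring
  have h4 : fourierMode n 0 = 1 := by simp [fourierMode]
  rw [← h3, Pi.mul_apply, h4, mul_one] at h2
  rw [kernelCoeff, kernelCoeff, ← mul_sub, h1, h2, inv_mul_cancel_left₀ Complex.two_pi_I_ne_zero]

/-- Brings the upper contour down by τ, so that a quasi-period of k relates the coefficients on the
two contours. -/
theorem kernelCoeff_half (k : ℂ → ℂ) (n : ℤ) : kernelCoeff k (τ / 2) n =
    (2 * Real.pi * Complex.I)⁻¹ * (fourierMode n τ *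
      lineIntegral (fun u => k (u + τ) * fourierMode n u) (-(τ / 2))) := by
  rw [kernelCoeff, lineIntegral, lineIntegral,
    ← intervalIntegral.integral_const_mul (fourierMode n τ)]
  refine congrArg _ (intervalIntegral.integral_congr fun x _ => ?_)
  have e : (x : ℂ) + τ / 2 = x + -(τ / 2) + τ := by ring
  simp only [Pi.mul_apply, e, fourierMode_add]
  ring

/-- The number `e^{-2πiμ} q^n`. -/
noncomputable def twist (τ μ : ℂ) (n : ℤ) : ℂ := fourierMode (-1) μ * fourierMode n τ

theorem twist_mul_twist (τ μ ν : ℂ) (m n : ℤ) :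
    twist τ μ m * twist τ ν n = twist τ (μ + ν) (m + n) := by
  rw [twist, twist, twist, fourierMode_add, ← fourierMode_mul]; ring

theorem twist_zero_left (τ : ℂ) (n : ℤ) : twist τ 0 n = fourierMode n τ := by
  simp [twist, fourierMode]

theorem one_sub_fourierMode_ne_zero (hτ : 0 < τ.im) {n : ℤ} (hn : n ≠ 0) :
    1 - fourierMode n τ ≠ 0 := by
  intro h
  have h1 := congrArg norm (sub_eq_zero.1 h)
  rw [norm_one, norm_fourierMode, eq_comm, Real.exp_eq_one_iff, neg_eq_zero] at h1
  have hn' : (n : ℝ) ≠ 0 := Int.cast_ne_zero.2 hn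
  exact mul_ne_zero (mul_ne_zero Real.two_pi_pos.ne' hn') hτ.ne' h1

/-- The Fourier coefficients of `φ_μ`. -/
noncomputable def phiCoeff (τ μ : ℂ) (n : ℤ) : ℂ := (1 - twist τ μ n)⁻¹

/-- The derivatives of the Fourier coefficients of `φ_μ` with respect to `μ`. -/
noncomputable def dphiCoeff (τ μ : ℂ) (n : ℤ) : ℂ :=
  -(2 * Real.pi * Complex.I) * twist τ μ n * ((1 - twist τ μ n) ^ 2)⁻¹

/-- The Fourier coefficients of `ζ`. -/
noncomputable def zetaCoeff (τ : ℂ) (n : ℤ) : ℂ :=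
  if n = 0 then 1 / 2 else (1 - fourierMode n τ)⁻¹

theorem continuous_phi_line (hτ : 0 < τ.im) (μ : ℂ) {b : ℂ} (hb : |b.im| = τ.im / 2) :
    Continuous fun x : ℝ => phi τ μ (x + b) :=
  (isStripFunction_phi hτ μ).continuous_line (fun h => by rw [h, abs_zero] at hb; linarith) hb.le

theorem kernelCoeff_phi_half (n : ℤ) : kernelCoeff (phi τ μ) (τ / 2) n =
    twist τ μ n * kernelCoeff (phi τ μ) (-(τ / 2)) n := by
  have h : (fun u => phi τ μ (u + τ) * fourierMode n u) =
      fourierMode (-1) μ • (phi τ μ * fourierMode n) := funext fun u => by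
    rw [phi_add_tau, mul_assoc]; rfl
  rw [kernelCoeff_half, h, lineIntegral_smul, kernelCoeff, twist]
  ring

theorem kernelCoeff_phi_sub (hτ : 0 < τ.im) (hμ : theta τ μ ≠ 0) (n : ℤ) :
    kernelCoeff (phi τ μ) (-(τ / 2)) n - kernelCoeff (phi τ μ) (τ / 2) n = 1 := by
  rw [kernelCoeff_sub hτ (isStripFunction_phi hτ μ)
    (N := fun u => theta τ (u + μ) / theta τ μ) (analyticAt_theta_add μ 0).div_const
    (fun u => by rw [phi_eq]), zero_add, div_self hμ]

/-- The quasi-period and the residue give (1 − twist)·coefficient = 1, which already excludes the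
value 1 of the twist. The same equation yields the coefficients of φ_μ. -/
theorem one_sub_twist_ne_zero (hτ : 0 < τ.im) (hμ : theta τ μ ≠ 0) (n : ℤ) :
    1 - twist τ μ n ≠ 0 := fun h => by
  have h1 := kernelCoeff_phi_sub hτ hμ n
  rw [kernelCoeff_phi_half, ← one_sub_mul, h, zero_mul] at h1
  exact zero_ne_one h1

theorem kernelCoeff_phi_neg (hτ : 0 < τ.im) (hμ : theta τ μ ≠ 0) :
    kernelCoeff (phi τ μ) (-(τ / 2)) = phiCoeff τ μ := funext fun n => by
  have h1 := kernelCoeff_phi_sub hτ hμ n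
  rw [kernelCoeff_phi_half, ← one_sub_mul] at h1
  exact eq_inv_of_mul_eq_one_right h1

theorem kernelCoeff_phi_pos (hτ : 0 < τ.im) (hμ : theta τ μ ≠ 0) :
    kernelCoeff (phi τ μ) (τ / 2) = fun n => phiCoeff τ μ n - 1 := funext fun n => by
  rw [← kernelCoeff_phi_neg hτ hμ, ← kernelCoeff_phi_sub hτ hμ n, sub_sub_cancel]

/-- For n ≠ 0 the additive quasi-period −2πi integrates to zero against the mode, and the argument
for φ_μ applies. For n = 0 the two contours are exchanged by u ↦ −u; ζ is odd, so each takes half of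
the residue, up to sign. -/
theorem kernelCoeff_zeta (hτ : 0 < τ.im) :
    kernelCoeff (zeta τ) (-(τ / 2)) = zetaCoeff τ := funext fun n => by
  have h1 := kernelCoeff_sub hτ (isStripFunction_zeta hτ) (analyticAt_theta 0).deriv
    (fun u => rfl) n
  rw [deriv_theta_zero hτ] at h1
  rw [zetaCoeff]
  have hpi := Complex.two_pi_I_ne_zero
  split_ifs with hn
  · subst hn
    have h2 : kernelCoeff (zeta τ) (τ / 2) 0 = -kernelCoeff (zeta τ) (-(τ / 2)) 0 := by
      rw [kernelCoeff, kernelCoeff, ← mul_neg]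
      congr 1
      have h3 := intervalIntegral.integral_comp_neg (a := -(1 / 2)) (b := 1 / 2)
        (fun x : ℝ => (zeta τ * fourierMode 0) (x + -(τ / 2)))
      rw [neg_neg] at h3
      rw [lineIntegral, lineIntegral, ← h3, ← intervalIntegral.integral_neg]
      refine intervalIntegral.integral_congr fun x _ => ?_
      have : ((-x : ℝ) : ℂ) + -(τ / 2) = -(x + τ / 2) := by push_cast; ring
      simp only [this, Pi.mul_apply, zeta_neg, fourierMode_zero]
      ring
    rw [h2] at h1
    linear_combination h1 / 2
  · have hc : ∀ x : ℝ, theta τ (x + -(τ / 2)) ≠ 0 := fun x =>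
      theta_ne_zero_of_im hτ (by simp [abs_of_pos hτ, abs_div])
    have hb : (-(τ / 2)).im ≠ 0 := by simp; exact hτ.ne'
    have hb' : |(-(τ / 2)).im| ≤ τ.im / 2 := by simp [abs_of_pos hτ, abs_div]
    have h2 : lineIntegral (fun u => zeta τ (u + τ) * fourierMode n u) (-(τ / 2)) =
        lineIntegral (zeta τ * fourierMode n) (-(τ / 2)) := by
      have h3 : lineIntegral (fun u => zeta τ (u + τ) * fourierMode n u) (-(τ / 2)) =
          lineIntegral (zeta τ * fourierMode n + (-(2 * Real.pi * Complex.I)) • fourierMode n)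
            (-(τ / 2)) := lineIntegral_congr fun x => by
        simp only [Pi.add_apply, Pi.mul_apply, Pi.smul_apply, smul_eq_mul]
        rw [zeta_add_tau (hc x)]; ring
      have hs := isStripFunction_fourierMode (τ.im / 2) n
      rw [h3, lineIntegral_add (((isStripFunction_zeta hτ).mul hs).continuous_line hb hb')
        ((hs.const_smul _).continuous_line hb hb'), lineIntegral_smul, lineIntegral_fourierMode_eq,
        if_neg hn, mul_zero, add_zero]
    rw [kernelCoeff_half, h2, mul_left_comm, ← kernelCoeff, ← one_sub_mul] at h1
    exact eq_inv_of_mul_eq_one_right h1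

/-! ### The Green distributions as Fourier multipliers -/

theorem green_diag (hτ : 0 < τ.im) (s t : CylFunctions) :
    (green τ).diag s t = testAlgebra.pairing (multiplier (zetaCoeff τ) s) t := by
  rw [← kernelCoeff_zeta hτ]
  exact kernelDist_eq ((isStripFunction_zeta hτ).continuous_line (by simp; exact hτ.ne')
    (by simp [abs_of_pos hτ, abs_div])) s t

theorem green_plus (hτ : 0 < τ.im) (hμ : theta τ μ ≠ 0) (s t : CylFunctions) :
    (green τ).plus μ s t = testAlgebra.pairing (multiplier (phiCoeff τ μ) s) t := by
  rw [← kernelCoeff_phi_neg hτ hμ]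
  exact kernelDist_eq (continuous_phi_line hτ μ (by simp [abs_of_pos hτ, abs_div])) s t

theorem multiplier_sub_one (a : ℤ → ℂ) (s : CylFunctions) :
    multiplier (fun n => a n - 1) s = multiplier a s - s := by
  induction s using mode_induction with
  | mode n => rw [multiplier_mode, multiplier_mode, sub_smul, one_smul]
  | add s t hs ht => rw [map_add, map_add, hs, ht]; abel
  | smul c s hs => rw [map_smul, map_smul, hs, smul_sub]

theorem green_minus (hτ : 0 < τ.im) (hμ : theta τ μ ≠ 0) (s t : CylFunctions) :
    (green τ).minus μ s t = testAlgebra.pairing (multiplier (phiCoeff τ μ) s) t -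
      testAlgebra.pairing s t := by
  rw [← LinearMap.sub_apply, ← map_sub, ← multiplier_sub_one, ← kernelCoeff_phi_pos hτ hμ]
  exact kernelDist_eq (continuous_phi_line hτ μ (by simp [abs_of_pos hτ, abs_div])) s t

theorem hasDerivAt_fourierMode (n : ℤ) (u : ℂ) :
    HasDerivAt (fourierMode n) (2 * Real.pi * Complex.I * n * fourierMode n u) u :=
  (((hasDerivAt_id u).const_mul (2 * Real.pi * Complex.I * n)).cexp).congr_deriv (by
    rw [mul_one, mul_comm]; rfl)

theorem hasDerivAt_phiCoeff (hτ : 0 < τ.im) (hμ : theta τ μ ≠ 0) (n : ℤ) :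
    HasDerivAt (fun ν => phiCoeff τ ν n) (dphiCoeff τ μ n) μ := by
  have h := (((hasDerivAt_fourierMode (-1) μ).mul_const (fourierMode n τ)).const_sub 1).inv
    (one_sub_twist_ne_zero hτ hμ n)
  refine h.congr_deriv ?_
  rw [dphiCoeff, div_eq_mul_inv, twist]
  push_cast
  ring

/-- The twist is a function of nτ − μ, so ∂_τ is −n ∂_μ. -/
theorem hasDerivAt_phiCoeff_modulus (hτ : 0 < τ.im) (hμ : theta τ μ ≠ 0) (n : ℤ) :
    HasDerivAt (fun y => phiCoeff y μ n) (-n * dphiCoeff τ μ n) τ := by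
  have h := (((hasDerivAt_fourierMode n τ).const_mul (fourierMode (-1) μ)).const_sub 1).inv
    (one_sub_twist_ne_zero hτ hμ n)
  refine h.congr_deriv ?_
  rw [dphiCoeff, div_eq_mul_inv, twist]
  ring

/-- The derivatives of the Fourier coefficients of `ζ` with respect to `τ`. -/
noncomputable def zetaCoeffModulus (τ : ℂ) (n : ℤ) : ℂ :=
  2 * Real.pi * Complex.I * n * fourierMode n τ * ((1 - fourierMode n τ) ^ 2)⁻¹

theorem hasDerivAt_zetaCoeff (hτ : 0 < τ.im) (n : ℤ) :
    HasDerivAt (fun y => zetaCoeff y n) (zetaCoeffModulus τ n) τ := by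
  rcases eq_or_ne n 0 with rfl | hn
  · simpa [zetaCoeff, zetaCoeffModulus] using hasDerivAt_const τ (1 / 2 : ℂ)
  · have h := ((hasDerivAt_fourierMode n τ).const_sub 1).inv (one_sub_fourierMode_ne_zero hτ hn)
    simp only [zetaCoeff, if_neg hn]
    refine h.congr_deriv ?_
    rw [zetaCoeffModulus, div_eq_mul_inv, neg_neg]

/-- Only `theta1` need be continuous in τ: the normalizing derivative is nonzero for every τ in the
upper half-plane. -/
theorem eventually_theta_ne_zero (hτ : 0 < τ.im) (hμ : theta τ μ ≠ 0) :
    ∀ᶠ x in 𝓝 τ, 0 < x.im ∧ theta x μ ≠ 0 := by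
  have h1 : ∀ᶠ x in 𝓝 τ, 0 < x.im := Complex.continuous_im.continuousAt.eventually (lt_mem_nhds hτ)
  have h2 : theta1 τ μ ≠ 0 := fun h => hμ (by rw [theta, h, zero_div])
  have h3 : ContinuousAt (fun x => theta1 x μ) τ := by
    refine ContinuousAt.mul (by fun_prop) ?_
    exact ContinuousAt.comp (g := fun p : ℂ × ℂ => jacobiTheta₂ p.1 p.2)
      (f := fun x : ℂ => (μ + 1 / 2 + x / 2, x)) (continuousAt_jacobiTheta₂ _ hτ) (by fun_prop)
  filter_upwards [h1, h3.eventually_ne h2] with x hx hx2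
  exact ⟨hx, div_ne_zero hx2 (deriv_theta1_ne_zero hx)⟩

theorem hasDerivAt_green_diag (hτ : 0 < τ.im) (s t : CylFunctions) :
    HasDerivAt (fun x => (green x).diag s t)
      (testAlgebra.pairing (multiplier (zetaCoeffModulus τ) s) t) τ := by
  refine (hasDerivAt_multiplier (hasDerivAt_zetaCoeff hτ) s t).congr_of_eventuallyEq ?_
  filter_upwards [Complex.continuous_im.continuousAt.eventually (lt_mem_nhds hτ)] with x hx
  exact green_diag hx s t

theorem hasDerivAt_green_plus (hτ : 0 < τ.im) (hμ : theta τ μ ≠ 0) (s t : CylFunctions) :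
    HasDerivAt (fun x => (green x).plus μ s t)
      (testAlgebra.pairing (multiplier (fun n => -n * dphiCoeff τ μ n) s) t) τ := by
  refine (hasDerivAt_multiplier (hasDerivAt_phiCoeff_modulus hτ hμ) s t).congr_of_eventuallyEq ?_
  filter_upwards [eventually_theta_ne_zero hτ hμ] with x hx
  exact green_plus hx.1 hx.2 s t

/-! ### The identities between Fourier coefficients -/

theorem zetaCoeff_add (hτ : 0 < τ.im) (n : ℤ) : zetaCoeff τ n + zetaCoeff τ (-n) = 1 := by
  rcases eq_or_ne n 0 with rfl | hn
  · norm_num [zetaCoeff]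
  · have h1 := one_sub_fourierMode_ne_zero hτ hn
    have h2 := one_sub_fourierMode_ne_zero hτ (neg_ne_zero.2 hn)
    have h3 : fourierMode n τ * fourierMode (-n) τ = 1 := by
      rw [fourierMode_mul, add_neg_cancel, fourierMode_zero]
    rw [zetaCoeff, zetaCoeff, if_neg hn, if_neg (neg_ne_zero.2 hn)]
    field_simp
    linear_combination -h3

theorem twist_mul_neg (τ μ : ℂ) (n : ℤ) : twist τ μ n * twist τ (-μ) (-n) = 1 := by
  rw [twist_mul_twist, add_neg_cancel, add_neg_cancel, twist_zero_left, fourierMode_zero]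

theorem theta_neg_ne_zero (hμ : theta τ μ ≠ 0) : theta τ (-μ) ≠ 0 := by
  rw [theta_neg]; exact neg_ne_zero.2 hμ

theorem phiCoeff_add (hτ : 0 < τ.im) (hμ : theta τ μ ≠ 0) (n : ℤ) :
    phiCoeff τ μ n + phiCoeff τ (-μ) (-n) = 1 := by
  have h1 := one_sub_twist_ne_zero hτ hμ n
  have h2 := one_sub_twist_ne_zero hτ (theta_neg_ne_zero hμ) (-n)
  rw [phiCoeff, phiCoeff]
  field_simp
  linear_combination -twist_mul_neg τ μ n

/-- With X the twist at (μ, n), the twist at (−μ, −n) is 1/X, and 1/((1−X)(1−1/X)) = −X/(1−X)². The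
factor 2πin from the derivation of the mode then makes the cocycle a derivative in τ. -/
theorem phiCoeff_mul_neg (hτ : 0 < τ.im) (hμ : theta τ μ ≠ 0) (n : ℤ) :
    2 * Real.pi * Complex.I * (phiCoeff τ μ n * phiCoeff τ (-μ) (-n)) = dphiCoeff τ μ n := by
  have h1 := one_sub_twist_ne_zero hτ hμ n
  have h2 := one_sub_twist_ne_zero hτ (theta_neg_ne_zero hμ) (-n)
  rw [phiCoeff, phiCoeff, dphiCoeff]
  field_simp
  linear_combination -twist_mul_neg τ μ n

theorem zetaCoeff_mul_neg (hτ : 0 < τ.im) (n : ℤ) :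
    2 * Real.pi * Complex.I * n * (zetaCoeff τ n * zetaCoeff τ (-n)) = -zetaCoeffModulus τ n := by
  rcases eq_or_ne n 0 with rfl | hn
  · simp [zetaCoeffModulus]
  · have h1 := one_sub_fourierMode_ne_zero hτ hn
    have h2 := one_sub_fourierMode_ne_zero hτ (neg_ne_zero.2 hn)
    have h3 : fourierMode n τ * fourierMode (-n) τ = 1 := by
      rw [fourierMode_mul, add_neg_cancel, fourierMode_zero]
    rw [zetaCoeff, zetaCoeff, if_neg hn, if_neg (neg_ne_zero.2 hn), zetaCoeffModulus]
    field_simp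
    linear_combination -h3

/-- For m ≠ 0 this is a rational identity in q^m and the twist. For m = 0 the terms with ζ cancel,
whatever its zeroth coefficient, and φ(1 − φ) remains. -/
theorem zetaCoeff_mul_phiCoeff (hτ : 0 < τ.im) (hμ : theta τ μ ≠ 0) (m n : ℤ) :
    zetaCoeff τ m * phiCoeff τ μ n - phiCoeff τ μ (m + n) * zetaCoeff τ m +
      phiCoeff τ μ (m + n) * (1 - phiCoeff τ μ n) =
        if m = 0 then (2 * Real.pi * Complex.I)⁻¹ * dphiCoeff τ μ n else 0 := by
  have hn := one_sub_twist_ne_zero hτ hμ n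
  have hpi := Complex.two_pi_I_ne_zero
  split_ifs with hm
  · subst hm
    rw [zero_add, dphiCoeff, phiCoeff]
    field_simp
    ring
  · have hmn := one_sub_twist_ne_zero hτ hμ (m + n)
    have hm' := one_sub_fourierMode_ne_zero hτ hm
    have e : twist τ μ (m + n) = fourierMode m τ * twist τ μ n := by
      rw [twist, twist, ← fourierMode_mul]; ring
    rw [zetaCoeff, if_neg hm, phiCoeff, phiCoeff]
    rw [e] at hmn ⊢
    field_simp
    ring

/-- For m + n = 0 the zeroth coefficient of ζ is multiplied by 1 − φ_m − φ_{−m} = 0, the second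
coefficient being that of −μ. Otherwise it is a rational identity in the two twists, whose product
is q^{m+n}. -/
theorem phiCoeff_mul_phiCoeff (hτ : 0 < τ.im) (hμ : theta τ μ ≠ 0) (m n : ℤ) :
    phiCoeff τ μ m * phiCoeff τ (-μ) n - zetaCoeff τ (m + n) * phiCoeff τ μ m +
      zetaCoeff τ (m + n) * (1 - phiCoeff τ (-μ) n) =
        if m + n = 0 then (2 * Real.pi * Complex.I)⁻¹ * dphiCoeff τ μ m else 0 := by
  have hpi := Complex.two_pi_I_ne_zero
  split_ifs with h
  · obtain rfl : n = -m := by omega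
    rw [← phiCoeff_mul_neg hτ hμ, inv_mul_cancel_left₀ hpi]
    linear_combination -zetaCoeff τ (m + -m) * phiCoeff_add hτ hμ m
  · have hm := one_sub_twist_ne_zero hτ hμ m
    have hn := one_sub_twist_ne_zero hτ (theta_neg_ne_zero hμ) n
    have hmn := one_sub_fourierMode_ne_zero hτ h
    have e : twist τ μ m * twist τ (-μ) n = fourierMode (m + n) τ := by
      rw [twist_mul_twist, add_neg_cancel, twist_zero_left]
    rw [zetaCoeff, if_neg h, phiCoeff, phiCoeff]
    rw [← e] at hmn ⊢
    field_simp
    ring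

/-- The derivatives of the Green distributions with respect to `-τ`. -/
noncomputable def centralSystem (τ : ℂ) : GreenSystem CylFunctions where
  diag := -paramDeriv (fun x => (green x).diag) τ
  plus μ := -paramDeriv (fun x => (green x).plus μ) τ
  -- The r-matrix contains only the components `diag` and `plus`, so this value never enters.
  minus _ := 0

/-- Only the modes n and −n pair, and differentiation of the first contributes 2πin. -/
theorem central_eq {a b c : ℤ → ℂ} (h : ∀ n, 2 * Real.pi * Complex.I * n * (a n * b (-n)) = -c n)
    (s t : CylFunctions) : testAlgebra.pairing (testAlgebra.D (multiplier a s)) (multiplier b t) =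
      -testAlgebra.pairing (multiplier c s) t := by
  induction s using mode_induction with
  | mode m =>
    induction t using mode_induction with
    | mode n =>
      simp only [multiplier_mode, Derivation.map_smul, D_mode, map_smul, LinearMap.smul_apply,
        smul_eq_mul, pairing_mode]
      split_ifs with hmn
      · obtain rfl : n = -m := by omega
        linear_combination (2 * Real.pi * Complex.I)⁻¹ * h m
      · ring
    | add s t hs ht =>
      simp only [map_add]
      linear_combination hs + ht
    | smul c s hs =>
      simp only [map_smul, smul_eq_mul]
      linear_combination c * hs
  | add s t hs ht =>
    simp only [map_add, LinearMap.add_apply]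
    linear_combination hs + ht
  | smul c s hs =>
    simp only [map_smul, Derivation.map_smul, smul_eq_mul, LinearMap.smul_apply]
    linear_combination c * hs

theorem multiplier_mul_PQ (hτ : 0 < τ.im) (hμ : theta τ μ ≠ 0) (s t : CylFunctions) :
    multiplier (zetaCoeff τ) s * multiplier (phiCoeff τ μ) t -
      multiplier (phiCoeff τ μ) (multiplier (zetaCoeff τ) s * t) +
      multiplier (phiCoeff τ μ) (s * (t - multiplier (phiCoeff τ μ) t)) =
        testAlgebra.integral s • multiplier (dphiCoeff τ μ) t := by
  induction s using mode_induction with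
  | mode m =>
    induction t using mode_induction with
    | mode n =>
      have h := congrArg (· • mode (m + n)) (zetaCoeff_mul_phiCoeff hτ hμ m n)
      simp only [multiplier_mode, smul_mul_assoc, mul_smul_comm, mul_sub, mode_mul, map_smul, map_sub,
        integral_mode]
      split_ifs at h ⊢ with hm
      · subst hm
        rw [zero_add] at h ⊢
        simp only [smul_smul]
        rw [← h]
        module
      · rw [zero_smul] at h ⊢
        rw [← h]
        module
    | add s t hs ht =>
      simp only [map_add, mul_add, mul_sub, map_sub, smul_add] at hs ht ⊢
      rw [← hs, ← ht]
      abel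
    | smul c s hs =>
      simp only [map_smul, mul_smul_comm, mul_sub, map_sub] at hs ⊢
      rw [smul_comm, ← hs]
      module
  | add s t hs ht =>
    simp only [map_add, add_mul, add_smul]
    rw [← hs, ← ht]
    abel
  | smul c s hs =>
    simp only [map_smul, smul_mul_assoc, smul_assoc]
    rw [← hs]
    module

theorem multiplier_mul_QQ (hτ : 0 < τ.im) (hμ : theta τ μ ≠ 0) (s t : CylFunctions) :
    multiplier (phiCoeff τ μ) s * multiplier (phiCoeff τ (-μ)) t -
      multiplier (zetaCoeff τ) (multiplier (phiCoeff τ μ) s * t) +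
      multiplier (zetaCoeff τ) (s * (t - multiplier (phiCoeff τ (-μ)) t)) =
        testAlgebra.pairing (multiplier (dphiCoeff τ μ) s) t • (1 : CylFunctions) := by
  induction s using mode_induction with
  | mode m =>
    induction t using mode_induction with
    | mode n =>
      have h := congrArg (· • mode (m + n)) (phiCoeff_mul_phiCoeff hτ hμ m n)
      simp only [multiplier_mode, smul_mul_assoc, mul_smul_comm, mul_sub, mode_mul, map_smul, map_sub,
        LinearMap.smul_apply, pairing_mode, smul_eq_mul]
      split_ifs at h ⊢ with hmn
      · rw [hmn, mode_zero] at h ⊢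
        rw [mul_comm (dphiCoeff τ μ m), ← h]
        module
      · rw [mul_zero, zero_smul]
        rw [zero_smul] at h
        rw [← h]
        module
    | add s t hs ht =>
      simp only [map_add, mul_add, mul_sub, map_sub, add_smul] at hs ht ⊢
      rw [← hs, ← ht]
      abel
    | smul c s hs =>
      simp only [map_smul, mul_smul_comm, mul_sub, map_sub, smul_assoc] at hs ⊢
      rw [← hs]
      module
  | add s t hs ht =>
    simp only [map_add, add_mul, add_smul, LinearMap.add_apply]
    rw [← hs, ← ht]
    abel
  | smul c s hs =>
    simp only [map_smul, smul_mul_assoc, smul_assoc, LinearMap.smul_apply]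
    rw [← hs]
    module

/-- The splitting of the algebra of functions on the cylinder defined by the Green distributions. -/
noncomputable def splitting (hτ : 0 < τ.im) :
    testAlgebra.Splitting (green τ) (centralSystem τ) {μ | theta τ μ ≠ 0} where
  P := multiplier (zetaCoeff τ)
  Q μ := multiplier (phiCoeff τ μ)
  dQ μ := multiplier (dphiCoeff τ μ)
  isOpen := isOpen_ne_fun (differentiable_theta τ).continuous continuous_const
  neg_mem _ hμ := theta_neg_ne_zero hμ
  diag_eq s t := (green_diag hτ s t).symm
  plus_eq _ hμ s t := (green_plus hτ hμ s t).symm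
  minus_eq _ hμ s t := (green_minus hτ hμ s t).symm
  P_symm := multiplier_symm (zetaCoeff_add hτ)
  Q_symm _ hμ := multiplier_symm (phiCoeff_add hτ hμ)
  P_D := multiplier_D _
  Q_D _ _ := multiplier_D _
  hasDerivAt_plus μ hμ s t := by
    refine (hasDerivAt_multiplier (hasDerivAt_phiCoeff hτ hμ) s t).congr_of_eventuallyEq ?_
    filter_upwards [(differentiable_theta τ).continuous.continuousAt.eventually_ne hμ] with ν hν
    exact green_plus hτ hν s t
  mul_PQ _ hμ := multiplier_mul_PQ hτ hμ
  mul_QQ _ hμ := multiplier_mul_QQ hτ hμ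
  central_diag s t := by
    rw [central_eq (zetaCoeff_mul_neg hτ), ← (hasDerivAt_green_diag hτ s t).deriv]
    rfl
  central_plus μ hμ s t := by
    rw [central_eq (c := fun n => -n * dphiCoeff τ μ n) (fun n => by
      rw [← phiCoeff_mul_neg hτ hμ]; ring), ← (hasDerivAt_green_plus hτ hμ s t).deriv]
    rfl

theorem differentiableAt_rMatrix (hτ : 0 < τ.im) (hμ : theta τ μ ≠ 0) (p q : Fin 2 × Fin 2)
    (s t : CylFunctions) : DifferentiableAt ℂ (fun x => (green x).rMatrix μ p q s t) τ := by
  have h1 := (hasDerivAt_green_diag hτ s t).differentiableAt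
  have h2 := (hasDerivAt_green_plus hτ hμ s t).differentiableAt
  have h3 := (hasDerivAt_green_plus hτ (theta_neg_ne_zero hμ) s t).differentiableAt
  simp only [GreenSystem.rMatrix_eq, GreenSystem.sixVertex, Matrix.of_apply]
  split_ifs
  exacts [h1.const_mul (1 / 2), h1.const_mul (-(1 / 2)), h3, h2, differentiableAt_const _]

theorem rMatrix_centralSystem (τ lam : ℂ) :
    (centralSystem τ).rMatrix lam = -GreenSystem.rMatrixModulus green τ lam := by
  ext p q s t
  rw [Matrix.neg_apply, Pi.neg_apply, Pi.neg_apply]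
  simp only [GreenSystem.rMatrixModulus, paramDeriv, GreenSystem.rMatrix_eq, GreenSystem.sixVertex,
    Matrix.of_apply, centralSystem]
  split_ifs
  · simp [paramDeriv]
  · simp [paramDeriv]
  · rfl
  · rfl
  · simp

end CylFunctions

/-! ### The Green series of germs as projections. -/

namespace TestFunctionAlgebra

theorem pairing_mul_rotate {K : Type*} [CommRing K] [Algebra ℂ K] (T : TestFunctionAlgebra K)
    (a b c : K) : T.pairing (a * b) c = T.pairing (b * c) a := by
  rw [pairing_apply, pairing_apply]; congr 1; ring

namespace PolarData

variable {K : Type*} [CommRing K] [Algebra ℂ K] {T : TestFunctionAlgebra K} (V : T.PolarData)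

/-- A germ has finitely many polar coefficients, so the series of the Green distributions are finite
sums, which the lift computes. -/
theorem linearMap_lift_eq_tsum (g : K →ₗ[ℂ] ℂ) (k t : K) :
    g (V.lift k t) = ∑' n : ℕ, T.pairing (V.x ^ n) t * ((-1) ^ n * g (T.divDeriv n k)) := by
  have h : ∀ n, g ((-1 : ℂ) ^ n • T.divDeriv n k) = (-1) ^ n * g (T.divDeriv n k) := fun n => by
    rw [map_smul, smul_eq_mul]
  rw [lift, map_polarMap, polarMap_apply]
  have hf : Function.HasFiniteSupport fun n =>
      V.polarCoeff n t • g ((-1 : ℂ) ^ n • T.divDeriv n k) := V.finite_support_polarCoeff_smul _ t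
  refine (tsum_eq_finsum hf).symm.trans
    (tsum_congr fun n => ?_)
  rw [h]; rfl

theorem pairing_lift_eq_tsum (k s t : K) : T.pairing s (V.lift k t) =
    ∑' n : ℕ, T.pairing (T.divDeriv n k) s * T.pairing ((-V.x) ^ n) t := by
  rw [V.linearMap_lift_eq_tsum]
  refine tsum_congr fun n => ?_
  have h : T.pairing ((-V.x) ^ n) t = (-1) ^ n * T.pairing (V.x ^ n) t := by
    have : (-V.x) ^ n = (-1 : ℂ) ^ n • V.x ^ n := by
      rw [neg_pow, Algebra.smul_def]; simp
    rw [this, map_smul, LinearMap.smul_apply, smul_eq_mul]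
  rw [h, T.pairing_comm s]
  ring

theorem lift_pairing_eq_tsum (k s t : K) : T.pairing (V.lift k s) t =
    ∑' n : ℕ, T.pairing (V.x ^ n) s * T.pairing ((-1 : ℂ) ^ n • T.divDeriv n k) t := by
  rw [T.pairing_comm, V.linearMap_lift_eq_tsum]
  refine tsum_congr fun n => ?_
  rw [map_smul, LinearMap.smul_apply, smul_eq_mul, T.pairing_comm t]

end PolarData

end TestFunctionAlgebra

theorem deriv_iterate_add_eq_mul {f : ℂ → ℂ} {a c : ℂ} (h : ∀ u, f (u + a) = c * f u) (n : ℕ) (u : ℂ) :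
    deriv^[n] f (u + a) = c * deriv^[n] f u := by
  induction n generalizing u with
  | zero => exact h u
  | succ n ih =>
    rw [Function.iterate_succ_apply', ← deriv_comp_add_const, funext ih, deriv_const_mul_field]

/-! ### Residues of products of ζ, φ and their derivatives. -/

namespace EllipticTheta

variable {τ : ℂ}

theorem deriv_add_tau_of_add_const {f : ℂ → ℂ} {c : ℂ}
    (h : ∀ u, theta τ u ≠ 0 → f (u + τ) = f u + c) {u : ℂ} (hu : theta τ u ≠ 0) :
    deriv f (u + τ) = deriv f u := by
  rw [← deriv_comp_add_const]
  have h1 : (fun u => f (u + τ)) =ᶠ[𝓝 u] fun u => f u + c := by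
    filter_upwards [(differentiable_theta τ).continuous.continuousAt.eventually_ne hu] with v hv
    exact h v hv
  rw [h1.deriv_eq, deriv_add_const]

theorem deriv_iterate_zeta_add_tau (n : ℕ) {u : ℂ} (hu : theta τ u ≠ 0) :
    deriv^[n + 1] (zeta τ) (u + τ) = deriv^[n + 1] (zeta τ) u := by
  induction n generalizing u with
  | zero =>
    refine deriv_add_tau_of_add_const (c := -(2 * Real.pi * Complex.I)) (fun u hu => ?_) hu
    rw [zeta_add_tau hu]; ring
  | succ n ih =>
    rw [Function.iterate_succ_apply']
    exact deriv_add_tau_of_add_const (c := 0) (fun u hu => by rw [ih hu, add_zero]) hu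

/-- The function ζ² is not elliptic, but it is even, and u ↦ −u exchanges the two contours of the
residue theorem. -/
theorem residueFun_zeta_sq (hτ : 0 < τ.im) :
    LocalField.residueFun (zeta τ * zeta τ) = 0 := by
  have hs := (isStripFunction_zeta hτ).mul (isStripFunction_zeta hτ)
  have h1 := lineIntegral_sub_eq_residue hτ hs
  have h2 : lineIntegral (zeta τ * zeta τ) (-(τ / 2)) = lineIntegral (zeta τ * zeta τ) (τ / 2) := by
    have h3 := intervalIntegral.integral_comp_neg (a := -(1 / 2)) (b := 1 / 2)
      (fun x : ℝ => (zeta τ * zeta τ) (x + -(τ / 2)))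
    rw [neg_neg] at h3
    rw [lineIntegral, ← h3]
    refine intervalIntegral.integral_congr fun x _ => ?_
    have : ((-x : ℝ) : ℂ) + -(τ / 2) = -(x + τ / 2) := by push_cast; ring
    simp only [this, Pi.mul_apply, zeta_neg, neg_mul_neg]
  rw [h2, sub_self] at h1
  exact (mul_eq_zero.1 h1.symm).resolve_left Complex.two_pi_I_ne_zero

/-- The derivative of `φ_λ(u)` with respect to `λ`. -/
noncomputable def dphi (τ lam u : ℂ) : ℂ :=
  ((deriv (theta τ) (u + lam) * theta τ lam - theta τ (u + lam) * deriv (theta τ) lam) /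
    theta τ lam ^ 2) / theta τ u

theorem analyticAt_deriv_theta_add (lam u : ℂ) :
    AnalyticAt ℂ (fun u => deriv (theta τ) (u + lam)) u :=
  ((differentiable_theta τ).deriv.comp (differentiable_id.add_const lam)).analyticAt u

theorem analyticAt_dphi_num (lam u : ℂ) : AnalyticAt ℂ (fun u => (deriv (theta τ) (u + lam) *
    theta τ lam - theta τ (u + lam) * deriv (theta τ) lam) / theta τ lam ^ 2) u :=
  (((analyticAt_deriv_theta_add lam u).mul analyticAt_const).sub
    ((analyticAt_theta_add lam u).mul analyticAt_const)).div_const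

theorem meromorphicAt_dphi (τ lam : ℂ) : MeromorphicAt (dphi τ lam) 0 :=
  (analyticAt_dphi_num lam 0).meromorphicAt.div (meromorphicAt_theta τ 0)

theorem isStripFunction_dphi (hτ : 0 < τ.im) (lam : ℂ) :
    IsStripFunction (τ.im / 2) (dphi τ lam) :=
  isStripFunction_div_theta hτ (fun u => analyticAt_dphi_num lam u) fun u => by
    rw [add_right_comm, theta_add_one, deriv_theta_add_one]; ring

theorem dphi_add_tau {lam : ℂ} (hlam : theta τ lam ≠ 0) (u : ℂ) : dphi τ lam (u + τ) =
    fourierMode (-1) lam * (dphi τ lam u - 2 * Real.pi * Complex.I * phi τ lam u) := by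
  have h : Complex.exp (-Real.pi * Complex.I * (τ + 2 * (u + lam))) =
      Complex.exp (-Real.pi * Complex.I * (τ + 2 * u)) * fourierMode (-1) lam := by
    rw [fourierMode, ← Complex.exp_add]; congr 1; push_cast; ring
  have h0 := Complex.exp_ne_zero (-Real.pi * Complex.I * (τ + 2 * u))
  rw [dphi, dphi, phi, add_right_comm, theta_add_tau, deriv_theta_add_tau, theta_add_tau, h]
  set E := Complex.exp (-Real.pi * Complex.I * (τ + 2 * u))
  -- At lattice points both sides are zero, as quotients by zero.
  rcases eq_or_ne (theta τ u) 0 with hu | hu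
  · simp [hu]
  · field_simp
    ring

/-- The multipliers e^{−2πiλ} and e^{2πiλ} cancel, so the product is elliptic. -/
theorem residueFun_phi_mul (hτ : 0 < τ.im) {lam : ℂ} {F : ℂ → ℂ} (hF : IsStripFunction (τ.im / 2) F)
    (h : ∀ u, theta τ u ≠ 0 → F (u + τ) = fourierMode (-1) lam * F u) (n : ℕ) :
    LocalField.residueFun (F * deriv^[n] (phi τ (-lam))) = 0 := by
  refine residueFun_eq_zero_of_elliptic hτ (hF.mul ((isStripFunction_phi hτ _).iterate_deriv n))
    fun u hu => ?_
  have h1 : fourierMode (-1) lam * fourierMode (-1) (-lam) = 1 := by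
    rw [← fourierMode_add]; simp [fourierMode]
  rw [Pi.mul_apply, Pi.mul_apply, h u hu, deriv_iterate_add_eq_mul (phi_add_tau (-lam))]
  linear_combination (F u * deriv^[n] (phi τ (-lam)) u) * h1

end EllipticTheta

/-! ### The germs of ζ and φ satisfy the residue conditions. -/

namespace LocalField

open EllipticTheta

variable {τ : ℂ}

theorem integral_mul_coordInv {f : ℂ → ℂ} (hf : AnalyticAt ℂ f 0) :
    testAlgebra.integral (mk f hf.meromorphicAt * coordInv) = f 0 := by
  have hm : MeromorphicAt (fun u => (f u - f 0) / u) 0 :=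
    (hf.sub analyticAt_const).meromorphicAt.div (MeromorphicAt.id 0)
  have h : testAlgebra.integral (mk (fun u => (f u - f 0) / u) hm) = 0 := integral_hol
    (div_mem_hol (f := fun u => u) (hf.sub (analyticAt_const (v := f 0))) analyticAt_id rfl (by simp) (sub_self _) hm)
  have e : mk f hf.meromorphicAt * coordInv = mk _ hm + f 0 • coordInv := by
    rw [coordInv, mk_mul, mk_smul, mk_add, mk_eq_mk]
    refine Eventually.of_forall fun u => ?_
    simp only [Pi.mul_apply, Pi.add_apply, Pi.smul_apply, smul_eq_mul]; ring
  rw [e, map_add, h, map_smul, integral_coordInv, smul_eq_mul, mul_one, zero_add]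

/-- The germ at the origin of `u ↦ f(u + a)`. -/
noncomputable def translate (f : ℂ → ℂ) (hf : Differentiable ℂ f) (a : ℂ) : LocalField :=
  mk (fun u => f (u + a)) ((hf.comp (differentiable_id.add_const a)).analyticAt 0).meromorphicAt

theorem translate_mem_hol {f : ℂ → ℂ} (hf : Differentiable ℂ f) (a : ℂ) :
    translate f hf a ∈ hol :=
  mk_mem_hol ((hf.comp (differentiable_id.add_const a)).analyticAt 0)

theorem D_translate {f : ℂ → ℂ} (hf : Differentiable ℂ f) (a : ℂ) :
    testAlgebra.D (translate f hf a) = translate (deriv f) hf.deriv a := by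
  rw [translate, D_mk, translate, mk_eq_mk]
  exact Eventually.of_forall fun u => deriv_comp_add_const f a u

theorem pairing_translate_pow (n : ℕ) {f : ℂ → ℂ} (hf : Differentiable ℂ f) (a : ℂ) :
    testAlgebra.pairing (translate f hf a) (coordInv ^ (n + 1)) =
      (n.factorial : ℂ)⁻¹ * deriv^[n] f a := by
  have h1 : coordInv ^ (n + 1) = (-1 : ℂ) ^ n • testAlgebra.divDeriv n coordInv :=
    polarData.y_pow_eq n
  have h2 : ∀ (n : ℕ) {f : ℂ → ℂ} (hf : Differentiable ℂ f),
      testAlgebra.pairing ((⇑testAlgebra.D)^[n] (translate f hf a)) coordInv = deriv^[n] f a := by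
    intro n
    induction n with
    | zero =>
      intro f hf
      have := integral_mul_coordInv ((hf.comp (differentiable_id.add_const a)).analyticAt 0)
      refine this.trans ?_
      simp
    | succ n ih =>
      intro f hf
      rw [Function.iterate_succ_apply, D_translate, ih hf.deriv, Function.iterate_succ_apply]
  have h3 := testAlgebra.pairing_iterate_D n (translate f hf a) coordInv
  rw [h2] at h3
  rw [h1, TestFunctionAlgebra.divDeriv, map_smul, map_smul, smul_eq_mul, smul_eq_mul, h3]
  ring

/-- No differentiation under the contour integral is needed: holomorphic germs pair to zero, and a
negative power extracts a Taylor coefficient of f at a, which is differentiable in a. -/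
theorem hasDerivAt_pairing_translate {f : ℂ → ℂ} (hf : Differentiable ℂ f) (a : ℂ)
    (s : LocalField) : HasDerivAt (fun a => testAlgebra.pairing (translate f hf a) s)
      (testAlgebra.pairing (translate (deriv f) hf.deriv a) s) a := by
  induction s using polarData.polar_induction with
  | hol s hs =>
    have h : ∀ {f : ℂ → ℂ} (hf : Differentiable ℂ f) (a : ℂ),
        testAlgebra.pairing (translate f hf a) s = 0 := fun hf a =>
      polarData.pairing_hol (translate_mem_hol hf a) hs
    simp only [h]
    exact hasDerivAt_const a 0
  | pow n =>
    change HasDerivAt (fun a => testAlgebra.pairing (translate f hf a) (coordInv ^ (n + 1)))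
      (testAlgebra.pairing (translate (deriv f) hf.deriv a) (coordInv ^ (n + 1))) a
    simp only [pairing_translate_pow]
    rw [← Function.iterate_succ_apply deriv, Function.iterate_succ_apply']
    have hd : ∀ n, Differentiable ℂ (deriv^[n] f) := fun n => by
      induction n with
      | zero => exact hf
      | succ n ih => rw [Function.iterate_succ_apply']; exact ih.deriv
    exact (hd n a).hasDerivAt.const_mul _
  | add s t hs ht =>
    simp only [map_add]
    exact hs.add ht
  | smul c s hs =>
    simp only [map_smul]
    exact hs.const_mul c

/-- The germ of the derivative of `φ_λ(u)` with respect to `λ`. -/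
noncomputable def dphiGerm (τ lam : ℂ) : LocalField :=
  mk (dphi τ lam) (meromorphicAt_dphi τ lam)

/-- The parameter enters through the translate θ(u + ν) and the scalar θ(ν); the factor 1/θ(u) is
absorbed into the test germ. -/
theorem hasDerivAt_pairing_phiGerm {lam : ℂ} (hlam : theta τ lam ≠ 0) (s : LocalField) :
    HasDerivAt (fun ν => testAlgebra.pairing (phiGerm τ ν) s)
      (testAlgebra.pairing (dphiGerm τ lam) s) lam := by
  have hd := differentiable_theta τ
  set w : LocalField := mk (fun u => (theta τ u)⁻¹) (meromorphicAt_theta τ 0).inv with hw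
  have h1 : ∀ ν, testAlgebra.pairing (phiGerm τ ν) s =
      (theta τ ν)⁻¹ * testAlgebra.pairing (translate (theta τ) hd ν) (w * s) := fun ν => by
    have : phiGerm τ ν = (theta τ ν)⁻¹ • (translate (theta τ) hd ν * w) := by
      rw [phiGerm, translate, hw, mk_mul, mk_smul, mk_eq_mk]
      refine Eventually.of_forall fun u => ?_
      simp only [phi, Pi.smul_apply, Pi.mul_apply, smul_eq_mul]
      rw [div_eq_mul_inv, mul_inv]; ring
    rw [this, map_smul, LinearMap.smul_apply, smul_eq_mul, testAlgebra.pairing_apply,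
      testAlgebra.pairing_apply, mul_assoc]
  have h2 : dphiGerm τ lam = (theta τ lam)⁻¹ • (translate (deriv (theta τ)) hd.deriv lam * w) +
      (-deriv (theta τ) lam / theta τ lam ^ 2) • (translate (theta τ) hd lam * w) := by
    rw [dphiGerm, translate, translate, hw, mk_mul, mk_smul, mk_mul, mk_smul, mk_add, mk_eq_mk]
    refine Eventually.of_forall fun u => ?_
    simp only [dphi, Pi.add_apply, Pi.smul_apply, Pi.mul_apply, smul_eq_mul]
    rw [div_eq_mul_inv _ (theta τ u)]
    field_simp
    ring
  simp only [h1]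
  refine ((hd lam).hasDerivAt.inv hlam |>.mul (hasDerivAt_pairing_translate hd lam (w * s))
    ).congr_deriv ?_
  rw [h2, map_add, LinearMap.add_apply, map_smul, LinearMap.smul_apply, smul_eq_mul, map_smul,
    LinearMap.smul_apply, smul_eq_mul, testAlgebra.pairing_apply, testAlgebra.pairing_apply,
    testAlgebra.pairing_apply, testAlgebra.pairing_apply, mul_assoc, mul_assoc, Pi.inv_apply]
  ring

theorem pairing_mk {f g : ℂ → ℂ} (hf : MeromorphicAt f 0) (hg : MeromorphicAt g 0) :
    testAlgebra.pairing (mk f hf) (mk g hg) = residueFun (f * g) := by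
  rw [testAlgebra.pairing_apply, mk_mul, integral_mk]

theorem kernels (hτ : 0 < τ.im) : polarData.Kernels (zetaGerm τ) (phiGerm τ) (dphiGerm τ)
    {μ | theta τ μ ≠ 0} where
  isOpen := isOpen_ne_fun (differentiable_theta τ).continuous continuous_const
  neg_mem μ hμ := by rw [Set.mem_ofPred_eq, theta_neg]; exact neg_ne_zero.2 hμ
  zeta_sub := div_sub_coordInv_mem (analyticAt_theta 0).deriv (analyticAt_theta 0) theta_zero rfl
    (by rw [deriv_theta_zero hτ]; exact one_ne_zero) _
  phi_sub μ hμ := by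
    have hμ : theta τ μ ≠ 0 := hμ
    have h : ∀ hm, mk (fun u => (theta τ (u + μ) / theta τ μ) / theta τ u) hm - coordInv ∈ hol :=
      div_sub_coordInv_mem (analyticAt_theta_add μ 0).div_const (analyticAt_theta 0) theta_zero
        (by rw [deriv_theta_zero hτ, zero_add, div_self hμ])
        (by rw [zero_add, div_self hμ]; exact one_ne_zero)
    simp only [← phi_eq] at h
    exact h (meromorphicAt_phi τ μ 0)
  dphi_mem μ hμ := div_mem_hol (analyticAt_dphi_num μ 0) (analyticAt_theta 0) theta_zero
    (by rw [deriv_theta_zero hτ]; exact one_ne_zero)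
    (by rw [zero_add, mul_comm, sub_self, zero_div]) _
  -- As ζ is not elliptic, small orders are separate: parity for n = 0, skewness of D for n = 1.
  -- From n = 2 on, one integration by parts leaves a product of derivatives of ζ, which is
  -- elliptic.
  zeta_zeta n := by
    match n with
    | 0 => exact (pairing_mk _ _).trans (residueFun_zeta_sq hτ)
    | 1 =>
      have h := testAlgebra.pairing_D (zetaGerm τ) (zetaGerm τ)
      rw [testAlgebra.pairing_comm] at h
      change testAlgebra.pairing (zetaGerm τ) (testAlgebra.D (zetaGerm τ)) = 0
      linear_combination h / 2
    | n + 2 =>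
      have h := testAlgebra.pairing_D (zetaGerm τ) ((⇑testAlgebra.D)^[n + 1] (zetaGerm τ))
      rw [← Function.iterate_succ_apply' (⇑testAlgebra.D)] at h
      rw [← neg_eq_zero, ← h]
      rw [zetaGerm, iterate_D_mk, D_mk, pairing_mk]
      have hs := isStripFunction_zeta hτ
      refine residueFun_eq_zero_of_elliptic hτ (hs.deriv.mul (hs.iterate_deriv _)) fun u hu => ?_
      rw [Pi.mul_apply, Pi.mul_apply, deriv_iterate_zeta_add_tau n hu]
      congr 1
      exact deriv_iterate_zeta_add_tau 0 hu
  phi_phi μ _ n := by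
    rw [phiGerm, phiGerm, iterate_D_mk, pairing_mk]
    exact residueFun_phi_mul hτ (isStripFunction_phi hτ μ) (fun u _ => phi_add_tau μ u) n
  zeta_phi μ hμ n := by
    have hμ : theta τ μ ≠ 0 := hμ
    rw [zetaGerm, phiGerm, phiGerm, dphiGerm, iterate_D_mk, mk_mul, mk_sub, pairing_mk,
      sub_eq_add_neg, ← neg_one_smul ℂ (dphi τ μ)]
    refine residueFun_phi_mul hτ (((isStripFunction_zeta hτ).mul (isStripFunction_phi hτ μ)).add
      ((isStripFunction_dphi hτ μ).const_smul (-1))) (fun u hu => ?_) n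
    simp only [Pi.add_apply, Pi.mul_apply, Pi.smul_apply, smul_eq_mul]
    -- The non-multiplicative terms −2πiφ of ζφ and of ∂_λφ cancel in the difference.
    rw [zeta_add_tau hu, phi_add_tau, dphi_add_tau hμ]
    ring
  D_zeta_phi μ _ m n := by
    rw [zetaGerm, phiGerm, phiGerm, iterate_D_mk, iterate_D_mk, mk_mul, pairing_mk]
    refine residueFun_phi_mul hτ (((isStripFunction_zeta hτ).iterate_deriv _).mul
      (isStripFunction_phi hτ μ)) (fun u hu => ?_) n
    rw [Pi.mul_apply, Pi.mul_apply, phi_add_tau, deriv_iterate_zeta_add_tau m hu]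
    ring
  phi_phi_zeta μ _ k m n := by
    rw [testAlgebra.pairing_mul_rotate, zetaGerm, phiGerm, phiGerm, iterate_D_mk, iterate_D_mk,
      iterate_D_mk, mk_mul, pairing_mk]
    refine residueFun_phi_mul hτ (((isStripFunction_phi hτ _).iterate_deriv n).mul
      ((isStripFunction_zeta hτ).iterate_deriv _)) (fun u hu => ?_) m
    rw [Pi.mul_apply, Pi.mul_apply, deriv_iterate_add_eq_mul (phi_add_tau μ),
      deriv_iterate_zeta_add_tau k hu]
    ring
  hasDerivAt μ hμ s := hasDerivAt_pairing_phiGerm hμ s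

/-- The splitting of the algebra of germs defined by the Green distributions. -/
noncomputable def splitting (hτ : 0 < τ.im) :
    testAlgebra.Splitting (green τ) ⟨0, 0, 0⟩ {μ | theta τ μ ≠ 0} :=
  (kernels hτ).splitting (fun s t => (polarData.pairing_lift_eq_tsum _ s t).symm)
    (fun _ s t => (polarData.pairing_lift_eq_tsum _ s t).symm)
    (fun _ s t => congrArg Neg.neg (polarData.lift_pairing_eq_tsum _ s t).symm)

end LocalField

theorem GreenSystem.rMatrix_zero {K : Type*} (lam : ℂ) :
    (⟨0, 0, 0⟩ : GreenSystem K).rMatrix lam = 0 := by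
  rw [GreenSystem.rMatrix_eq]
  ext p q s t
  simp only [GreenSystem.sixVertex, Matrix.of_apply]
  split_ifs <;> simp

/-! ### The theorem for both algebras. -/

theorem mainTheorem10 (τ lam : ℂ) (hτ : 0 < τ.im) (hlam : ∀ m n : ℤ, lam ≠ m + n * τ) :
    -- the algebra of germs of meromorphic functions
    ((LocalField.green τ).IsRegular LocalField.testAlgebra lam ∧
      (LocalField.testAlgebra.DerivationRelation (LocalField.green τ) lam
          (TestFunctionAlgebra.CurrentAlgebra.current LocalField.testAlgebra)
          (TestFunctionAlgebra.CurrentAlgebra.d LocalField.testAlgebra) ∧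
        (∀ σ, LocalField.testAlgebra.RLLRelation (LocalField.green τ) lam
          (TestFunctionAlgebra.CurrentAlgebra.current LocalField.testAlgebra)
          (TestFunctionAlgebra.CurrentAlgebra.c LocalField.testAlgebra) 0 σ σ) ∧
        LocalField.testAlgebra.RLLRelation (LocalField.green τ) lam
          (TestFunctionAlgebra.CurrentAlgebra.current LocalField.testAlgebra)
          (TestFunctionAlgebra.CurrentAlgebra.c LocalField.testAlgebra)
          (LocalField.testAlgebra.rMatrixU (LocalField.green τ) lam) .pos .neg ∧
        LocalField.testAlgebra.WeightRelation (LocalField.green τ) lam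
          (TestFunctionAlgebra.CurrentAlgebra.current LocalField.testAlgebra)) ∧
      ∀ (A : Type*) [LieRing A] [LieAlgebra ℂ A] (X : Sl2 →ₗ[ℂ] LocalField →ₗ[ℂ] A) (c d : A),
        (∀ a : A, ⁅c, a⁆ = 0) →
        (LocalField.testAlgebra.CurrentDerivation X d ↔
          LocalField.testAlgebra.DerivationRelation (LocalField.green τ) lam X d) ∧
        (LocalField.testAlgebra.CurrentBracket X c ↔
          (∀ σ, LocalField.testAlgebra.RLLRelation (LocalField.green τ) lam X c 0 σ σ) ∧
          LocalField.testAlgebra.RLLRelation (LocalField.green τ) lam X c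
            (LocalField.testAlgebra.rMatrixU (LocalField.green τ) lam) .pos .neg) ∧
        (LocalField.testAlgebra.CurrentBracket X c →
          LocalField.testAlgebra.WeightRelation (LocalField.green τ) lam X)) ∧
    -- the algebra of functions on the cylinder
    ((CylFunctions.green τ).IsRegular CylFunctions.testAlgebra lam ∧
      (∀ p q s t, DifferentiableAt ℂ (fun x => (CylFunctions.green x).rMatrix lam p q s t) τ) ∧
      (CylFunctions.testAlgebra.DerivationRelation (CylFunctions.green τ) lam
          (TestFunctionAlgebra.CurrentAlgebra.current CylFunctions.testAlgebra)
          (TestFunctionAlgebra.CurrentAlgebra.d CylFunctions.testAlgebra) ∧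
        (∀ σ, CylFunctions.testAlgebra.RLLRelation (CylFunctions.green τ) lam
          (TestFunctionAlgebra.CurrentAlgebra.current CylFunctions.testAlgebra)
          (TestFunctionAlgebra.CurrentAlgebra.c CylFunctions.testAlgebra)
          (-GreenSystem.rMatrixModulus CylFunctions.green τ lam) σ σ) ∧
        CylFunctions.testAlgebra.RLLRelation (CylFunctions.green τ) lam
          (TestFunctionAlgebra.CurrentAlgebra.current CylFunctions.testAlgebra)
          (TestFunctionAlgebra.CurrentAlgebra.c CylFunctions.testAlgebra)
          (CylFunctions.testAlgebra.rMatrixU (CylFunctions.green τ) lam -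
            GreenSystem.rMatrixModulus CylFunctions.green τ lam) .pos .neg ∧
        CylFunctions.testAlgebra.WeightRelation (CylFunctions.green τ) lam
          (TestFunctionAlgebra.CurrentAlgebra.current CylFunctions.testAlgebra)) ∧
      ∀ (A : Type*) [LieRing A] [LieAlgebra ℂ A] (X : Sl2 →ₗ[ℂ] CylFunctions →ₗ[ℂ] A) (c d : A),
        (∀ a : A, ⁅c, a⁆ = 0) →
        (CylFunctions.testAlgebra.CurrentDerivation X d ↔
          CylFunctions.testAlgebra.DerivationRelation (CylFunctions.green τ) lam X d) ∧
        (CylFunctions.testAlgebra.CurrentBracket X c ↔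
          (∀ σ, CylFunctions.testAlgebra.RLLRelation (CylFunctions.green τ) lam X c
            (-GreenSystem.rMatrixModulus CylFunctions.green τ lam) σ σ) ∧
          CylFunctions.testAlgebra.RLLRelation (CylFunctions.green τ) lam X c
            (CylFunctions.testAlgebra.rMatrixU (CylFunctions.green τ) lam -
              GreenSystem.rMatrixModulus CylFunctions.green τ lam) .pos .neg) ∧
        (CylFunctions.testAlgebra.CurrentBracket X c →
          CylFunctions.testAlgebra.WeightRelation (CylFunctions.green τ) lam X)) := by

  have hS : lam ∈ {μ | EllipticTheta.theta τ μ ≠ 0} := fun h => by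
    obtain ⟨m, n, h⟩ := (EllipticTheta.theta_eq_zero_iff hτ lam).1 h
    exact hlam m n h
  let V := LocalField.splitting hτ
  let W := CylFunctions.splitting hτ
  have hV := (V.currentBracket_iff _ _ hS).1 (TestFunctionAlgebra.CurrentAlgebra.currentBracket _)
  have hW := (W.currentBracket_iff _ _ hS).1 (TestFunctionAlgebra.CurrentAlgebra.currentBracket _)
  rw [GreenSystem.rMatrix_zero, add_zero] at hV
  rw [CylFunctions.rMatrix_centralSystem, ← sub_eq_add_neg] at hW
  refine ⟨⟨V.isRegular hS, ⟨(V.currentDerivation_iff _ _ hS).1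
      (TestFunctionAlgebra.CurrentAlgebra.currentDerivation _), hV.1, hV.2,
      V.weightRelation _ (TestFunctionAlgebra.CurrentAlgebra.currentBracket _) hS⟩,
      fun A _ _ X c d _ => ⟨V.currentDerivation_iff X d hS, ?_, fun h => V.weightRelation X h hS⟩⟩,
    W.isRegular hS, CylFunctions.differentiableAt_rMatrix hτ hS, ⟨(W.currentDerivation_iff _ _ hS).1
      (TestFunctionAlgebra.CurrentAlgebra.currentDerivation _), hW.1, hW.2,
      W.weightRelation _ (TestFunctionAlgebra.CurrentAlgebra.currentBracket _) hS⟩,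
    fun A _ _ X c d _ => ⟨W.currentDerivation_iff X d hS, ?_, fun h => W.weightRelation X h hS⟩⟩
  · have h := V.currentBracket_iff X c hS
    rwa [GreenSystem.rMatrix_zero, add_zero] at h
  · have h := W.currentBracket_iff X c hS
    rwa [CylFunctions.rMatrix_centralSystem, ← sub_eq_add_neg] at h
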